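/- Let $A$ be a finite alphabet and $\xi$ a primitive proper substitution on $A$. (A substitution is given by words $\xi(b)\in A^*$, $b\in A$, such that some $\xi(a)$ begins with $a$ and $|\xi^n(b)|\to\infty$ for every $b$; it is proper if all words $\xi(b)$ begin with one and the same letter and all end with one and the same letter.) Let $M$ be its incidence matrix ($M_{ij}$ is the number of occurrences of $i$ in $\xi(j)$; $\xi$ is primitive if some power of $M$ is positive), let $\Omega_\xi\subset A^{\mathbb Z}$ be the set of bi-infinite sequences all of whose finite factors occur in words $\xi^n(b)$, $n\ge 0$, $b\in A$, let $S$ be the shift $(Sx)_n=x_{n+1}$ on $\Omega_\xi$, and let $\mu$ be an (in fact, the) $S$-invariant Borel probability measure on $\Omega_\xi$. Let $E^s\subset\mathbb R^{A}$ be the sum of the real generalized eigenspaces of $M^t$ for the eigenvalues $z$ with $0<|z|<1$; equivalently, the set of $v\in\bigcap_{k}(M^t)^k\mathbb R^{A}$ with $(M^t)^kv\to 0$. Put $d-1=\dim E^s$. Assume: i) the characteristic polynomial of $M$ has a unique complex root of modulus greater than one; ii) there are real numbers $\alpha_1,\dots,\alpha_{d-1}$ such that $1,\alpha_1,\dots,\alpha_{d-1}$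 are rationally independent and each $\exp(2i\pi\alpha_j)$ is an eigenvalue of $(\Omega_\xi,S,\mu)$, i.e. $f\circ S=\exp(2i\pi\alpha_j)f$ for some non-zero $f\in L^2(\mu)$. Then there are vectors $v(1),\dots,v(d-1)\in E^s$ and $w(1),\dots,w(d-1)\in\mathbb R^{A}$ with $\alpha_j(1,\dots,1)^t=v(j)+w(j)$ and $(M^t)^{m_j}w(j)\in\mathbb Z^{A}$ for some $m_j\ge 0$. For all such vectors the following holds. For $k\ge1$, $x\in\Omega_\xi$ and $a\in A$ let $r_k(x)=\min\{i\ge 0:\ S^ix\in\xi^{k-1}(\Omega_\xi)\}$ and $$s_k(x)_a=\#\{\,r_k(x)\le i<r_{k+1}(x):\ S^ix\in\xi^{k-1}([a])\,\},\qquad [a]=\{y\in\Omega_\xi:\ y_0=a\},$$ where $\xi$ acts on sequences by $\xi(\cdots x_{-1}.x_0x_1\cdots)=\cdots\xi(x_{-1}).\xi(x_0)\xi(x_1)\cdots$. Then the series $$F(x)=\Big(\sum_{k\ge 1}\langle s_k(x),(M^t)^k v(j)\rangle\Big)_{1\le j\le d-1}\in\mathbb R^{d-1}$$ converges uniformly on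 $\Omega_\xi$, and for every clopen set $c\subset\Omega_\xi$ the image $F(c)$ is regular, i.e. it is compact and equals the closure of its interior in $\mathbb R^{d-1}$. -/

import Mathlib

open Filter Topology MeasureTheory

namespace PisotRegular

/-- The shift iterated `k` times on bi-infinite sequences: `(S^k x)_n = x_{n+k}`. -/
def shiftBy {A : Type*} (k : ℕ) (x : ℤ → A) : ℤ → A := fun n => x (n + k)

/-- The word `x_i x_{i+1} ⋯ x_{i+l-1}`. -/
def factor {A : Type*} (x : ℤ → A) (i : ℤ) (l : ℕ) : List A :=
  List.ofFn fun j : Fin l => x (i + (j : ℕ))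

/-- An endomorphism of the free monoid `A^*` is given by the images `ξ a` of the letters;
`iter ξ n` is its `n`-th power `ξ^n`. -/
def iter {A : Type*} (ξ : A → List A) : ℕ → A → List A
  | 0 => fun a => [a]
  | n + 1 => fun a => (iter ξ n a).flatMap ξ

/-- `ξ` is a substitution: `ξ a` begins with `a` for some letter `a`, and `|ξ^n b| → ∞`
for every letter `b`. -/
def IsSubstitution {A : Type*} (ξ : A → List A) : Prop :=
  (∃ a, (ξ a).head? = some a) ∧
    ∀ b, Tendsto (fun n => (iter ξ n b).length) atTop atTop

/-- `ξ` is proper: the words `ξ b` all begin with one letter and all end with one letter. -/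
def IsProper {A : Type*} (ξ : A → List A) : Prop :=
  (∃ a, ∀ b, (ξ b).head? = some a) ∧ ∃ a, ∀ b, (ξ b).getLast? = some a

/-- The incidence matrix: the entry `(i, j)` is the number of occurrences of `i` in `ξ j`. -/
def incidence {A : Type*} [DecidableEq A] (ξ : A → List A) : Matrix A A ℝ :=
  Matrix.of fun i j => ((ξ j).count i : ℝ)

/-- `ξ` is primitive: some power of the incidence matrix has strictly positive entries. -/
def IsPrimitiveSubst {A : Type*} [Fintype A] [DecidableEq A] (ξ : A → List A) : Prop :=
  (incidence ξ).IsPrimitive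

/-- The language of `ξ`: the words that occur in some `ξ^n b`. -/
def language {A : Type*} (ξ : A → List A) : Set (List A) :=
  {u | ∃ (n : ℕ) (b : A), u <:+: iter ξ n b}

/-- The substitutive subshift `Ω_ξ`: the bi-infinite sequences all of whose factors belong to
the language of `ξ`. -/
def Omega {A : Type*} (ξ : A → List A) : Set (ℤ → A) :=
  {x | ∀ (i : ℤ) (l : ℕ), factor x i l ∈ language ξ}

/-- The shift `S : Ω_ξ → Ω_ξ`. -/
def shift {A : Type*} (ξ : A → List A) (x : Omega ξ) : Omega ξ :=
  ⟨shiftBy 1 x.1, fun i l => by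
    have h := x.2 (i + 1) l
    have e : factor (shiftBy 1 x.1) i l = factor x.1 (i + 1) l := by
      unfold factor shiftBy
      congr 1
      funext j
      exact congrArg x.1 (by push_cast; omega)
    rw [e]
    exact h⟩

/-- `y = σ(x)`, the concatenation `⋯ σ(x_{-1}) . σ(x_0) σ(x_1) ⋯`: the block `σ(x_n)` occupies
the places `p n, …, p (n + 1) - 1` of `y`, and `p 0 = 0`. -/
def IsImage {A : Type*} (σ : A → List A) (x y : ℤ → A) : Prop :=
  ∃ p : ℤ → ℤ, p 0 = 0 ∧ (∀ n, p (n + 1) = p n + ((σ (x n)).length : ℤ)) ∧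
    ∀ (n : ℤ) (j : ℕ) (hj : j < (σ (x n)).length), y (p n + j) = (σ (x n))[j]

/-- The image `σ(C)` of a set `C` of sequences. -/
def imageSet {A : Type*} (σ : A → List A) (C : Set (ℤ → A)) : Set (ℤ → A) :=
  {y | ∃ x ∈ C, IsImage σ x y}

/-- The cylinder `[a] = {x ∈ Ω_ξ ; x_0 = a}`. -/
def cyl {A : Type*} (ξ : A → List A) (a : A) : Set (ℤ → A) :=
  {x | x ∈ Omega ξ ∧ x 0 = a}

/-- The entrance time `r_n(x) = min {k ≥ 0 ; S^k x ∈ ξ^{n-1}(Ω_ξ)}`, for `n ≥ 1`. -/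
noncomputable def entrance {A : Type*} (ξ : A → List A) (n : ℕ) (x : ℤ → A) : ℕ :=
  sInf {k : ℕ | shiftBy k x ∈ imageSet (iter ξ (n - 1)) (Omega ξ)}

/-- The counting vector, for `k ≥ 1`:
`s_k(x)_a = #{r_k(x) ≤ i < r_{k+1}(x) ; S^i x ∈ ξ^{k-1}([a])}`. -/
noncomputable def visits {A : Type*} (ξ : A → List A) (k : ℕ) (x : ℤ → A) (a : A) : ℕ :=
  Set.ncard {i : ℕ | entrance ξ k x ≤ i ∧ i < entrance ξ (k + 1) x ∧
    shiftBy i x ∈ imageSet (iter ξ (k - 1)) (cyl ξ a)}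

/-- The vectors that tend to `0` under the iterates of `B`. -/
def contracted {A : Type*} [Fintype A] [DecidableEq A] (B : Matrix A A ℝ) :
    Submodule ℝ (A → ℝ) where
  carrier := {v | Tendsto (fun k : ℕ => (B ^ k).mulVec v) atTop (𝓝 0)}
  zero_mem' := by simp
  add_mem' := by
    intro u v hu hv
    have h := Tendsto.add hu hv
    simpa [Matrix.mulVec_add] using h
  smul_mem' := by
    intro c v hv
    have h := Tendsto.const_smul hv c
    simpa [Matrix.mulVec_smul] using h

/-- The space `E^s` of `M_ξ^t`. The intersection of the ranges of the powers of `M_ξ^t` is the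
invariant complement of the generalized kernel, on which `M_ξ^t` is bijective; `E^s` consists of
the vectors of it that are contracted, i.e. it is the sum of the generalized eigenspaces of
the eigenvalues `z` with `0 < |z| < 1`. -/
def stableSpace {A : Type*} [Fintype A] [DecidableEq A] (ξ : A → List A) :
    Submodule ℝ (A → ℝ) :=
  contracted (incidence ξ).transpose ⊓
    ⨅ k : ℕ, LinearMap.range (((incidence ξ).transpose ^ k).mulVecLin)

/-- `z` is an eigenvalue of the measurable dynamical system `(X, μ, T)`: there is a non-zero
`f ∈ L²(μ)` with `f ∘ T = z f`. -/
def IsEigenvalue {X : Type*} [MeasurableSpace X] (μ : Measure X) (T : X → X) (z : ℂ) : Prop :=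
  ∃ f : X → ℂ, MemLp f 2 μ ∧ ¬ f =ᵐ[μ] 0 ∧ (fun x => f (T x)) =ᵐ[μ] fun x => z * f x

/-- The characteristic polynomial of the incidence matrix has exactly one complex root of
modulus greater than one. -/
def HypI {A : Type*} [Fintype A] [DecidableEq A] (ξ : A → List A) : Prop :=
  ∃! β : ℂ, ((incidence ξ).charpoly.map (algebraMap ℝ ℂ)).IsRoot β ∧ 1 < ‖β‖

/-- `dim E^s = n`, the numbers `exp(2iπα_1), …, exp(2iπα_n)` are eigenvalues of `(Ω_ξ, S, μ)`, and
`1, α_1, …, α_n` are rationally independent. -/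
def HypII {A : Type*} [Fintype A] [DecidableEq A] [MeasurableSpace A] (ξ : A → List A)
    (μ : Measure (Omega ξ)) {n : ℕ} (α : Fin n → ℝ) : Prop :=
  Module.finrank ℝ (stableSpace ξ) = n ∧
    (∀ i, IsEigenvalue μ (shift ξ) (Complex.exp (2 * Real.pi * Complex.I * (α i : ℂ)))) ∧
    LinearIndependent ℚ (Fin.cons 1 α : Fin (n + 1) → ℝ)

/-- `α (1, …, 1)^t = v + w` with `v ∈ E^s` and `(M_ξ^t)^m w` an integer vector for some `m`. -/
def IsDecomposition {A : Type*} [Fintype A] [DecidableEq A] (ξ : A → List A) (α : ℝ)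
    (v w : A → ℝ) : Prop :=
  (∀ a, α = v a + w a) ∧ v ∈ stableSpace ξ ∧
    ∃ m : ℕ, ∀ a, ∃ z : ℤ, (((incidence ξ).transpose ^ m).mulVec w) a = z

/-- The `k`-th term of the series of `F`, for `k ≥ 1`: its coordinates are
`⟨s_k(x), (M_ξ^t)^k v(i)⟩`. -/
noncomputable def seriesTerm {A : Type*} [Fintype A] [DecidableEq A] (ξ : A → List A) {n : ℕ}
    (v : Fin n → A → ℝ) (k : ℕ) (x : Omega ξ) : Fin n → ℝ :=
  fun i => ∑ a, (visits ξ k x.1 a : ℝ) * (((incidence ξ).transpose ^ k).mulVec (v i)) a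

/-- `F(x) = (∑_{k ≥ 1} ⟨s_k(x), (M_ξ^t)^k v(i)⟩)_i`. -/
noncomputable def F {A : Type*} [Fintype A] [DecidableEq A] (ξ : A → List A) {n : ℕ}
    (v : Fin n → A → ℝ) (x : Omega ξ) : Fin n → ℝ :=
  ∑' k : ℕ, seriesTerm ξ v (k + 1) x

/-- A compact set is regular if it is the closure of its interior. -/
def IsRegularSet {n : ℕ} (K : Set (Fin n → ℝ)) : Prop :=
  IsCompact K ∧ closure (interior K) = K

end PisotRegular

/-! Put V(a) = (v(1)_a, …, v(d-1)_a), W likewise, and let G(x) be the limit as k → ∞ of the sums of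
V over x_0 ⋯ x_{r_k(x)-1} (`limitMap`). By recognizability x = S^{-r} ξ^k(y) with r = r_{k+1}(x),
and the stretch of x from r_{k+1}(x) to r_{k+2}(x) is the image by ξ^k of a stretch of y of bounded
length. Its V-sum is bounded by a multiple of the size of (M^t)^k v, which is summable on E^s; so G
is a uniform limit. The series F is the same construction for the weight M^t v (`seriesTerm_eq`),
and F = L ∘ G, with L the matrix of M^t in the family v(j).

Interior. Let u be a fixed point of ξ. As α(1, …, 1)^t = v + w in each coordinate, G(S^{-i}u) is iα
minus the W-sum of u_{-i} ⋯ u_{-1}. The W-sums of the words ξ^m a are integral for some m, so modulo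
integer vectors only finitely many W-sums occur. The multiples of α are dense modulo integers
(Kronecker), hence finitely many translates of the compact set G(Ω) cover the torus, and Baire's
theorem gives a letter b such that G({y : y_{-1} = b}) has an interior point
(`exists_nonempty_interior`). A linear relation among the v(j) would confine G to a hyperplane; so
they form a basis of E^s, and L is invertible.

Regularity. On the points at distance r before a cut of level k that follows ξ^k b, G is G(y)
followed by an affine automorphism (`limitMap_tower`). Primitivity carries interior points from one
letter to all; properness fixes the surroundings of a cut, so that these pieces lie in prescribed
clopen neighbourhoods while their images are small. Each point of G(c) is thus a limit of interior
points (`isRegularSet_image_limitMap`).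

Two inputs come from the eigenvalues. An irrational eigenvalue excludes periods, and aperiodicity
gives recognizability by counting occurrences (`eventually_exists_occurrence`). Moreover an
eigenvalue z satisfies z^{|ξ^n b|} → 1 (`tendsto_pow_length`), from which Host's argument produces v
and w (`exists_isDecomposition`). -/

namespace PisotRegular

/-! ### Occurrences of words, additive cocycles and the action of a morphism on bi-infinite
sequences -/

section Words

variable {A : Type*} {E : Type*} [AddCommGroup E]

/-- Translation of a bi-infinite sequence by an integer. -/
def tr (c : ℤ) (x : ℤ → A) : ℤ → A := fun n => x (n + c)

@[simp] lemma tr_apply (c : ℤ) (x : ℤ → A) (n : ℤ) : tr c x n = x (n + c) := rfl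

@[simp] lemma tr_zero (x : ℤ → A) : tr 0 x = x := by ext n; simp

lemma tr_tr (c d : ℤ) (x : ℤ → A) : tr c (tr d x) = tr (c + d) x := by
  ext n; simp [add_assoc]

lemma shiftBy_eq_tr (k : ℕ) (x : ℤ → A) : shiftBy k x = tr k x := rfl

/-- The word `u` occurs in `x` at the place `c`. -/
def Occ (x : ℤ → A) (c : ℤ) (u : List A) : Prop :=
  ∀ (j : ℕ) (hj : j < u.length), x (c + j) = u[j]

lemma occ_nil (x : ℤ → A) (c : ℤ) : Occ x c [] := fun j hj => by simp at hj

lemma occ_append {x : ℤ → A} {c : ℤ} {u v : List A} :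
    Occ x c (u ++ v) ↔ Occ x c u ∧ Occ x (c + u.length) v := by
  constructor
  · intro h
    refine ⟨fun j hj => ?_, fun j hj => ?_⟩
    · rw [h j (by simp; omega), List.getElem_append_left hj]
    · have := h (u.length + j) (by simp; omega)
      rw [List.getElem_append_right (by omega)] at this
      simp only [Nat.add_sub_cancel_left, Nat.cast_add, ← add_assoc] at this
      exact this
  · rintro ⟨h1, h2⟩ j hj
    by_cases hju : j < u.length
    · rw [h1 j hju, List.getElem_append_left hju]
    · have := h2 (j - u.length) (by simp at hj; omega)
      rw [List.getElem_append_right (by omega), ← this]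
      congr 1
      omega

lemma occ_cons {x : ℤ → A} {c : ℤ} {a : A} {u : List A} :
    Occ x c (a :: u) ↔ x c = a ∧ Occ x (c + 1) u := by
  have h : Occ x c [a] ↔ x c = a := by
    constructor
    · intro h; simpa using h 0 (by simp)
    · intro h j hj
      obtain rfl : j = 0 := by simpa using hj
      simpa using h
  rw [← h]
  simpa using occ_append (x := x) (c := c) (u := [a]) (v := u)

lemma occ_singleton {x : ℤ → A} {c : ℤ} {a : A} : Occ x c [a] ↔ x c = a := by
  simp [occ_cons, occ_nil]

@[simp] lemma length_factor (x : ℤ → A) (c : ℤ) (l : ℕ) : (factor x c l).length = l := by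
  simp [factor]

lemma occ_factor (x : ℤ → A) (c : ℤ) (l : ℕ) : Occ x c (factor x c l) := by
  intro j hj
  simp [factor]

lemma Occ.eq_factor {x : ℤ → A} {c : ℤ} {u : List A} (h : Occ x c u) :
    u = factor x c u.length := by
  apply List.ext_getElem (by simp)
  intro j h1 h2
  rw [← h j h1, ← occ_factor x c u.length j h2]

lemma occ_tr {x : ℤ → A} {c d : ℤ} {u : List A} : Occ (tr d x) c u ↔ Occ x (c + d) u := by
  unfold Occ
  simp only [tr_apply]
  have (j : ℕ) : c + j + d = c + d + j := by ring
  simp only [this]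

lemma Occ.infix_of_le {x : ℤ → A} {c d : ℤ} {u w : List A} (hu : Occ x c u) (hw : Occ x d w)
    (h1 : d ≤ c) (h2 : c + u.length ≤ d + w.length) :
    ∃ p q, w = p ++ u ++ q ∧ (p.length : ℤ) = c - d := by
  obtain ⟨k, hk⟩ := Int.eq_ofNat_of_zero_le (sub_nonneg.2 h1)
  have hkw : k + u.length ≤ w.length := by omega
  refine ⟨w.take k, w.drop (k + u.length), ?_, ?_⟩
  · have : u = (w.drop k).take u.length := by
      apply List.ext_getElem
      · simp; omega
      · intro j h3 h4
        rw [List.getElem_take, List.getElem_drop, ← hw, ← hu j h3]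
        congr 1; push_cast; omega
    have e := List.take_append_drop u.length (w.drop k)
    rw [← this, List.drop_drop] at e
    rw [List.append_assoc, e, List.take_append_drop]
  · simp; omega

/-- The sum of `v` over the letters of a word. -/
def wt (v : A → E) (u : List A) : E := (u.map v).sum

@[simp] lemma wt_nil (v : A → E) : wt v [] = 0 := rfl
@[simp] lemma wt_cons (v : A → E) (a : A) (u : List A) : wt v (a :: u) = v a + wt v u := by
  simp [wt]
@[simp] lemma wt_append (v : A → E) (u w : List A) : wt v (u ++ w) = wt v u + wt v w := by
  simp [wt]

lemma wt_flatMap (v : A → E) (σ : A → List A) (u : List A) :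
    wt v (u.flatMap σ) = wt (fun a => wt v (σ a)) u := by
  induction u with
  | nil => rfl
  | cons a u ih => simp [ih]

lemma map_wt {E' : Type*} [AddCommGroup E'] (L : E →+ E') (v : A → E) (u : List A) :
    wt (fun a => L (v a)) u = L (wt v u) := by
  induction u with
  | nil => simp
  | cons a u ih => simp [ih]

lemma wt_length (σ : A → List A) (u : List A) :
    wt (fun a => ((σ a).length : ℤ)) u = (u.flatMap σ).length := by
  induction u with
  | nil => simp
  | cons a u ih => simp only [wt_cons, ih, List.flatMap_cons, List.length_append]; push_cast; rfl

/-- The additive cocycle of `v` over the shift: the sum of `v` over `x_0 ⋯ x_{n-1}` for `n ≥ 0`,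
extended to negative `n` by the cocycle rule. -/
def cum (v : A → E) (x : ℤ → A) : ℤ → E
  | Int.ofNat n => ∑ i ∈ Finset.range n, v (x i)
  | Int.negSucc n => -∑ i ∈ Finset.range (n + 1), v (x (-(i + 1)))

@[simp] lemma cum_zero (v : A → E) (x : ℤ → A) : cum v x 0 = 0 := by
  change cum v x (Int.ofNat 0) = 0
  simp [cum]

lemma cum_natCast (v : A → E) (x : ℤ → A) (n : ℕ) :
    cum v x n = ∑ i ∈ Finset.range n, v (x i) := rfl

lemma cum_succ (v : A → E) (x : ℤ → A) (n : ℤ) : cum v x (n + 1) = cum v x n + v (x n) := by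
  match n with
  | Int.ofNat n =>
    change cum v x (Int.ofNat (n + 1)) = _
    simp [cum, Finset.sum_range_succ]
  | Int.negSucc 0 =>
    change cum v x (0 : ℤ) = _
    simp [cum]
  | Int.negSucc (n + 1) =>
    change cum v x (Int.negSucc n) = _
    simp only [cum]
    rw [Finset.sum_range_succ _ (n + 1)]
    have : (Int.negSucc (n + 1)) = -(((n + 1 : ℕ) : ℤ) + 1) := by omega
    rw [this]
    abel

/-- A cocycle is determined by its value at 0 and its increments; most identities for `cum` and
`cuts` below are instances of this uniqueness. -/
lemma eq_cum {v : A → E} {x : ℤ → A} {g : ℤ → E} (h0 : g 0 = 0)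
    (h : ∀ n, g (n + 1) = g n + v (x n)) (n : ℤ) : g n = cum v x n := by
  induction n using Int.induction_on with
  | zero => simp [h0]
  | succ n ih => rw [h, cum_succ, ih]
  | pred n ih =>
    have h1 := h (-n - 1)
    have h2 := cum_succ v x (-n - 1)
    rw [sub_add_cancel] at h1 h2
    rw [h1, h2] at ih
    exact add_right_cancel ih

lemma cum_tr (v : A → E) (x : ℤ → A) (c n : ℤ) :
    cum v (tr c x) n = cum v x (n + c) - cum v x c := by
  symm
  apply eq_cum (g := fun n => cum v x (n + c) - cum v x c)
  · simp
  · intro n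
    have : n + 1 + c = n + c + 1 := by ring
    simp only [this, cum_succ, tr_apply]
    abel

lemma map_cum {E' : Type*} [AddCommGroup E'] (L : E →+ E') (v : A → E) (x : ℤ → A) (n : ℤ) :
    cum (fun a => L (v a)) x n = L (cum v x n) := by
  symm
  apply eq_cum (g := fun n => L (cum v x n))
  · simp
  · intro n; simp [cum_succ]

lemma Occ.cum_add {x : ℤ → A} {c : ℤ} {u : List A} (h : Occ x c u) (v : A → E) :
    cum v x (c + u.length) = cum v x c + wt v u := by
  induction u generalizing c with
  | nil => simp
  | cons a u ih =>
    rw [occ_cons] at h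
    have := ih h.2
    simp only [List.length_cons, wt_cons]
    rw [← h.1, ← add_assoc, ← cum_succ, ← this]
    congr 1; push_cast; ring

/-- A strictly increasing integer sequence moves by at least one at each step, so it is unbounded on
both sides and a greatest `n` with `f n ≤ m` exists. Applied to cuts, it finds the block that
contains a place. -/
lemma exists_block {f : ℤ → ℤ} (hf : ∀ n, f n < f (n + 1)) (m : ℤ) :
    ∃ n, f n ≤ m ∧ m < f (n + 1) := by
  have hm : StrictMono f := strictMono_int_of_lt_succ hf
  have h1 : ∀ n : ℕ, f 0 + n ≤ f n := by
    intro n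
    induction n with
    | zero => simp
    | succ n ih => have := hf n; push_cast; omega
  have h2 : ∀ n : ℕ, f (-n) ≤ f 0 - n := by
    intro n
    induction n with
    | zero => simp
    | succ n ih =>
      have := hf (-(n : ℤ) - 1)
      rw [sub_add_cancel] at this
      have e : -((n + 1 : ℕ) : ℤ) = -(n : ℤ) - 1 := by push_cast; ring
      rw [e]; push_cast; omega
  obtain ⟨n, hn, hmax⟩ := Int.exists_greatest_of_bdd (P := fun n => f n ≤ m)
    ⟨(m - f 0).toNat, fun z hz => by
      by_contra hlt
      have hz' : 0 ≤ z := by omega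
      obtain ⟨k, rfl⟩ := Int.eq_ofNat_of_zero_le hz'
      have := h1 k
      omega⟩
    ⟨-((f 0 - m).toNat : ℤ), by have := h2 (f 0 - m).toNat; omega⟩
  refine ⟨n, hn, ?_⟩
  by_contra h
  have := hmax (n + 1) (not_lt.1 h)
  omega

/-- The places at which the blocks `σ (x n)` begin in `σ(x)`. -/
def cuts (σ : A → List A) (x : ℤ → A) : ℤ → ℤ := cum (fun a => ((σ a).length : ℤ)) x

@[simp] lemma cuts_zero (σ : A → List A) (x : ℤ → A) : cuts σ x 0 = 0 := cum_zero _ _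

lemma cuts_succ (σ : A → List A) (x : ℤ → A) (n : ℤ) :
    cuts σ x (n + 1) = cuts σ x n + (σ (x n)).length := cum_succ _ _ _

lemma cuts_lt_succ {σ : A → List A} (hσ : ∀ a, σ a ≠ []) (x : ℤ → A) (n : ℤ) :
    cuts σ x n < cuts σ x (n + 1) := by
  have := List.length_pos_iff.2 (hσ (x n))
  rw [cuts_succ]; omega

lemma cuts_strictMono {σ : A → List A} (hσ : ∀ a, σ a ≠ []) (x : ℤ → A) :
    StrictMono (cuts σ x) := strictMono_int_of_lt_succ (cuts_lt_succ hσ x)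

open Classical in
/-- The bi-infinite sequence `σ(x)`. -/
noncomputable def sub (σ : A → List A) (x : ℤ → A) (m : ℤ) : A :=
  let n := Classical.epsilon fun n => cuts σ x n ≤ m ∧ m < cuts σ x (n + 1)
  -- When no word `σ a` is empty the chosen block contains `m`, and the default `x 0` is never used.
  (σ (x n)).getD (m - cuts σ x n).toNat (x 0)

lemma occ_sub {σ : A → List A} (hσ : ∀ a, σ a ≠ []) (x : ℤ → A) (n : ℤ) :
    Occ (sub σ x) (cuts σ x n) (σ (x n)) := by
  intro j hj
  set m := cuts σ x n + j with hm
  have hs := Classical.epsilon_spec (exists_block (cuts_lt_succ hσ x) m)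
  have hmono := cuts_strictMono hσ x
  have hn : Classical.epsilon (fun n => cuts σ x n ≤ m ∧ m < cuts σ x (n + 1)) = n := by
    set n' := Classical.epsilon (fun n => cuts σ x n ≤ m ∧ m < cuts σ x (n + 1))
    have h1 : m < cuts σ x (n + 1) := by rw [cuts_succ]; omega
    have h2 : n' < n + 1 := hmono.lt_iff_lt.1 (hs.1.trans_lt h1)
    have h3 : n < n' + 1 := hmono.lt_iff_lt.1 (lt_of_le_of_lt (by omega) hs.2)
    omega
  unfold sub
  simp only [hn]
  have : (m - cuts σ x n).toNat = j := by omega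
  rw [this, List.getD_eq_getElem _ _ hj]

lemma eq_sub {σ : A → List A} (hσ : ∀ a, σ a ≠ []) {x y : ℤ → A}
    (h : ∀ n, Occ y (cuts σ x n) (σ (x n))) : y = sub σ x := by
  ext m
  obtain ⟨n, h1, h2⟩ := exists_block (cuts_lt_succ hσ x) m
  obtain ⟨j, hj⟩ := Int.eq_ofNat_of_zero_le (sub_nonneg.2 h1)
  rw [cuts_succ] at h2
  have hj' : j < (σ (x n)).length := by omega
  have e : m = cuts σ x n + j := by omega
  rw [e, h n j hj', occ_sub hσ x n j hj']

lemma isImage_iff {σ : A → List A} (hσ : ∀ a, σ a ≠ []) {x y : ℤ → A} :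
    IsImage σ x y ↔ y = sub σ x := by
  constructor
  · rintro ⟨p, h0, hs, h⟩
    have hp : ∀ n, p n = cuts σ x n := eq_cum h0 hs
    apply eq_sub hσ
    intro n j hj
    rw [← hp, h n j hj]
  · rintro rfl
    exact ⟨cuts σ x, cuts_zero _ _, cuts_succ _ _, fun n => occ_sub hσ x n⟩

lemma mem_imageSet_iff {σ : A → List A} (hσ : ∀ a, σ a ≠ []) {C : Set (ℤ → A)} {y : ℤ → A} :
    y ∈ imageSet σ C ↔ ∃ x ∈ C, y = sub σ x := by
  simp [imageSet, isImage_iff hσ]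

lemma Occ.cuts_add {x : ℤ → A} {c : ℤ} {u : List A} (h : Occ x c u) (σ : A → List A) :
    cuts σ x (c + u.length) = cuts σ x c + (u.flatMap σ).length := by
  rw [cuts, h.cum_add, wt_length]

lemma Occ.sub {σ : A → List A} (hσ : ∀ a, σ a ≠ []) {x : ℤ → A} {c : ℤ} {u : List A}
    (h : Occ x c u) : Occ (sub σ x) (cuts σ x c) (u.flatMap σ) := by
  induction u generalizing c with
  | nil => exact occ_nil _ _
  | cons a u ih =>
    rw [occ_cons] at h
    rw [List.flatMap_cons, occ_append]
    have h2 := ih h.2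
    rw [cuts_succ, h.1] at h2
    refine ⟨?_, h2⟩
    have := occ_sub hσ x c
    rwa [h.1] at this

/-- Each block contributes its own weight, so summing `v` along the cuts of `σ(x)` amounts to
summing over `x` the transformed weight. For `σ = ξ` that weight is M^t v: all renormalization below
rests on this. -/
lemma cum_sub {σ : A → List A} (hσ : ∀ a, σ a ≠ []) (v : A → E) (x : ℤ → A) (n : ℤ) :
    cum v (sub σ x) (cuts σ x n) = cum (fun a => wt v (σ a)) x n := by
  apply eq_cum (g := fun n => cum v (sub σ x) (cuts σ x n))
  · simp
  · intro n
    simp only [cuts_succ]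
    exact (occ_sub hσ x n).cum_add v

lemma cuts_sub {σ : A → List A} (hσ : ∀ a, σ a ≠ []) (τ : A → List A) (x : ℤ → A) (n : ℤ) :
    cuts τ (sub σ x) (cuts σ x n) = cuts (fun a => (σ a).flatMap τ) x n := by
  rw [cuts, cum_sub hσ]
  simp only [wt_length, cuts]

lemma sub_sub_eq {σ τ : A → List A} (hσ : ∀ a, σ a ≠ []) (hτ : ∀ a, τ a ≠ []) (x : ℤ → A) :
    sub τ (sub σ x) = sub (fun a => (σ a).flatMap τ) x := by
  apply eq_sub
  · intro a h
    rw [List.flatMap_eq_nil_iff] at h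
    obtain ⟨b, hb⟩ := List.exists_mem_of_ne_nil _ (hσ a)
    exact hτ b (h b hb)
  · intro n
    rw [← cuts_sub hσ]
    exact (occ_sub hσ x n).sub hτ

lemma cuts_tr (σ : A → List A) (x : ℤ → A) (c n : ℤ) :
    cuts σ (tr c x) n = cuts σ x (n + c) - cuts σ x c := cum_tr _ _ _ _

lemma tr_sub {σ : A → List A} (hσ : ∀ a, σ a ≠ []) (x : ℤ → A) (n : ℤ) :
    tr (cuts σ x n) (sub σ x) = sub σ (tr n x) := by
  apply eq_sub hσ
  intro m
  rw [occ_tr, cuts_tr, sub_add_cancel]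
  exact occ_sub hσ x (m + n)

end Words

/-! ### Powers of the substitution -/

section Iter

variable {A : Type*} {ξ : A → List A}

@[simp] lemma iter_zero (ξ : A → List A) (a : A) : iter ξ 0 a = [a] := rfl

lemma iter_succ (ξ : A → List A) (n : ℕ) (a : A) : iter ξ (n + 1) a = (iter ξ n a).flatMap ξ := rfl

lemma iter_add (ξ : A → List A) (n m : ℕ) (a : A) :
    (iter ξ n a).flatMap (iter ξ m) = iter ξ (n + m) a := by
  induction m with
  | zero => exact List.flatMap_singleton' _
  | succ m ih =>
    rw [← add_assoc, iter_succ, ← ih, List.flatMap_assoc]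
    rfl

lemma iter_one (ξ : A → List A) (a : A) : iter ξ 1 a = ξ a := by simp [iter_succ]

lemma iter_succ' (ξ : A → List A) (n : ℕ) (a : A) :
    iter ξ (n + 1) a = (ξ a).flatMap (iter ξ n) := by
  rw [add_comm, ← iter_add, iter_one]

lemma flatMap_ne_nil {σ : A → List A} (hσ : ∀ a, σ a ≠ []) {u : List A} (hu : u ≠ []) :
    u.flatMap σ ≠ [] := by
  intro h
  rw [List.flatMap_eq_nil_iff] at h
  obtain ⟨b, hb⟩ := List.exists_mem_of_ne_nil _ hu
  exact hσ b (h b hb)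

lemma iter_ne_nil (hξ : ∀ a, ξ a ≠ []) (n : ℕ) (a : A) : iter ξ n a ≠ [] := by
  induction n with
  | zero => simp
  | succ n ih => exact flatMap_ne_nil hξ ih

lemma sub_iter_add (hξ : ∀ a, ξ a ≠ []) (n m : ℕ) (x : ℤ → A) :
    sub (iter ξ m) (sub (iter ξ n) x) = sub (iter ξ (n + m)) x := by
  rw [sub_sub_eq (iter_ne_nil hξ n) (iter_ne_nil hξ m)]
  simp only [iter_add]

lemma cuts_iter_add (hξ : ∀ a, ξ a ≠ []) (n m : ℕ) (x : ℤ → A) (i : ℤ) :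
    cuts (iter ξ m) (sub (iter ξ n) x) (cuts (iter ξ n) x i) = cuts (iter ξ (n + m)) x i := by
  rw [cuts_sub (iter_ne_nil hξ n)]
  simp only [iter_add]

@[simp] lemma cuts_iter_zero (x : ℤ → A) (i : ℤ) : cuts (iter ξ 0) x i = i := by
  symm
  apply eq_cum (g := fun i => i) rfl
  simp

@[simp] lemma sub_iter_zero (x : ℤ → A) : sub (iter ξ 0) x = x := by
  symm
  apply eq_sub (by simp)
  intro n
  rw [cuts_iter_zero, iter_zero, occ_singleton]

end Iter

/-! ### The transposed incidence matrix as an operation on weights -/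

section Incidence

variable {A : Type*} [Fintype A] [DecidableEq A]

lemma wt_eq_sum_count (v : A → ℝ) (u : List A) : wt v u = ∑ a, (u.count a : ℝ) * v a := by
  induction u with
  | nil => simp
  | cons b u ih =>
    simp only [wt_cons, ih, List.count_cons, Nat.cast_add, add_mul, Finset.sum_add_distrib]
    simp [add_comm]

lemma incidence_transpose_mulVec (ξ : A → List A) (v : A → ℝ) :
    (incidence ξ).transpose.mulVec v = fun a => wt v (ξ a) := by
  ext a
  simp [Matrix.mulVec, dotProduct, incidence, wt_eq_sum_count]

/-- The dictionary between matrices and words: M^t sends a weight to its sums over the words `ξ a`,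
and iterating replaces `ξ` by `ξ^k`. -/
lemma pow_incidence_transpose_mulVec (ξ : A → List A) (k : ℕ) (v : A → ℝ) :
    ((incidence ξ).transpose ^ k).mulVec v = fun a => wt v (iter ξ k a) := by
  induction k generalizing v with
  | zero => ext a; simp
  | succ k ih =>
    rw [pow_succ, ← Matrix.mulVec_mulVec, incidence_transpose_mulVec, ih]
    ext a
    rw [iter_succ, wt_flatMap]

lemma mem_iter_of_pow_incidence_pos {ξ : A → List A} {k : ℕ} {a b : A}
    (h : 0 < (incidence ξ ^ k) a b) : a ∈ iter ξ k b := by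
  by_contra hn
  have h1 : (incidence ξ ^ k) a b = wt (Pi.single a (1 : ℝ)) (iter ξ k b) := by
    have := congrFun (pow_incidence_transpose_mulVec ξ k (Pi.single a 1)) b
    rw [← this, Matrix.mulVec_single_one, ← Matrix.transpose_pow]
    rfl
  have h2 : wt (Pi.single a (1 : ℝ)) (iter ξ k b) = 0 := by
    rw [wt_eq_sum_count]
    apply Finset.sum_eq_zero
    intro c _
    by_cases hc : c = a
    · subst hc; simp [List.count_eq_zero_of_not_mem hn]
    · simp [hc]
  rw [h1, h2] at h
  exact lt_irrefl _ h

end Incidence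

/-- The combinatorial content of the hypotheses on a primitive proper substitution, with the common
first letter `ℓ` and the common last letter `t`. -/
structure PrimitiveProper {A : Type*} (ξ : A → List A) (ℓ t : A) : Prop where
  head : ∀ b, (ξ b).head? = some ℓ
  last : ∀ b, (ξ b).getLast? = some t
  grow : ∀ b, Tendsto (fun n => (iter ξ n b).length) atTop atTop
  mem_iter : ∃ K, ∀ j ≥ K, ∀ a b, a ∈ iter ξ j b

/-! ### The language, the fixed point and linear recurrence -/

section Language

variable {A : Type*} {ξ : A → List A} {ℓ t : A}

lemma infix_flatMap {u v : List A} (h : u <:+: v) (σ : A → List A) :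
    u.flatMap σ <:+: v.flatMap σ := by
  obtain ⟨p, q, rfl⟩ := h
  exact ⟨p.flatMap σ, q.flatMap σ, by simp⟩

lemma language_of_infix {u v : List A} (h : u <:+: v) (hv : v ∈ language ξ) : u ∈ language ξ := by
  obtain ⟨n, b, hn⟩ := hv
  exact ⟨n, b, h.trans hn⟩

lemma flatMap_iter_mem_language {u : List A} (hu : u ∈ language ξ) (k : ℕ) :
    u.flatMap (iter ξ k) ∈ language ξ := by
  obtain ⟨n, b, hn⟩ := hu
  exact ⟨n + k, b, by rw [← iter_add]; exact infix_flatMap hn _⟩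

lemma mem_Omega_iff {x : ℤ → A} : x ∈ Omega ξ ↔ ∀ c u, Occ x c u → u ∈ language ξ := by
  constructor
  · intro h c u hu
    rw [hu.eq_factor]
    exact h _ _
  · intro h c l
    exact h c _ (occ_factor x c l)

lemma tr_mem_Omega {x : ℤ → A} (hx : x ∈ Omega ξ) (c : ℤ) : tr c x ∈ Omega ξ := by
  rw [mem_Omega_iff] at hx ⊢
  intro d u hu
  exact hx _ _ (occ_tr.1 hu)

/-- `ξ^k` maps `Ω_ξ` to itself. -/
lemma sub_mem_Omega (hξ : ∀ a, ξ a ≠ []) {y : ℤ → A} (hy : y ∈ Omega ξ) (k : ℕ) :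
    sub (iter ξ k) y ∈ Omega ξ := by
  rw [mem_Omega_iff]
  intro c u hu
  have hk := iter_ne_nil hξ k
  obtain ⟨n, hn, -⟩ := exists_block (cuts_lt_succ hk y) c
  obtain ⟨m, hm1, hm2⟩ := exists_block (cuts_lt_succ hk y) (c + u.length)
  have hnm : n < m + 1 := (cuts_strictMono hk y).lt_iff_lt.1 (by omega)
  obtain ⟨l, hl⟩ := Int.eq_ofNat_of_zero_le (show 0 ≤ m + 1 - n by omega)
  have h1 := (occ_factor y n l).sub hk
  have h2 := (occ_factor y n l).cuts_add (iter ξ k)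
  rw [length_factor] at h2
  have e : n + (l : ℤ) = m + 1 := by omega
  rw [e] at h2
  obtain ⟨p, q, hpq, -⟩ := hu.infix_of_le h1 hn (by omega)
  exact language_of_infix ⟨p, q, hpq.symm⟩ (flatMap_iter_mem_language (hy n l) k)

namespace PrimitiveProper

lemma ne_nil (h : PrimitiveProper ξ ℓ t) (a : A) : ξ a ≠ [] := by
  intro h0
  have := h.head a
  simp [h0] at this

lemma iter_ne_nil (h : PrimitiveProper ξ ℓ t) (n : ℕ) (a : A) : iter ξ n a ≠ [] :=
  PisotRegular.iter_ne_nil h.ne_nil n a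

lemma length_iter_pos (h : PrimitiveProper ξ ℓ t) (n : ℕ) (a : A) : 0 < (iter ξ n a).length :=
  List.length_pos_iff.2 (h.iter_ne_nil n a)

/-- This is where properness enters: the first letter of `ξ b` is `ℓ` for every `b`, so what follows
a cut of level `n + 1` does not depend on the next letter over the length of `ξ^n ℓ`. -/
lemma iter_prefix (h : PrimitiveProper ξ ℓ t) (n : ℕ) (b : A) :
    iter ξ n ℓ <+: iter ξ (n + 1) b := by
  obtain ⟨u, hu⟩ := List.head?_eq_some_iff.1 (h.head b)
  rw [iter_succ', hu]
  exact ⟨u.flatMap (iter ξ n), by simp⟩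

lemma iter_suffix (h : PrimitiveProper ξ ℓ t) (n : ℕ) (b : A) :
    iter ξ n t <:+ iter ξ (n + 1) b := by
  obtain ⟨u, hu⟩ := List.getLast?_eq_some_iff.1 (h.last b)
  rw [iter_succ', hu]
  exact ⟨u.flatMap (iter ξ n), by simp⟩

lemma length_le_flatMap {σ : A → List A} (hσ : ∀ a, σ a ≠ []) (u : List A) :
    u.length ≤ (u.flatMap σ).length := by
  induction u with
  | nil => simp
  | cons a u ih =>
    have := List.length_pos_iff.2 (hσ a)
    simp only [List.length_cons, List.flatMap_cons, List.length_append]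
    omega

lemma length_iter_mono (h : PrimitiveProper ξ ℓ t) (a : A) :
    Monotone fun n => (iter ξ n a).length :=
  monotone_nat_of_le_succ fun n => by
    rw [iter_succ]
    exact length_le_flatMap h.ne_nil _

end PrimitiveProper

/-- A sequence of words, each a prefix of the next, has a right-infinite limit. -/
lemma exists_limit_of_prefix [Nonempty A] {w : ℕ → List A} (hw : ∀ n, w n <+: w (n + 1))
    (hl : Tendsto (fun n => (w n).length) atTop atTop) :
    ∃ f : ℕ → A, ∀ n j (hj : j < (w n).length), f j = (w n)[j] := by
  have hN : ∀ j, ∃ n, j < (w n).length := fun j =>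
    ((hl.eventually_gt_atTop j).exists)
  choose N hN using hN
  refine ⟨fun j => (w (N j))[j]'(hN j), fun n j hj => ?_⟩
  have hmono : ∀ m k, w m <+: w (m + k) := by
    intro m k
    induction k with
    | zero => exact List.prefix_rfl
    | succ k ih => exact ih.trans (hw _)
  rcases le_total n (N j) with h | h
  · obtain ⟨k, hk⟩ := Nat.exists_eq_add_of_le h
    have := hmono n k
    rw [← hk] at this
    exact (this.getElem hj).symm
  · obtain ⟨k, hk⟩ := Nat.exists_eq_add_of_le h
    have := hmono (N j) k
    rw [← hk] at this
    exact this.getElem (hN j)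

namespace PrimitiveProper

/-- Two consecutive letters `c d` of some `ξ^n ℓ` suffice: `ξ c` ends with `t` and `ξ d` begins with
`ℓ`. -/
lemma pair_mem_language (h : PrimitiveProper ξ ℓ t) : [t, ℓ] ∈ language ξ := by
  obtain ⟨n, hn⟩ := ((h.grow ℓ).eventually_ge_atTop 2).exists
  match hu : iter ξ n ℓ with
  | [] => simp [hu] at hn
  | [c] => simp [hu] at hn
  | c :: d :: r =>
    obtain ⟨p, hp⟩ := List.getLast?_eq_some_iff.1 (h.last c)
    obtain ⟨q, hq⟩ := List.head?_eq_some_iff.1 (h.head d)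
    refine ⟨n + 1, ℓ, p, q ++ r.flatMap ξ, ?_⟩
    rw [iter_succ, hu]
    simp [hp, hq]

/-- The words `ξ^m t` extend one another to the left and the words `ξ^m ℓ` to the right, and `t ℓ`
is admissible; so `ξ^m t . ξ^m ℓ` converges to a point of `Ω_ξ` fixed by `ξ`. By primitivity every
word of the language occurs in some `ξ^m ℓ`, hence in the limit. -/
lemma exists_fixedPoint (h : PrimitiveProper ξ ℓ t) :
    ∃ u ∈ Omega ξ, sub ξ u = u ∧ ∀ w ∈ language ξ, ∃ c : ℤ, Occ u c w := by
  have : Nonempty A := ⟨ℓ⟩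
  obtain ⟨f, hf⟩ := exists_limit_of_prefix (fun n => h.iter_prefix n ℓ) (h.grow ℓ)
  obtain ⟨g, hg⟩ := exists_limit_of_prefix (w := fun n => (iter ξ n t).reverse)
    (fun n => List.reverse_prefix.2 (h.iter_suffix n t)) (by simpa using h.grow t)
  let u : ℤ → A := fun i => match i with
    | Int.ofNat n => f n
    | Int.negSucc n => g n
  have hr : ∀ m, Occ u 0 (iter ξ m ℓ) := by
    intro m j hj
    rw [← hf m j hj, zero_add]
  have hl : ∀ m, Occ u (-(iter ξ m t).length) (iter ξ m t) := by
    intro m j hj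
    have h1 : j = (iter ξ m t).length - 1 - ((iter ξ m t).length - 1 - j) := by omega
    have h2 := hg m ((iter ξ m t).length - 1 - j) (by simp; omega)
    rw [List.getElem_reverse] at h2
    have h3 : (-(iter ξ m t).length : ℤ) + j = Int.negSucc ((iter ξ m t).length - 1 - j) := by
      omega
    rw [h3]
    change g _ = _
    rw [h2]
    congr 1
    omega
  have hm : ∀ m, Occ u (-(iter ξ m t).length) ([t, ℓ].flatMap (iter ξ m)) := by
    intro m
    simp only [List.flatMap_cons, List.flatMap_nil, List.append_nil]
    rw [occ_append]
    refine ⟨hl m, ?_⟩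
    rw [neg_add_cancel]
    exact hr m
  have hfix : sub ξ u = u := by
    ext i
    match i with
    | Int.ofNat j =>
      obtain ⟨m, hm⟩ := ((h.grow ℓ).eventually_gt_atTop j).exists
      have hm' : j < (iter ξ (m + 1) ℓ).length :=
        lt_of_lt_of_le hm (h.length_iter_mono ℓ (Nat.le_succ m))
      have h1 := (hr m).sub h.ne_nil
      rw [cuts_zero, ← iter_succ] at h1
      have h2 := h1 j hm'
      rw [← hr (m + 1) j hm'] at h2
      simpa using h2
    | Int.negSucc j =>
      obtain ⟨m, hm⟩ := ((h.grow t).eventually_gt_atTop j).exists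
      have hm' : j < (iter ξ (m + 1) t).length :=
        lt_of_lt_of_le hm (h.length_iter_mono t (Nat.le_succ m))
      have h1 := (hl m).sub h.ne_nil
      have h2 := (hl m).cuts_add ξ
      rw [neg_add_cancel, cuts_zero, ← iter_succ] at h2
      have h3 : cuts ξ u (-(iter ξ m t).length) = -(iter ξ (m + 1) t).length := by omega
      rw [h3, ← iter_succ] at h1
      have hj : (iter ξ (m + 1) t).length - 1 - j < (iter ξ (m + 1) t).length := by omega
      have h4 := h1 _ hj
      rw [← hl (m + 1) _ hj] at h4
      have e : -((iter ξ (m + 1) t).length : ℤ) + ((iter ξ (m + 1) t).length - 1 - j : ℕ)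
        = Int.negSucc j := by omega
      rwa [e] at h4
  refine ⟨u, ?_, hfix, ?_⟩
  · rw [mem_Omega_iff]
    intro c w hw
    obtain ⟨m, hm1, hm2⟩ := (((h.grow ℓ).eventually_ge_atTop (c + w.length).toNat).and
      ((h.grow t).eventually_ge_atTop (-c).toNat)).exists
    obtain ⟨p, q, hpq, -⟩ := hw.infix_of_le (hm m) (by omega) (by
      simp only [List.flatMap_cons, List.flatMap_nil, List.append_nil, List.length_append]
      push_cast
      omega)
    exact language_of_infix ⟨p, q, hpq.symm⟩ (flatMap_iter_mem_language h.pair_mem_language m)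
  · rintro w ⟨n, b, hn⟩
    obtain ⟨K, hK⟩ := h.mem_iter
    obtain ⟨p, q, hpq⟩ := List.append_of_mem (hK K le_rfl b ℓ)
    have h1 : w <:+: iter ξ (K + n) ℓ := by
      refine hn.trans ?_
      rw [← iter_add, hpq]
      exact ⟨p.flatMap (iter ξ n), q.flatMap (iter ξ n), by simp⟩
    obtain ⟨p', q', hw⟩ := h1
    have h2 := hr (K + n)
    rw [← hw, occ_append, occ_append] at h2
    exact ⟨_, h2.1.2⟩

lemma sub_iter_eq_of_fixed (h : PrimitiveProper ξ ℓ t) {u : ℤ → A} (hu : sub ξ u = u) (n : ℕ) :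
    sub (iter ξ n) u = u := by
  induction n with
  | zero => simp
  | succ n ih =>
    rw [← sub_iter_add h.ne_nil, ih]
    have : iter ξ 1 = ξ := by ext a : 1; exact iter_one ξ a
    rw [this, hu]

lemma length_flatMap_le {σ : A → List A} {C : ℕ} {u : List A} (h : ∀ a ∈ u, (σ a).length ≤ C) :
    (u.flatMap σ).length ≤ u.length * C := by
  induction u with
  | nil => simp
  | cons a u ih =>
    have h1 := h a (by simp)
    have h2 := ih fun b hb => h b (by simp [hb])
    simp only [List.length_cons, List.flatMap_cons, List.length_append]
    rw [add_mul]; omega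

lemma length_le_flatMap_of_mem {σ : A → List A} {u : List A} {a : A} (ha : a ∈ u) :
    (σ a).length ≤ (u.flatMap σ).length := by
  obtain ⟨p, q, rfl⟩ := List.append_of_mem ha
  simp
  omega

/-- Every letter `c` occurs in `ξ^K b`, whence |ξ^m c| ≤ |ξ^{K+m} b|; the lengths at one level are
therefore comparable with a constant independent of the level, and `q` further steps cost a bounded
factor. -/
lemma exists_length_iter_le [Finite A] (h : PrimitiveProper ξ ℓ t) (q : ℕ) :
    ∃ C : ℕ, 0 < C ∧ ∀ n a b, (iter ξ (n + q) a).length ≤ C * (iter ξ n b).length := by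
  have : Nonempty A := ⟨ℓ⟩
  obtain ⟨K, hK⟩ := h.mem_iter
  obtain ⟨cK, hcK⟩ := Finite.exists_max fun a => (iter ξ K a).length
  obtain ⟨cq, hcq⟩ := Finite.exists_max fun a => (iter ξ q a).length
  set D := (iter ξ K cK).length
  have h1 : ∀ n a b, (iter ξ n a).length ≤ D * (iter ξ n b).length := by
    intro n a b
    rcases le_total K n with hn | hn
    · obtain ⟨m, rfl⟩ := Nat.exists_eq_add_of_le hn
      rw [← iter_add ξ K m a]
      refine (length_flatMap_le (C := (iter ξ (K + m) b).length) fun c _ => ?_).trans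
        (Nat.mul_le_mul_right _ (hcK a))
      rw [← iter_add]
      exact length_le_flatMap_of_mem (hK K le_rfl c b)
    · calc (iter ξ n a).length ≤ D := (h.length_iter_mono a hn).trans (hcK a)
        _ ≤ D * (iter ξ n b).length := Nat.le_mul_of_pos_right _ (h.length_iter_pos n b)
  refine ⟨(iter ξ q cq).length * D, Nat.mul_pos (h.length_iter_pos _ _) (h.length_iter_pos _ _),
    fun n a b => ?_⟩
  rw [add_comm n q, ← iter_add, mul_assoc]
  exact (length_flatMap_le fun c _ => h1 n c b).trans (Nat.mul_le_mul_right _ (hcq a))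

lemma eventually_infix_iter [Finite A] (h : PrimitiveProper ξ ℓ t) {w : List A}
    (hw : w ∈ language ξ) : ∀ᶠ q in atTop, ∀ a, w <:+: iter ξ q a := by
  obtain ⟨m, d, hm⟩ := hw
  obtain ⟨K, hK⟩ := h.mem_iter
  filter_upwards [eventually_ge_atTop (K + m)] with q hq a
  obtain ⟨r, rfl⟩ := Nat.exists_eq_add_of_le' hq
  obtain ⟨p, s, hps⟩ := List.append_of_mem (hK (r + K) (by omega) d a)
  rw [← add_assoc, ← iter_add, hps]
  exact hm.trans ⟨p.flatMap (iter ξ m), s.flatMap (iter ξ m), by simp⟩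

/-- Linear recurrence: a word of the language no longer than the words `ξ^n b` occurs in all the
words `ξ^{n+q} a`. -/
lemma exists_linear_recurrence [Finite A] (h : PrimitiveProper ξ ℓ t) :
    ∃ q, ∀ n, ∀ w ∈ language ξ, (∀ b, w.length ≤ (iter ξ n b).length) →
      ∀ a, w <:+: iter ξ (n + q) a := by
  -- There are finitely many two-letter words, so one `q` serves for all of them.
  have h2 : ∀ᶠ q in atTop, ∀ b c : A, [b, c] ∈ language ξ → ∀ a, [b, c] <:+: iter ξ q a := by
    rw [eventually_all]; intro b
    rw [eventually_all]; intro c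
    by_cases hbc : [b, c] ∈ language ξ
    · filter_upwards [h.eventually_infix_iter hbc] with q hq _ using hq
    · exact Eventually.of_forall fun _ hc => absurd hc hbc
  obtain ⟨q, hq⟩ := h2.exists
  refine ⟨q, fun n w hw hlen a => ?_⟩
  obtain ⟨u, huΩ, hfix, hocc⟩ := h.exists_fixedPoint
  obtain ⟨c, hc⟩ := hocc w hw
  have hfn := h.sub_iter_eq_of_fixed hfix n
  obtain ⟨i, hi1, hi2⟩ := exists_block (cuts_lt_succ (h.iter_ne_nil n) u) c
  -- A word that starts in the block of `u i` and is no longer than any `ξ^n b` ends at the latest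
  -- in the next block.
  have ho : Occ u i [u i, u (i + 1)] := by simp [occ_cons, occ_nil]
  have h3 := ho.sub (h.iter_ne_nil n)
  rw [hfn] at h3
  rw [cuts_succ] at hi2
  have hl := hlen (u (i + 1))
  obtain ⟨p, s, hps, -⟩ := hc.infix_of_le h3 hi1 (by simp; omega)
  have h4 : [u i, u (i + 1)] <:+: iter ξ q a := hq _ _ ((mem_Omega_iff.1 huΩ) _ _ ho) a
  rw [add_comm, ← iter_add]
  exact (show w <:+: _ from ⟨p, s, hps.symm⟩).trans (infix_flatMap h4 _)

end PrimitiveProper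

/-- The part of `Ω_ξ` at distance `r` before a cut of level `k`. -/
def towerLevel (ξ : A → List A) (k r : ℕ) : Set (ℤ → A) :=
  (fun y => tr (-r) (sub (iter ξ k) y)) '' {y ∈ Omega ξ | r < (iter ξ k (y (-1))).length}

lemma mem_towerLevel {k r : ℕ} {x : ℤ → A} : x ∈ towerLevel ξ k r ↔
    ∃ y ∈ Omega ξ, r < (iter ξ k (y (-1))).length ∧ x = tr (-r) (sub (iter ξ k) y) := by
  simp [towerLevel, and_assoc, eq_comm]

end Language

/-! ### Topology of Ω_ξ and its covering by towers -/

section Topology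

variable {A : Type*} [TopologicalSpace A]

lemma continuous_tr (c : ℤ) : Continuous (tr c : (ℤ → A) → ℤ → A) :=
  continuous_pi fun n => continuous_apply (n + c)

lemma exists_window_of_isOpen {U : Set (ℤ → A)} (hU : IsOpen U) {x : ℤ → A} (hx : x ∈ U) :
    ∃ N : ℕ, ∀ x', (∀ i : ℤ, -N ≤ i → i ≤ N → x' i = x i) → x' ∈ U := by
  obtain ⟨I, V, hV, hsub⟩ := isOpen_pi_iff.1 hU x hx
  refine ⟨I.sup Int.natAbs, fun x' h => hsub fun i hi => ?_⟩
  have : i.natAbs ≤ I.sup Int.natAbs := Finset.le_sup (f := Int.natAbs) hi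
  rw [h i (by omega) (by omega)]
  exact (hV i hi).2

variable [DiscreteTopology A]

lemma continuous_cum {E : Type*} [AddCommGroup E] [TopologicalSpace E] [IsTopologicalAddGroup E]
    (v : A → E) (n : ℤ) : Continuous fun x => cum v x n := by
  have hc : ∀ i : ℤ, Continuous fun x : ℤ → A => v (x i) := fun i =>
    (continuous_of_discreteTopology (f := v)).comp (continuous_apply i)
  match n with
  | Int.ofNat n => exact continuous_finsetSum _ fun i _ => hc i
  | Int.negSucc n => exact (continuous_finsetSum _ fun i _ => hc _).neg

lemma eventually_eq_of_continuous {X Y : Type*} [TopologicalSpace X] [TopologicalSpace Y]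
    [DiscreteTopology Y] {f : X → Y} (hf : Continuous f) (x : X) : ∀ᶠ x' in 𝓝 x, f x' = f x :=
  (IsLocallyConstant.iff_continuous f).2 hf |>.eventually_eq x

lemma continuous_sub {σ : A → List A} (hσ : ∀ a, σ a ≠ []) : Continuous (sub σ) := by
  refine continuous_pi fun m => ?_
  rw [← IsLocallyConstant.iff_continuous, IsLocallyConstant.iff_eventually_eq]
  intro x
  obtain ⟨n, h1, h2⟩ := exists_block (cuts_lt_succ hσ x) m
  filter_upwards [eventually_eq_of_continuous (continuous_cum (fun a => ((σ a).length : ℤ)) n) x,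
    eventually_eq_of_continuous (continuous_apply n) x] with x' hc hx
  change cuts σ x' n = cuts σ x n at hc
  rw [cuts_succ] at h2
  obtain ⟨j, hj⟩ := Int.eq_ofNat_of_zero_le (sub_nonneg.2 h1)
  have hj' : j < (σ (x n)).length := by omega
  have e : m = cuts σ x n + j := by omega
  have o1 := occ_sub hσ x n j hj'
  have o2 := occ_sub hσ x' n
  rw [hx, hc] at o2
  rw [e, o1, o2 j hj']

lemma isClosed_Omega (ξ : A → List A) : IsClosed (Omega ξ) := by
  have : Omega ξ = ⋂ (i : ℤ) (l : ℕ), {x | factor x i l ∈ language ξ} := by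
    ext x; simp [Omega]
  rw [this]
  refine isClosed_iInter fun i => isClosed_iInter fun l => ?_
  have hc : Continuous fun x : ℤ → A => fun j : Fin l => x (i + (j : ℕ)) :=
    continuous_pi fun j => continuous_apply _
  exact (isClosed_discrete {g : Fin l → A | List.ofFn g ∈ language ξ}).preimage hc

variable [Finite A] {ξ : A → List A} {ℓ t : A}

lemma isCompact_Omega (ξ : A → List A) : IsCompact (Omega ξ) :=
  (isClosed_Omega ξ).isCompact

instance (ξ : A → List A) : CompactSpace (Omega ξ) :=
  isCompact_iff_compactSpace.1 (isCompact_Omega ξ)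

lemma PrimitiveProper.isClosed_towerLevel (h : PrimitiveProper ξ ℓ t) (k r : ℕ) :
    IsClosed (towerLevel ξ k r) := by
  apply IsCompact.isClosed
  apply IsCompact.image
  · apply IsClosed.isCompact
    apply (isClosed_Omega ξ).inter
    exact (isClosed_discrete {a : A | r < (iter ξ k a).length}).preimage
      (continuous_apply (A := fun _ : ℤ => A) (-1))
  · exact (continuous_tr _).comp (continuous_sub (h.iter_ne_nil k))

/-- It holds for the translates of the fixed point `u`, since `u = ξ^k(u)`. These are dense, because
every word of the language occurs in `u`, and the union of the finitely many levels `r < R` is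
closed. -/
lemma PrimitiveProper.exists_mem_towerLevel (h : PrimitiveProper ξ ℓ t) (k : ℕ) {x : ℤ → A}
    (hx : x ∈ Omega ξ) : ∃ r, x ∈ towerLevel ξ k r := by
  have : Nonempty A := ⟨ℓ⟩
  obtain ⟨a, ha⟩ := Finite.exists_max fun a => (iter ξ k a).length
  set R := (iter ξ k a).length
  set X := ⋃ r ∈ Finset.range R, towerLevel ξ k r
  have hX : IsClosed X := isClosed_biUnion_finset fun r _ => h.isClosed_towerLevel k r
  suffices x ∈ X by
    obtain ⟨r, -, hr⟩ := Set.mem_iUnion₂.1 this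
    exact ⟨r, hr⟩
  by_contra hxX
  obtain ⟨N, hN⟩ := exists_window_of_isOpen hX.isOpen_compl hxX
  obtain ⟨u, huΩ, hfix, hocc⟩ := h.exists_fixedPoint
  obtain ⟨c, hc⟩ := hocc _ (hx (-N) (2 * N + 1))
  refine hN (tr (c + N) u) (fun i h1 h2 => ?_) ?_
  · obtain ⟨j, hj⟩ := Int.eq_ofNat_of_zero_le (show 0 ≤ i + N by omega)
    have h3 := hc j (by simp; omega)
    have h4 := occ_factor x (-N) (2 * N + 1) j (by simp; omega)
    rw [← h4] at h3
    have e1 : -(N : ℤ) + j = i := by omega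
    have e2 : c + j = i + (c + N) := by omega
    rw [e1, e2] at h3
    exact h3
  · set d := c + (N : ℤ)
    -- The block that contains the place `d - 1` ends at the first cut at or after `d`.
    obtain ⟨b, hb1, hb2⟩ := exists_block (cuts_lt_succ (h.iter_ne_nil k) u) (d - 1)
    obtain ⟨r, hr⟩ := Int.eq_ofNat_of_zero_le (show 0 ≤ cuts (iter ξ k) u (b + 1) - d by omega)
    have hlen : r < (iter ξ k (u b)).length := by
      rw [cuts_succ] at hr; omega
    simp only [X, Set.mem_iUnion]
    refine ⟨r, by simpa using hlen.trans_le (ha (u b)), mem_towerLevel.2 ⟨tr (b + 1) u,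
      tr_mem_Omega huΩ _, by simpa using hlen, ?_⟩⟩
    rw [← tr_sub (h.iter_ne_nil k), h.sub_iter_eq_of_fixed hfix, tr_tr]
    congr 1; omega

end Topology

/-- No translation by a positive integer is the identity on `Ω_ξ`. -/
def NoPeriod {A : Type*} (ξ : A → List A) : Prop :=
  ∀ p : ℕ, 0 < p → ∃ x ∈ Omega ξ, tr p x ≠ x

/-! ### Recognizability of aperiodic primitive proper substitutions -/

section Recognizability

variable {A : Type*} {ξ : A → List A} {ℓ t : A}

open Classical in
/-- The places at which `u` occurs in `w`. -/
noncomputable def occurrences (u w : List A) : Finset ℕ :=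
  (Finset.range (w.length + 1)).filter fun s => ∃ p q, w = p ++ u ++ q ∧ p.length = s

lemma mem_occurrences {u w : List A} {s : ℕ} :
    s ∈ occurrences u w ↔ ∃ p q, w = p ++ u ++ q ∧ p.length = s := by
  simp only [occurrences, Finset.mem_filter, Finset.mem_range, and_iff_right_iff_imp]
  rintro ⟨p, q, rfl, rfl⟩
  simp only [List.length_append]
  omega

lemma getElem?_append_append {p u q : List A} {j : ℕ} (hj : j < u.length) :
    (p ++ u ++ q)[p.length + j]? = u[j]? := by
  rw [List.append_assoc, List.getElem?_append_right (by omega), Nat.add_sub_cancel_left,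
    List.getElem?_append_left hj]

lemma getElem?_of_mem_occurrences {u w : List A} {s j : ℕ} (hs : s ∈ occurrences u w)
    (hj : j < u.length) : w[s + j]? = u[j]? := by
  obtain ⟨p, q, rfl, rfl⟩ := mem_occurrences.1 hs
  exact getElem?_append_append hj

namespace PrimitiveProper

variable [Finite A]

/-- Two occurrences of `ξ^{n+q} a` in a word are far apart. -/
lemma exists_gap (h : PrimitiveProper ξ ℓ t) (hper : NoPeriod ξ) : ∃ q, ∀ n a w s s',
    s ∈ occurrences (iter ξ (n + q) a) w → s' ∈ occurrences (iter ξ (n + q) a) w → s < s' →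
      ∃ b, (iter ξ n b).length ≤ s' - s := by
  obtain ⟨q, hq⟩ := h.exists_linear_recurrence
  refine ⟨q, fun n a w s s' hs hs' hlt => ?_⟩
  -- If the distance were less than all `|ξ^n b|`, linear recurrence would place every factor of
  -- length `s' - s + 1` inside `ξ^{n+q} a`; the overlap of the two occurrences would make `s' - s`
  -- a period of every point.
  by_contra! hcon
  obtain ⟨x, hx, hne⟩ := hper (s' - s) (by omega)
  apply hne
  ext i
  obtain ⟨p1, q1, hV⟩ := hq n (factor x i (s' - s + 1)) (hx _ _)
    (fun b => by rw [length_factor]; exact hcon b) a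
  have hl : (iter ξ (n + q) a).length = p1.length + (s' - s + 1) + q1.length := by
    rw [← hV]; simp; omega
  have key : ∀ j (hj : j < s' - s + 1), (iter ξ (n + q) a)[p1.length + j]? = some (x (i + j)) := by
    intro j hj
    rw [← hV, getElem?_append_append (by simpa using hj),
      occ_factor x i (s' - s + 1) j (by rwa [length_factor]), List.getElem?_eq_getElem]
  have e1 := getElem?_of_mem_occurrences hs (j := p1.length + (s' - s)) (by omega)
  have e2 := getElem?_of_mem_occurrences hs' (j := p1.length + 0) (by omega)
  rw [key _ (by omega)] at e1 e2
  have e3 : s + (p1.length + (s' - s)) = s' + (p1.length + 0) := by omega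
  rw [e3, e2] at e1
  simpa using (Option.some.inj e1).symm

/-- With `g` the least `|ξ^m b|`, the occurrences of `ξ^{m+q} a` are at least `g` apart, so `s ↦ s /
g` is injective on them, while the word `ξ^{m+q} w` has length at most `|w| C g`. The finitely many
`n < q` are absorbed in `D`. -/
lemma exists_card_occurrences_le (h : PrimitiveProper ξ ℓ t) (hper : NoPeriod ξ) (a : A)
    (w : List A) : ∃ C, ∀ n, (occurrences (iter ξ n a) (w.flatMap (iter ξ n))).card ≤ C := by
  have : Nonempty A := ⟨ℓ⟩
  obtain ⟨q, hq⟩ := h.exists_gap hper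
  obtain ⟨C, -, hC⟩ := h.exists_length_iter_le q
  obtain ⟨D, hD⟩ : ∃ D, ∀ n < q,
      (occurrences (iter ξ n a) (w.flatMap (iter ξ n))).card ≤ D :=
    ⟨(Finset.range q).sup fun n => (occurrences (iter ξ n a) (w.flatMap (iter ξ n))).card,
      fun n hn => Finset.le_sup (f := fun n =>
        (occurrences (iter ξ n a) (w.flatMap (iter ξ n))).card) (Finset.mem_range.2 hn)⟩
  refine ⟨max D (w.length * C + 1), fun n => ?_⟩
  rcases lt_or_ge n q with hn | hn
  · exact le_max_of_le_left (hD n hn)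
  obtain ⟨m, rfl⟩ := Nat.exists_eq_add_of_le' hn
  apply le_max_of_le_right
  obtain ⟨b, hb⟩ := Finite.exists_min fun b => (iter ξ m b).length
  set g := (iter ξ m b).length
  have hg : 0 < g := h.length_iter_pos m b
  rw [← Finset.card_range (w.length * C + 1)]
  refine Finset.card_le_card_of_injOn (fun s => s / g) (fun s hs => ?_) ?_
  · obtain ⟨p, r, hw, rfl⟩ := mem_occurrences.1 (Finset.mem_coe.1 hs)
    have h1 : (w.flatMap (iter ξ (m + q))).length ≤ w.length * (C * g) :=
      length_flatMap_le fun c _ => hC m c b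
    have h2 : p.length ≤ (w.flatMap (iter ξ (m + q))).length := by rw [hw]; simp
    simp only [Finset.coe_range, Set.mem_Iio, Nat.lt_succ_iff]
    rw [← mul_assoc] at h1
    exact Nat.div_le_of_le_mul (by rw [mul_comm]; exact h2.trans h1)
  · have aux : ∀ s s', s ∈ occurrences (iter ξ (m + q) a) (w.flatMap (iter ξ (m + q))) →
        s' ∈ occurrences (iter ξ (m + q) a) (w.flatMap (iter ξ (m + q))) → s < s' →
        s / g < s' / g := by
      intro s s' hs hs' hlt
      obtain ⟨c, hc⟩ := hq m a _ s s' hs hs' hlt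
      have := (hb c).trans hc
      calc s / g < s / g + 1 := Nat.lt_succ_self _
        _ = (s + g) / g := (Nat.add_div_right _ hg).symm
        _ ≤ s' / g := Nat.div_le_div_right (by omega)
    intro s hs s' hs' he
    rcases lt_trichotomy s s' with hlt | heq | hlt
    · exact absurd he (aux s s' hs hs' hlt).ne
    · exact heq
    · exact absurd he.symm (aux s' s hs' hs hlt).ne

/-- At large levels, every occurrence of `ξ^{n+1} a` in `ξ^{n+1} w` is the image by `ξ` of an
occurrence of `ξ^n a` in `ξ^n w`. -/
lemma eventually_exists_occurrence (h : PrimitiveProper ξ ℓ t) (hper : NoPeriod ξ) (a : A)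
    (w : List A) : ∀ᶠ n in atTop, ∀ p' q',
      w.flatMap (iter ξ (n + 1)) = p' ++ iter ξ (n + 1) a ++ q' →
      ∃ p q, w.flatMap (iter ξ n) = p ++ iter ξ n a ++ q ∧ (p.flatMap ξ).length = p'.length := by
  set T : ℕ → Finset ℕ := fun n => occurrences (iter ξ n a) (w.flatMap (iter ξ n)) with hT
  have hstep : ∀ n, w.flatMap (iter ξ (n + 1)) = (w.flatMap (iter ξ n)).flatMap ξ := by
    intro n
    rw [List.flatMap_assoc]
    rfl
  set f : ℕ → ℕ → ℕ := fun n s => (((w.flatMap (iter ξ n)).take s).flatMap ξ).length with hf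
  have hmaps : ∀ n, ∀ s ∈ T n, f n s ∈ T (n + 1) := by
    intro n s hs
    obtain ⟨p, q, hw, rfl⟩ := mem_occurrences.1 hs
    refine mem_occurrences.2 ⟨p.flatMap ξ, q.flatMap ξ, ?_, ?_⟩
    · rw [hstep, hw, iter_succ]; simp
    · simp [hf, hw]
  have hinj : ∀ n, Set.InjOn (f n) (T n) := by
    intro n
    have hlt : ∀ s s', s ∈ T n → s' ∈ T n → s < s' → f n s < f n s' := by
      intro s s' hs hs' hlt
      obtain ⟨p, q, hw, rfl⟩ := mem_occurrences.1 hs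
      obtain ⟨p', q', hw', rfl⟩ := mem_occurrences.1 hs'
      have e1 : (w.flatMap (iter ξ n)).take p.length = p := by rw [hw]; simp
      have e2 : (w.flatMap (iter ξ n)).take p'.length = p' := by rw [hw']; simp
      have e3 : p'.take p.length = p := by
        rw [← e2, List.take_take, min_eq_left hlt.le, e1]
      have e4 := List.take_append_drop p.length p'
      rw [e3] at e4
      simp only [hf, e1, e2]
      rw [← e4, List.flatMap_append, List.length_append]
      have : p'.drop p.length ≠ [] := by simpa using hlt
      have := List.length_pos_iff.2 (flatMap_ne_nil h.ne_nil this)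
      omega
    intro s hs s' hs' he
    rcases lt_trichotomy s s' with hl | hl | hl
    · exact absurd he (hlt s s' hs hs' hl).ne
    · exact hl
    · exact absurd he.symm (hlt s' s hs' hs hl).ne
  -- Applying `ξ` injects the occurrences at level `n` into those at level `n + 1`. The numbers of
  -- occurrences increase and are bounded, so they stabilize, and from then on the injection is
  -- onto.
  have hcard : Monotone fun n => (T n).card := monotone_nat_of_le_succ fun n =>
    Finset.card_le_card_of_injOn (f n) (hmaps n) (hinj n)
  obtain ⟨C, hC⟩ := h.exists_card_occurrences_le hper a w
  obtain ⟨_, ⟨N, rfl⟩, hN⟩ := Set.exists_max_image (Set.range fun n => (T n).card) id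
    ((Set.finite_Iic C).subset (by rintro _ ⟨n, rfl⟩; exact hC n)) (Set.range_nonempty _)
  filter_upwards [eventually_ge_atTop N] with n hn p' q' hw
  have him : (T n).image (f n) = T (n + 1) := by
    apply Finset.eq_of_subset_of_card_le
    · intro s hs
      obtain ⟨s', hs', rfl⟩ := Finset.mem_image.1 hs
      exact hmaps n s' hs'
    · rw [Finset.card_image_of_injOn (hinj n)]
      exact (hN _ ⟨n + 1, rfl⟩).trans (hcard hn)
  have hp' : p'.length ∈ T (n + 1) := mem_occurrences.2 ⟨p', q', hw, rfl⟩
  rw [← him] at hp'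
  obtain ⟨s, hs, hs'⟩ := Finset.mem_image.1 hp'
  obtain ⟨p, q, hw', rfl⟩ := mem_occurrences.1 hs
  refine ⟨p, q, hw', ?_⟩
  rw [← hs']
  simp [hf, hw']

variable [TopologicalSpace A] [DiscreteTopology A]

/-- Every letter of a cut of `ξ(y)` is seen by any other parsing of the same sequence. -/
lemma exists_cut_of_tr_eq (h : PrimitiveProper ξ ℓ t) (hper : NoPeriod ξ) {y y' : ℤ → A}
    (hy : y ∈ Omega ξ) (hy' : y' ∈ Omega ξ) {j : ℤ} (he : tr j (sub ξ y) = sub ξ y') (i : ℤ) :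
    ∃ i', cuts ξ y i = j + cuts ξ y' i' ∧ y i = y' i' := by
  obtain ⟨C, hCpos, hC⟩ := h.exists_length_iter_le 0
  -- Windows of `C + 1` letters: one block for the place where `ξ^{n+1} a` starts, and `C` more
  -- whose total length is at least that of any `ξ^{n+1} a`. Windows and letters are finite in
  -- number, so one `n` serves for all.
  have hev : ∀ᶠ n in atTop, ∀ a, ∀ g : Fin (C + 1) → A, ∀ p' q',
      (List.ofFn g).flatMap (iter ξ (n + 1)) = p' ++ iter ξ (n + 1) a ++ q' →
      ∃ p q, (List.ofFn g).flatMap (iter ξ n) = p ++ iter ξ n a ++ q ∧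
        (p.flatMap ξ).length = p'.length :=
    eventually_all.2 fun a => eventually_all.2 fun g =>
      h.eventually_exists_occurrence hper a (List.ofFn g)
  obtain ⟨n, hn⟩ := hev.exists
  have hne := h.iter_ne_nil n
  obtain ⟨r, hr⟩ := h.exists_mem_towerLevel n hy
  obtain ⟨z, hz, -, rfl⟩ := mem_towerLevel.1 hr
  obtain ⟨r', hr'⟩ := h.exists_mem_towerLevel n hy'
  obtain ⟨z', hz', -, rfl⟩ := mem_towerLevel.1 hr'
  set y := tr (-r) (sub (iter ξ n) z) with hydef
  set y' := tr (-r') (sub (iter ξ n) z') with hy'def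
  -- The place `i` of `y` lies in a block `ξ^n a`. The image `ξ^{n+1} a` of this block is seen in
  -- `ξ(y')`, where it must come from an occurrence of `ξ^n a` in `y'`; the place at the same offset
  -- in that occurrence is `i'`.
  obtain ⟨b, hb1, hb2⟩ := exists_block (cuts_lt_succ hne z) (i - r)
  have ho : Occ y (cuts (iter ξ n) z b + r) (iter ξ n (z b)) := by
    rw [hydef, occ_tr]
    simpa using occ_sub hne z b
  set c := cuts (iter ξ n) z b + (r : ℤ)
  set a := z b
  rw [cuts_succ] at hb2
  change _ < _ + ((iter ξ n a).length : ℤ) at hb2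
  set e := cuts ξ y c - j with hedef
  have hoX : Occ (sub ξ y') e (iter ξ (n + 1) a) := by
    rw [← he, occ_tr, hedef, sub_add_cancel]
    exact ho.sub h.ne_nil
  have hmono : ∀ b, cuts ξ y' (cuts (iter ξ n) z' b + r') <
      cuts ξ y' (cuts (iter ξ n) z' (b + 1) + r') := fun b =>
    cuts_strictMono h.ne_nil y' (by have := cuts_lt_succ hne z' b; omega)
  obtain ⟨d, hd1, hd2⟩ := exists_block hmono e
  have hW' : Occ y' (cuts (iter ξ n) z' d + r') ((factor z' d (C + 1)).flatMap (iter ξ n)) := by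
    rw [hy'def, occ_tr]
    simpa using (occ_factor z' d (C + 1)).sub hne
  have hoblock : Occ y' (cuts (iter ξ n) z' d + r') (iter ξ n (z' d)) := by
    rw [hy'def, occ_tr]
    simpa using occ_sub hne z' d
  set c' := cuts (iter ξ n) z' d + (r' : ℤ) with hc'
  have hd2' : e < cuts ξ y' c' + (iter ξ (n + 1) (z' d)).length := by
    have := hoblock.cuts_add ξ
    rw [cuts_succ] at hd2
    rw [iter_succ, ← this, hc']
    convert hd2 using 2
    ring
  have hflat : ((factor z' d (C + 1)).flatMap (iter ξ n)).flatMap ξ =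
      (factor z' d (C + 1)).flatMap (iter ξ (n + 1)) := by
    rw [List.flatMap_assoc]; rfl
  have hWX := hW'.sub h.ne_nil
  rw [hflat] at hWX
  have hlong : (iter ξ (n + 1) (z' d)).length + (iter ξ (n + 1) a).length ≤
      ((factor z' d (C + 1)).flatMap (iter ξ (n + 1))).length := by
    have e1 : factor z' d (C + 1) = z' d :: factor z' (d + 1) C := by
      unfold factor
      rw [List.ofFn_succ]
      simp only [Fin.val_zero, Nat.cast_zero, add_zero, Fin.val_succ, Nat.cast_add, Nat.cast_one]
      congr 2
      ext i
      congr 1; ring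
    rw [e1, List.flatMap_cons, List.length_append]
    have : ∀ u : List A, u.length = C →
        (iter ξ (n + 1) a).length ≤ (u.flatMap (iter ξ (n + 1))).length := by
      intro u hu
      have hge : ∀ u : List A, u.length * (iter ξ (n + 1) a).length ≤
          C * (u.flatMap (iter ξ (n + 1))).length := by
        intro u
        induction u with
        | nil => simp
        | cons b u ih =>
          have := hC (n + 1) a b
          simp only [List.length_cons, List.flatMap_cons, List.length_append]
          rw [add_mul, mul_add, one_mul]
          rw [add_zero] at this
          omega
      have := hge u
      rw [hu] at this
      exact Nat.le_of_mul_le_mul_left this hCpos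
    have := this (factor z' (d + 1) C) (by simp)
    omega
  obtain ⟨p', q', hpq', hplen⟩ := hoX.infix_of_le hWX hd1 (by omega)
  obtain ⟨p, q, hpq, hlen⟩ := hn a _ p' q' hpq'
  change (factor z' d (C + 1)).flatMap (iter ξ n) = _ at hpq
  rw [hpq, occ_append, occ_append] at hW'
  obtain ⟨⟨hp, ha⟩, -⟩ := hW'
  have hcutp := hp.cuts_add ξ
  obtain ⟨k, hk⟩ := Int.eq_ofNat_of_zero_le (show 0 ≤ i - c by omega)
  have hk' : k < (iter ξ n a).length := by omega
  refine ⟨c' + p.length + k, ?_, ?_⟩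
  · have t1 : Occ y c ((iter ξ n a).take k ++ (iter ξ n a).drop k) := by
      rwa [List.take_append_drop]
    have t2 : Occ y' (c' + p.length) ((iter ξ n a).take k ++ (iter ξ n a).drop k) := by
      rwa [List.take_append_drop]
    have t3 := (occ_append.1 t1).1.cuts_add ξ
    have t4 := (occ_append.1 t2).1.cuts_add ξ
    rw [List.length_take, min_eq_left hk'.le] at t3 t4
    have e0 : i = c + k := by omega
    rw [e0, t3, t4, hcutp, hlen]
    omega
  · rw [ha k hk', ← ho k hk']
    congr 1; omega

/-- Recognizability of `ξ`. -/
lemma recognizable_one (h : PrimitiveProper ξ ℓ t) (hper : NoPeriod ξ) {y y' : ℤ → A}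
    (hy : y ∈ Omega ξ) (hy' : y' ∈ Omega ξ) {j : ℤ} (he : tr j (sub ξ y) = sub ξ y') :
    ∃ i, j = cuts ξ y i ∧ y' = tr i y := by
  choose φ hφ1 hφ2 using h.exists_cut_of_tr_eq hper hy hy' he
  have hmono := cuts_strictMono h.ne_nil y'
  -- The blocks of `i` and `φ i` start at the same place and carry the same letter, hence end at the
  -- same place; so `φ` is a translation.
  have hstep : ∀ i, φ (i + 1) = φ i + 1 := by
    intro i
    apply hmono.injective
    have h1 := hφ1 (i + 1)
    rw [cuts_succ, hφ1 i, hφ2 i] at h1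
    rw [cuts_succ]
    omega
  have hφ : ∀ i, φ i = φ 0 + i := by
    intro i
    induction i using Int.induction_on with
    | zero => simp
    | succ n ih => rw [hstep, ih]; ring
    | pred n ih =>
      have := hstep (-n - 1)
      rw [sub_add_cancel] at this
      omega
  refine ⟨-φ 0, ?_, ?_⟩
  · have h1 := hφ1 (-φ 0)
    rw [hφ (-φ 0), add_neg_cancel, cuts_zero, add_zero] at h1
    exact h1.symm
  · ext i
    rw [tr_apply, hφ2, hφ]
    congr 1; ring

/-- Recognizability of the powers of `ξ`. -/
lemma recognizable (h : PrimitiveProper ξ ℓ t) (hper : NoPeriod ξ) (k : ℕ) {y y' : ℤ → A}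
    (hy : y ∈ Omega ξ) (hy' : y' ∈ Omega ξ) {j : ℤ}
    (he : tr j (sub (iter ξ k) y) = sub (iter ξ k) y') :
    ∃ i, j = cuts (iter ξ k) y i ∧ y' = tr i y := by
  induction k generalizing j with
  | zero => exact ⟨j, by simp, by simpa using he.symm⟩
  | succ k ih =>
    have h1 : iter ξ 1 = ξ := by ext a : 1; exact iter_one ξ a
    have h2 := sub_iter_add h.ne_nil k 1 (A := A)
    rw [h1] at h2
    rw [← h2, ← h2] at he
    obtain ⟨i, hi, he'⟩ := h.recognizable_one hper (sub_mem_Omega h.ne_nil hy k)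
      (sub_mem_Omega h.ne_nil hy' k) he
    obtain ⟨i', rfl, hi'⟩ := ih he'.symm
    refine ⟨i', ?_, hi'⟩
    have h3 := cuts_iter_add h.ne_nil k 1 y i'
    rw [h1] at h3
    rw [hi, h3]

end PrimitiveProper

end Recognizability

/-! ### Entrance times in terms of the base points of towers -/

section Entrance

variable {A : Type*} {ξ : A → List A} {ℓ t : A}

/-- The places at which `x` has a cut of level `k`. -/
def cutSet (ξ : A → List A) (k : ℕ) (x : ℤ → A) : Set ℤ :=
  {c | ∃ y ∈ Omega ξ, tr c x = sub (iter ξ k) y}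

/-- The index is shifted by one: r_{k+1} is defined through ξ^k, that is through the cuts of level
`k`. -/
lemma entrance_succ (hξ : ∀ a, ξ a ≠ []) (k : ℕ) (x : ℤ → A) :
    entrance ξ (k + 1) x = sInf {i : ℕ | (i : ℤ) ∈ cutSet ξ k x} := by
  unfold entrance cutSet
  simp only [Nat.add_sub_cancel, mem_imageSet_iff (iter_ne_nil hξ k), shiftBy_eq_tr]
  rfl

lemma entrance_eq (hξ : ∀ a, ξ a ≠ []) {k : ℕ} {x : ℤ → A} {e : ℕ} (he : (e : ℤ) ∈ cutSet ξ k x)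
    (hmin : ∀ c ∈ cutSet ξ k x, 0 ≤ c → (e : ℤ) ≤ c) : entrance ξ (k + 1) x = e := by
  rw [entrance_succ hξ]
  apply le_antisymm (Nat.sInf_le he)
  have := hmin _ (Nat.sInf_mem (s := {i : ℕ | (i : ℤ) ∈ cutSet ξ k x}) ⟨e, he⟩) (by omega)
  exact_mod_cast this

lemma entrance_mem (hξ : ∀ a, ξ a ≠ []) {k : ℕ} {x : ℤ → A} {e : ℕ} (he : (e : ℤ) ∈ cutSet ξ k x) :
    (entrance ξ (k + 1) x : ℤ) ∈ cutSet ξ k x := by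
  rw [entrance_succ hξ]
  exact Nat.sInf_mem (s := {i : ℕ | (i : ℤ) ∈ cutSet ξ k x}) ⟨e, he⟩

lemma entrance_le (hξ : ∀ a, ξ a ≠ []) {k : ℕ} {x : ℤ → A} {c : ℤ} (hc : c ∈ cutSet ξ k x)
    (h0 : 0 ≤ c) : (entrance ξ (k + 1) x : ℤ) ≤ c := by
  obtain ⟨e, rfl⟩ := Int.eq_ofNat_of_zero_le h0
  rw [entrance_succ hξ]
  exact_mod_cast Nat.sInf_le (s := {i : ℕ | (i : ℤ) ∈ cutSet ξ k x}) hc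

@[simp] lemma entrance_one (hξ : ∀ a, ξ a ≠ []) {x : ℤ → A} (hx : x ∈ Omega ξ) :
    entrance ξ 1 x = 0 :=
  entrance_eq hξ (k := 0) ⟨x, hx, by simp⟩ fun c _ hc => by simpa using hc

namespace PrimitiveProper

variable [Finite A] [TopologicalSpace A] [DiscreteTopology A]

/-- A cut of level `k + j` is also one of level `k`, and recognizability of `ξ^k` brings it back to
a cut of level `j` of the base point `y`. -/
lemma cutSet_tower (h : PrimitiveProper ξ ℓ t) (hper : NoPeriod ξ) (k j : ℕ) {y : ℤ → A}
    (hy : y ∈ Omega ξ) (r c : ℤ) :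
    c ∈ cutSet ξ (k + j) (tr (-r) (sub (iter ξ k) y)) ↔
      ∃ i ∈ cutSet ξ j y, c = r + cuts (iter ξ k) y i := by
  have hne := h.iter_ne_nil k
  constructor
  · rintro ⟨z, hz, he⟩
    rw [tr_tr, add_comm k j, ← sub_iter_add h.ne_nil] at he
    obtain ⟨i, hi, hi'⟩ := h.recognizable hper k hy (sub_mem_Omega h.ne_nil hz j) he
    exact ⟨i, ⟨z, hz, hi'.symm⟩, by omega⟩
  · rintro ⟨i, ⟨z, hz, he⟩, rfl⟩
    refine ⟨z, hz, ?_⟩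
    rw [tr_tr, add_comm k j, ← sub_iter_add h.ne_nil, ← he, ← tr_sub hne]
    congr 1; ring

/-- The entrance times of a point of a tower of level `k` in terms of its base point. -/
lemma entrance_tower (h : PrimitiveProper ξ ℓ t) (hper : NoPeriod ξ) (k j : ℕ) {y : ℤ → A}
    (hy : y ∈ Omega ξ) {r : ℕ} (hr : r < (iter ξ k (y (-1))).length) :
    (entrance ξ (k + j + 1) (tr (-r) (sub (iter ξ k) y)) : ℤ) =
      r + cuts (iter ξ k) y (entrance ξ (j + 1) y) := by
  have hne := h.iter_ne_nil k
  have hmono := cuts_strictMono hne y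
  obtain ⟨r', hr'⟩ := h.exists_mem_towerLevel j hy
  obtain ⟨z, hz, -, hyz⟩ := mem_towerLevel.1 hr'
  have hmem : (entrance ξ (j + 1) y : ℤ) ∈ cutSet ξ j y :=
    entrance_mem h.ne_nil (e := r') ⟨z, hz, by rw [hyz, tr_tr]; simp⟩
  have h0 : 0 ≤ cuts (iter ξ k) y (entrance ξ (j + 1) y) := by
    have := hmono.monotone (show (0 : ℤ) ≤ entrance ξ (j + 1) y by omega)
    rwa [cuts_zero] at this
  obtain ⟨e, he⟩ := Int.eq_ofNat_of_zero_le
    (show 0 ≤ r + cuts (iter ξ k) y (entrance ξ (j + 1) y) by omega)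
  have : entrance ξ (k + j + 1) (tr (-r) (sub (iter ξ k) y)) = e := by
    apply entrance_eq h.ne_nil
    · rw [h.cutSet_tower hper k j hy]
      exact ⟨_, hmem, he.symm⟩
    · intro c hc hc0
      obtain ⟨i, hi, rfl⟩ := (h.cutSet_tower hper k j hy r c).1 hc
      -- The cut of index `-1` stands more than `r` places before the cut of index `0`, hence at a
      -- negative place of the tower point; only `i ≥ 0` competes.
      have h1 : cuts (iter ξ k) y (-1) = -(iter ξ k (y (-1))).length := by
        have := cuts_succ (iter ξ k) y (-1)
        rw [neg_add_cancel, cuts_zero] at this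
        omega
      have h2 : -1 < i := hmono.lt_iff_lt.1 (by omega)
      have h3 := hmono.monotone (entrance_le h.ne_nil hi (by omega))
      omega
  rw [this, he]

lemma entrance_tower_self (h : PrimitiveProper ξ ℓ t) (hper : NoPeriod ξ) (k : ℕ) {y : ℤ → A}
    (hy : y ∈ Omega ξ) {r : ℕ} (hr : r < (iter ξ k (y (-1))).length) :
    entrance ξ (k + 1) (tr (-r) (sub (iter ξ k) y)) = r := by
  have := h.entrance_tower hper k 0 hy hr
  rw [zero_add, entrance_one h.ne_nil hy] at this
  simpa using this

lemma exists_tower (h : PrimitiveProper ξ ℓ t) (hper : NoPeriod ξ) (k : ℕ) {x : ℤ → A}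
    (hx : x ∈ Omega ξ) : ∃ y ∈ Omega ξ, entrance ξ (k + 1) x < (iter ξ k (y (-1))).length ∧
      x = tr (-(entrance ξ (k + 1) x : ℕ)) (sub (iter ξ k) y) := by
  obtain ⟨r, hr⟩ := h.exists_mem_towerLevel k hx
  obtain ⟨y, hy, hlt, he⟩ := mem_towerLevel.1 hr
  have := h.entrance_tower_self hper k hy hlt
  rw [← he] at this
  rw [this]
  exact ⟨y, hy, hlt, he⟩

lemma mem_towerLevel_iff (h : PrimitiveProper ξ ℓ t) (hper : NoPeriod ξ) (k r : ℕ) {x : ℤ → A}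
    (hx : x ∈ Omega ξ) : x ∈ towerLevel ξ k r ↔ entrance ξ (k + 1) x = r := by
  constructor
  · intro hr
    obtain ⟨y, hy, hlt, rfl⟩ := mem_towerLevel.1 hr
    exact h.entrance_tower_self hper k hy hlt
  · rintro rfl
    exact mem_towerLevel.2 (h.exists_tower hper k hx)

lemma continuous_entrance (h : PrimitiveProper ξ ℓ t) (hper : NoPeriod ξ) (k : ℕ) :
    Continuous fun x : Omega ξ => entrance ξ (k + 1) x.1 := by
  have : Nonempty A := ⟨ℓ⟩
  obtain ⟨a, ha⟩ := Finite.exists_max fun a => (iter ξ k a).length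
  rw [continuous_iff_isClosed]
  intro s _
  have : (fun x : Omega ξ => entrance ξ (k + 1) x.1) ⁻¹' s =
      ⋃ r ∈ s ∩ Set.Iio (iter ξ k a).length, Subtype.val ⁻¹' towerLevel ξ k r := by
    ext x
    simp only [Set.mem_preimage, Set.mem_iUnion, h.mem_towerLevel_iff hper k _ x.2]
    constructor
    · intro hs
      obtain ⟨y, -, hlt, -⟩ := h.exists_tower hper k x.2
      exact ⟨_, ⟨hs, hlt.trans_le (ha _)⟩, rfl⟩
    · rintro ⟨r, ⟨hs, -⟩, hr⟩
      rwa [hr]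
  rw [this]
  exact Set.Finite.isClosed_biUnion ((Set.finite_Iio _).inter_of_right _)
    fun r _ => (h.isClosed_towerLevel k r).preimage continuous_subtype_val

lemma continuous_cum_entrance {E : Type*} [AddCommGroup E] [TopologicalSpace E]
    [IsTopologicalAddGroup E] (h : PrimitiveProper ξ ℓ t) (hper : NoPeriod ξ) (v : A → E) (k : ℕ) :
    Continuous fun x : Omega ξ => cum v x.1 (entrance ξ (k + 1) x.1) := by
  rw [continuous_iff_continuousAt]
  intro x
  have h1 : Continuous fun x' : Omega ξ => cum v x'.1 (entrance ξ (k + 1) x.1) :=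
    (continuous_cum v (entrance ξ (k + 1) x.1 : ℤ)).comp continuous_subtype_val
  refine h1.continuousAt.congr ?_
  filter_upwards [eventually_eq_of_continuous (h.continuous_entrance hper k) x] with x' hx'
  rw [hx']

lemma cum_entrance_tower {E : Type*} [AddCommGroup E] (h : PrimitiveProper ξ ℓ t)
    (hper : NoPeriod ξ) (v : A → E) (k j : ℕ) {y : ℤ → A} (hy : y ∈ Omega ξ) {r : ℕ}
    (hr : r < (iter ξ k (y (-1))).length) :
    cum v (tr (-r) (sub (iter ξ k) y)) (entrance ξ (k + j + 1) (tr (-r) (sub (iter ξ k) y))) =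
      cum (fun a => wt v (iter ξ k a)) y (entrance ξ (j + 1) y) -
        cum v (sub (iter ξ k) y) (-r) := by
  rw [h.entrance_tower hper k j hy hr, cum_tr]
  have : (r : ℤ) + cuts (iter ξ k) y (entrance ξ (j + 1) y) + -r =
    cuts (iter ξ k) y (entrance ξ (j + 1) y) := by ring
  rw [this, cum_sub (h.iter_ne_nil k)]

/-- The letters between the two entrance times form the image by `ξ^k` of the stretch of `y` from 0
to r_2(y). The scale `k` thus survives only in the weight. -/
lemma cum_entrance_succ_sub {E : Type*} [AddCommGroup E] (h : PrimitiveProper ξ ℓ t)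
    (hper : NoPeriod ξ) (v : A → E) (k : ℕ) {y : ℤ → A} (hy : y ∈ Omega ξ) {r : ℕ}
    (hr : r < (iter ξ k (y (-1))).length) {x : ℤ → A} (hx : x = tr (-r) (sub (iter ξ k) y)) :
    cum v x (entrance ξ (k + 2) x) - cum v x (entrance ξ (k + 1) x) =
      cum (fun a => wt v (iter ξ k a)) y (entrance ξ 2 y) := by
  have h1 := h.cum_entrance_tower hper v k 1 hy hr
  have h0 := h.cum_entrance_tower hper v k 0 hy hr
  rw [← hx] at h0 h1
  rw [h1, h0, zero_add, entrance_one h.ne_nil hy]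
  simp

end PrimitiveProper

end Entrance

/-! ### The counting vectors and the terms of the series -/

section Visits

variable {A : Type*} {ξ : A → List A} {ℓ t : A} [Fintype A] [DecidableEq A]
  [TopologicalSpace A] [DiscreteTopology A]

namespace PrimitiveProper

/-- By recognizability a visit to `ξ^k([a])` is a cut of level `k` followed by the block `ξ^k a`; in
the relevant range these are the cuts of index `q < r_2(y)` with `y q = a`. -/
lemma visits_eq (h : PrimitiveProper ξ ℓ t) (hper : NoPeriod ξ) (k : ℕ) {y : ℤ → A}
    (hy : y ∈ Omega ξ) {r : ℕ} (hr : r < (iter ξ k (y (-1))).length) {x : ℤ → A}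
    (hx : x = tr (-r) (sub (iter ξ k) y)) (a : A) :
    visits ξ (k + 1) x a = ((Finset.range (entrance ξ 2 y)).filter fun q : ℕ => y q = a).card := by
  have hne := h.iter_ne_nil k
  have hmono := cuts_strictMono hne y
  have e1 : entrance ξ (k + 1) x = r := by rw [hx]; exact h.entrance_tower_self hper k hy hr
  have e2 : (entrance ξ (k + 1 + 1) x : ℤ) = r + cuts (iter ξ k) y (entrance ξ 2 y) := by
    rw [hx]; exact h.entrance_tower hper k 1 hy hr
  have hnn : ∀ q : ℕ, 0 ≤ cuts (iter ξ k) y q := fun q => by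
    have := hmono.monotone (show (0 : ℤ) ≤ q by omega)
    rwa [cuts_zero] at this
  rw [← Set.ncard_coe_finset, visits]
  symm
  refine Set.ncard_congr (fun q _ => r + (cuts (iter ξ k) y q).toNat) ?_ ?_ ?_
  · intro q hq
    simp only [Finset.coe_filter, Finset.mem_range, Set.mem_ofPred_eq] at hq
    have h1 := hnn q
    have h2 := hmono (show (q : ℤ) < entrance ξ 2 y by omega)
    refine ⟨by omega, by omega, ?_⟩
    rw [Nat.add_sub_cancel, mem_imageSet_iff hne, shiftBy_eq_tr]
    refine ⟨tr q y, ⟨tr_mem_Omega hy q, by simpa using hq.2⟩, ?_⟩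
    rw [hx, tr_tr, ← tr_sub hne]
    congr 1; push_cast; omega
  · intro q q' _ _ he
    have h1 := hnn q
    have h2 := hnn q'
    have : (q : ℤ) = q' := hmono.injective (by omega)
    exact_mod_cast this
  · rintro i ⟨hi1, hi2, hi3⟩
    rw [Nat.add_sub_cancel, mem_imageSet_iff hne, shiftBy_eq_tr] at hi3
    obtain ⟨z, ⟨hz, hz0⟩, he⟩ := hi3
    rw [hx, tr_tr] at he
    obtain ⟨q, hq, rfl⟩ := h.recognizable hper k hy hz he
    have hq0 : 0 ≤ q := by
      rw [← hmono.le_iff_le, cuts_zero]; omega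
    obtain ⟨q, rfl⟩ := Int.eq_ofNat_of_zero_le hq0
    have hq1 : (q : ℤ) < entrance ξ 2 y := hmono.lt_iff_lt.1 (by omega)
    refine ⟨q, ?_, by omega⟩
    simp only [Finset.coe_filter, Finset.mem_range, Set.mem_ofPred_eq]
    exact ⟨by omega, by simpa using hz0⟩

lemma sum_visits_mul (h : PrimitiveProper ξ ℓ t) (hper : NoPeriod ξ) (k : ℕ) {y : ℤ → A}
    (hy : y ∈ Omega ξ) {r : ℕ} (hr : r < (iter ξ k (y (-1))).length) {x : ℤ → A}
    (hx : x = tr (-r) (sub (iter ξ k) y)) (φ : A → ℝ) :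
    ∑ a, (visits ξ (k + 1) x a : ℝ) * φ a = cum φ y (entrance ξ 2 y) := by
  rw [cum_natCast, ← Finset.sum_fiberwise (Finset.range (entrance ξ 2 y)) (fun q : ℕ => y q)]
  refine Finset.sum_congr rfl fun a _ => ?_
  rw [h.visits_eq hper k hy hr hx a, ← nsmul_eq_mul, ← Finset.sum_const]
  refine Finset.sum_congr rfl fun q hq => ?_
  rw [(Finset.mem_filter.1 hq).2]

/-- The term of index `k + 1` carries (M^t)^{k+1}, whereas the blocks crossed are the words `ξ^k a`.
The extra factor M^t goes into the weight, and the series telescopes. -/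
lemma seriesTerm_eq (h : PrimitiveProper ξ ℓ t) (hper : NoPeriod ξ) {n : ℕ} (v : Fin n → A → ℝ)
    (k : ℕ) (x : Omega ξ) :
    seriesTerm ξ v (k + 1) x =
      cum (fun a => wt (fun b i => v i b) (ξ a)) x.1 (entrance ξ (k + 2) x.1) -
        cum (fun a => wt (fun b i => v i b) (ξ a)) x.1 (entrance ξ (k + 1) x.1) := by
  obtain ⟨y, hy, hlt, hx⟩ := h.exists_tower hper k x.2
  rw [h.cum_entrance_succ_sub hper _ k hy hlt hx]
  ext i
  have h1 : ∀ φ : A → Fin n → ℝ, ∀ m : ℤ, cum φ y m i = cum (fun a => φ a i) y m := fun φ m =>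
    (map_cum (Pi.evalAddMonoidHom (fun _ : Fin n => ℝ) i) φ y m).symm
  have h2 : ∀ φ : A → Fin n → ℝ, ∀ u : List A, wt φ u i = wt (fun a => φ a i) u := fun φ u =>
    (map_wt (Pi.evalAddMonoidHom (fun _ : Fin n => ℝ) i) φ u).symm
  rw [seriesTerm, h.sum_visits_mul hper k hy hlt hx, h1]
  congr 1
  rw [pow_incidence_transpose_mulVec]
  ext a
  rw [iter_succ, wt_flatMap, h2]
  simp only [h2]

end PrimitiveProper

end Visits

/-! ### Summable decay on the contracted space -/

section Decay

/-- If the norm of some power of `T` is less than one, the norms of the powers are summable. -/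
lemma summable_norm_pow {R : Type*} [NormedRing R] {T : R} {K : ℕ} (hK : K ≠ 0)
    (hT : ‖T ^ K‖ < 1) : Summable fun k => ‖T ^ k‖ := by
  have : NeZero K := ⟨hK⟩
  rw [← (Nat.divModEquiv K).symm.summable_iff]
  have h1 : Summable fun p : ℕ × Fin K => ‖T ^ K‖ ^ p.1 * ‖T ^ (p.2 : ℕ)‖ * (max 1 ‖(1 : R)‖) := by
    apply Summable.mul_right
    exact (summable_geometric_of_lt_one (norm_nonneg _) hT).mul_of_nonneg
      (Summable.of_finite (f := fun r : Fin K => ‖T ^ (r : ℕ)‖)) (fun _ => by positivity)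
      (fun _ => by positivity)
  refine Summable.of_nonneg_of_le (fun _ => norm_nonneg _) (fun p => ?_) h1
  obtain ⟨q, r⟩ := p
  have e : (Nat.divModEquiv K).symm (q, r) = r + K * q := by
    simp [Nat.divModEquiv, mul_comm, add_comm]
  simp only [Function.comp_apply, e]
  rw [pow_add, pow_mul]
  have h2 : ‖(T ^ K) ^ q‖ ≤ ‖T ^ K‖ ^ q * max 1 ‖(1 : R)‖ := by
    rcases Nat.eq_zero_or_pos q with rfl | hq
    · simp
    · calc ‖(T ^ K) ^ q‖ ≤ ‖T ^ K‖ ^ q := norm_pow_le' _ hq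
        _ ≤ _ := le_mul_of_one_le_right (by positivity) (le_max_left _ _)
  calc ‖T ^ (r : ℕ) * (T ^ K) ^ q‖ ≤ ‖T ^ (r : ℕ)‖ * ‖(T ^ K) ^ q‖ := norm_mul_le _ _
    _ ≤ ‖T ^ (r : ℕ)‖ * (‖T ^ K‖ ^ q * max 1 ‖(1 : R)‖) := by gcongr
    _ = _ := by ring

variable {A : Type*} [Fintype A] [DecidableEq A]

lemma mulVec_mem_contracted {B : Matrix A A ℝ} {v : A → ℝ} (hv : v ∈ contracted B) :
    B.mulVec v ∈ contracted B := by
  change Tendsto _ _ _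
  have h : Tendsto (fun k : ℕ => (B ^ k).mulVec v) atTop (𝓝 0) := hv
  refine ((tendsto_add_atTop_iff_nat 1).2 h).congr fun k => ?_
  rw [pow_succ, Matrix.mulVec_mulVec]

/-- On the finite-dimensional contracted space the powers of the restriction `T` tend to 0 on a
basis, so some power has norm at most 1/2; this upgrades mere convergence to summability. -/
lemma summable_norm_pow_mulVec {B : Matrix A A ℝ} {v : A → ℝ} (hv : v ∈ contracted B) :
    Summable fun k => ‖(B ^ k).mulVec v‖ := by
  let T : contracted B →L[ℝ] contracted B := LinearMap.toContinuousLinearMap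
    (B.mulVecLin.restrict (p := contracted B) (q := contracted B)
      fun v hv => mulVec_mem_contracted hv)
  have hT : ∀ k (w : contracted B), ((T ^ k) w : A → ℝ) = (B ^ k).mulVec w := by
    intro k
    induction k with
    | zero => intro w; simp
    | succ k ih =>
      intro w
      have : ((T w : contracted B) : A → ℝ) = B.mulVec w := rfl
      rw [pow_succ, mul_apply_eq_comp, ih, this, pow_succ, Matrix.mulVec_mulVec]
  have hlim : ∀ w : contracted B, Tendsto (fun k => ‖(T ^ k) w‖) atTop (𝓝 0) := by
    intro w
    have h : Tendsto (fun k : ℕ => (B ^ k).mulVec (w : A → ℝ)) atTop (𝓝 0) := w.2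
    have := h.norm
    rw [norm_zero] at this
    refine this.congr fun k => ?_
    rw [← hT]
    rfl
  let b := Module.finBasis ℝ (contracted B)
  obtain ⟨C, hC, hle⟩ := b.exists_opNorm_le (F := contracted B) (𝕜 := ℝ)
  have hev : ∀ᶠ k in atTop, ∀ i, ‖(T ^ k) (b i)‖ ≤ (2 * C)⁻¹ :=
    eventually_all.2 fun i => (hlim (b i)).eventually_le_const (by positivity)
  obtain ⟨K, hK, hK1⟩ := (hev.and (eventually_ge_atTop 1)).exists
  have hKn : ‖T ^ K‖ < 1 := by
    have := hle (u := T ^ K) (M := (2 * C)⁻¹) (by positivity) hK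
    have e : C * (2 * C)⁻¹ = 1 / 2 := by field_simp
    rw [e] at this
    linarith
  refine Summable.of_nonneg_of_le (fun _ => norm_nonneg _) (fun k => ?_)
    ((summable_norm_pow (R := contracted B →L[ℝ] contracted B) (T := T)
      (Nat.one_le_iff_ne_zero.1 hK1) hKn).mul_right ‖v‖)
  have := (T ^ k).le_opNorm ⟨v, hv⟩
  calc ‖(B ^ k).mulVec v‖ = ‖(T ^ k) ⟨v, hv⟩‖ := by rw [← hT k ⟨v, hv⟩]; rfl
    _ ≤ _ := this

end Decay

/-! ### The limit map: convergence, continuity, self-affinity -/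

section LimitMap

variable {A : Type*} {ξ : A → List A} {ℓ t : A}
variable {E : Type*} [NormedAddCommGroup E]

/-- The limit of the sums of `v` over `x_0 ⋯ x_{r-1}` along the entrance times `r` of `x`. -/
noncomputable def limitMap (ξ : A → List A) (v : A → E) (x : ℤ → A) : E :=
  ∑' k : ℕ, (cum v x (entrance ξ (k + 2) x) - cum v x (entrance ξ (k + 1) x))

variable [Fintype A]

/-- The sums of `v` over the words `ξ^k a` are summable in `k`, uniformly in `a`. -/
def SummableWeight (ξ : A → List A) (v : A → E) : Prop :=
  Summable fun k => ‖fun a => wt v (iter ξ k a)‖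

lemma SummableWeight.iterate {v : A → E} (hv : SummableWeight ξ v) (k : ℕ) :
    SummableWeight ξ fun a => wt v (iter ξ k a) := by
  refine ((summable_nat_add_iff k).2 hv).congr fun j => ?_
  congr 1
  ext a
  rw [← iter_add, wt_flatMap]

lemma SummableWeight.tendsto {v : A → E} (hv : SummableWeight ξ v) (a : A) :
    Tendsto (fun k => wt v (iter ξ k a)) atTop (𝓝 0) :=
  squeeze_zero_norm (fun k => norm_le_pi_norm (fun a => wt v (iter ξ k a)) a) hv.tendsto_atTop_zero

lemma norm_cum_natCast_le (v : A → E) (x : ℤ → A) (m : ℕ) : ‖cum v x m‖ ≤ m * ‖v‖ := by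
  rw [cum_natCast]
  refine (norm_sum_le _ _).trans ?_
  calc ∑ i ∈ Finset.range m, ‖v (x i)‖ ≤ ∑ _i ∈ Finset.range m, ‖v‖ :=
        Finset.sum_le_sum fun i _ => norm_le_pi_norm v _
    _ = m * ‖v‖ := by simp

variable [TopologicalSpace A] [DiscreteTopology A]

namespace PrimitiveProper

lemma exists_norm_term_le (h : PrimitiveProper ξ ℓ t) (hper : NoPeriod ξ) (v : A → E) :
    ∃ D : ℝ, ∀ k, ∀ x ∈ Omega ξ,
      ‖cum v x (entrance ξ (k + 2) x) - cum v x (entrance ξ (k + 1) x)‖ ≤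
        D * ‖fun a => wt v (iter ξ k a)‖ := by
  have : Nonempty A := ⟨ℓ⟩
  obtain ⟨a, ha⟩ := Finite.exists_max fun a => (iter ξ 1 a).length
  refine ⟨(iter ξ 1 a).length, fun k x hx => ?_⟩
  obtain ⟨y, hy, hlt, hxy⟩ := h.exists_tower hper k hx
  rw [h.cum_entrance_succ_sub hper v k hy hlt hxy]
  -- Placing `y` in a tower of level 1 bounds r_2(y) by the length of some `ξ b`.
  obtain ⟨z, -, hlt', -⟩ := h.exists_tower hper 1 hy
  refine (norm_cum_natCast_le _ _ _).trans ?_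
  gcongr
  exact hlt'.le.trans (ha _)

variable [CompleteSpace E] {v : A → E}

lemma tendsto_limitMap (h : PrimitiveProper ξ ℓ t) (hper : NoPeriod ξ) (hv : SummableWeight ξ v)
    {x : ℤ → A} (hx : x ∈ Omega ξ) :
    Tendsto (fun k => cum v x (entrance ξ (k + 1) x)) atTop (𝓝 (limitMap ξ v x)) := by
  obtain ⟨D, hD⟩ := h.exists_norm_term_le hper v
  have hs : Summable fun k : ℕ => cum v x (entrance ξ (k + 2) x) - cum v x (entrance ξ (k + 1) x) :=
    Summable.of_norm_bounded (hv.mul_left D) fun k => hD k x hx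
  refine hs.hasSum.tendsto_sum_nat.congr fun m => ?_
  rw [Finset.sum_range_sub (fun k => cum v x (entrance ξ (k + 1) x)), zero_add,
    entrance_one h.ne_nil hx]
  simp

lemma tendstoUniformly_limitMap (h : PrimitiveProper ξ ℓ t) (hper : NoPeriod ξ)
    (hv : SummableWeight ξ v) :
    TendstoUniformly (fun (N : ℕ) (x : Omega ξ) => ∑ k ∈ Finset.range N,
      (cum v x.1 (entrance ξ (k + 2) x.1) - cum v x.1 (entrance ξ (k + 1) x.1)))
      (fun x => limitMap ξ v x.1) atTop := by
  obtain ⟨D, hD⟩ := h.exists_norm_term_le hper v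
  exact tendstoUniformly_tsum_nat (hv.mul_left D) fun k x => hD k x.1 x.2

lemma continuous_limitMap (h : PrimitiveProper ξ ℓ t) (hper : NoPeriod ξ)
    (hv : SummableWeight ξ v) : Continuous fun x : Omega ξ => limitMap ξ v x.1 := by
  obtain ⟨D, hD⟩ := h.exists_norm_term_le hper v
  exact continuous_tsum (fun k => (h.continuous_cum_entrance hper v (k + 1)).sub
    (h.continuous_cum_entrance hper v k)) (hv.mul_left D) fun k x => hD k x.1 x.2

/-- The partial sums at level `k` are uniformly close to the limit map. -/
lemma eventually_norm_limitMap_sub_le (h : PrimitiveProper ξ ℓ t) (hper : NoPeriod ξ)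
    (hv : SummableWeight ξ v) {ε : ℝ} (hε : 0 < ε) : ∀ᶠ k in atTop, ∀ x ∈ Omega ξ,
      ‖limitMap ξ v x - cum v x (entrance ξ (k + 1) x)‖ < ε := by
  filter_upwards [Metric.tendstoUniformly_iff.1 (h.tendstoUniformly_limitMap hper hv) ε hε]
    with k hk x hx
  have := hk ⟨x, hx⟩
  rw [dist_eq_norm, Finset.sum_range_sub (fun k => cum v x (entrance ξ (k + 1) x)), zero_add,
    entrance_one h.ne_nil hx] at this
  simpa using this

/-- Self-affinity of the limit map. -/
lemma limitMap_tower (h : PrimitiveProper ξ ℓ t) (hper : NoPeriod ξ) (hv : SummableWeight ξ v)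
    (k : ℕ) {y : ℤ → A} (hy : y ∈ Omega ξ) {r : ℕ} (hr : r < (iter ξ k (y (-1))).length) :
    limitMap ξ v (tr (-r) (sub (iter ξ k) y)) =
      limitMap ξ (fun a => wt v (iter ξ k a)) y - cum v (sub (iter ξ k) y) (-r) := by
  have hx : tr (-r) (sub (iter ξ k) y) ∈ Omega ξ := tr_mem_Omega (sub_mem_Omega h.ne_nil hy k) _
  have h1 := (tendsto_add_atTop_iff_nat k).2 (h.tendsto_limitMap hper hv hx)
  have h2 := (h.tendsto_limitMap hper (hv.iterate k) hy).sub_const (cum v (sub (iter ξ k) y) (-r))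
  refine tendsto_nhds_unique h1 (h2.congr fun j => ?_)
  rw [← h.cum_entrance_tower hper v k j hy hr, add_comm j k]

lemma limitMap_map {E' : Type*} [NormedAddCommGroup E'] [NormedSpace ℝ E] [NormedSpace ℝ E']
    [CompleteSpace E'] (h : PrimitiveProper ξ ℓ t) (hper : NoPeriod ξ) (hv : SummableWeight ξ v)
    (L : E →L[ℝ] E') (hv' : SummableWeight ξ fun a => L (v a)) {x : ℤ → A} (hx : x ∈ Omega ξ) :
    limitMap ξ (fun a => L (v a)) x = L (limitMap ξ v x) := by
  refine tendsto_nhds_unique (h.tendsto_limitMap hper hv' hx)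
    (((L.continuous.tendsto _).comp (h.tendsto_limitMap hper hv hx)).congr fun k => ?_)
  exact (map_cum (L : E →+ E') v x _).symm

end PrimitiveProper

end LimitMap

/-! ### Contracted vectors give summable weights -/

section StableSpace

variable {A : Type*} [Fintype A] [DecidableEq A] {ξ : A → List A} {n : ℕ}

lemma summableWeight_of_contracted {v : Fin n → A → ℝ}
    (hv : ∀ i, v i ∈ contracted (incidence ξ).transpose) :
    SummableWeight ξ fun a i => v i a := by
  have h1 := summable_sum fun i (_ : i ∈ Finset.univ) => summable_norm_pow_mulVec (hv i)
  refine Summable.of_nonneg_of_le (fun _ => norm_nonneg _) (fun k => ?_) h1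
  refine (pi_norm_le_iff_of_nonneg (Finset.sum_nonneg fun _ _ => norm_nonneg _)).2 fun a => ?_
  refine (pi_norm_le_iff_of_nonneg (Finset.sum_nonneg fun _ _ => norm_nonneg _)).2 fun i => ?_
  have h2 : wt (fun a i => v i a) (iter ξ k a) i = wt (v i) (iter ξ k a) :=
    (map_wt (Pi.evalAddMonoidHom (fun _ : Fin n => ℝ) i) (fun a i => v i a) _).symm
  rw [h2]
  refine le_trans ?_ (Finset.single_le_sum
    (f := fun i => ‖((incidence ξ).transpose ^ k).mulVec (v i)‖)
    (fun _ _ => norm_nonneg _) (Finset.mem_univ i))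
  have := norm_le_pi_norm (((incidence ξ).transpose ^ k).mulVec (v i)) a
  rwa [pow_incidence_transpose_mulVec] at this ⊢

end StableSpace

/-! ### Approximation of an eigenfunction by continuous functions -/

section Approximation

/-- Put δ = ∫ ‖f‖. Integrated, and by invariance of `μ`, the left side is at most 2Lεδ and the right
side equals 3Lεδ > 0; so the inequality holds with positive probability, while the eigenvalue
relation holds along almost every orbit. The surplus term forces `f x ≠ 0` and pays later for the
variation of `g`. -/
lemma exists_good_point {X : Type*} [MeasurableSpace X] {μ : Measure X}
    {T : X → X} (hT : MeasurePreserving T μ μ) {f g : X → ℂ} (hf : Integrable f μ)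
    (hg : Integrable g μ) {z : ℂ} (hfz : (fun x => f (T x)) =ᵐ[μ] fun x => z * f x)
    [IsProbabilityMeasure μ] {ε : ℝ} (hε : 0 < ε) (hf0 : 0 < ∫ x, ‖f x‖ ∂μ)
    (hfg : ∫ x, ‖f x - g x‖ ∂μ ≤ ε * ∫ x, ‖f x‖ ∂μ) {L : ℕ} (hL : 0 < L) :
    ∃ x, (∀ i : ℕ, f (T^[i] x) = z ^ i * f x) ∧
      ∑ i ∈ Finset.range L, ‖f (T^[i] x) - g (T^[i] x)‖ + L * (ε * ∫ x, ‖f x‖ ∂μ) <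
        L * (3 * ε * ‖f x‖) := by
  have hiter : ∀ i : ℕ, MeasurePreserving T^[i] μ μ := fun i => hT.iterate i
  have hae : ∀ᵐ x ∂μ, ∀ i : ℕ, f (T^[i] x) = z ^ i * f x := by
    rw [ae_all_iff]
    intro i
    induction i with
    | zero => simp
    | succ i ih =>
      filter_upwards [ih, (hiter i).quasiMeasurePreserving.ae hfz] with x hx hx'
      rw [Function.iterate_succ_apply', hx', hx, pow_succ']
      ring
  set δ := ∫ x, ‖f x‖ ∂μ with hδ
  have hd : Integrable (fun x => ‖f x - g x‖) μ := (hf.sub hg).norm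
  have hdi : ∀ i : ℕ, Integrable (fun x => ‖f (T^[i] x) - g (T^[i] x)‖) μ := fun i =>
    (hiter i).integrable_comp_of_integrable hd
  have hdint : ∀ i : ℕ, ∫ x, ‖f (T^[i] x) - g (T^[i] x)‖ ∂μ = ∫ x, ‖f x - g x‖ ∂μ := by
    intro i
    have := integral_map (hiter i).measurable.aemeasurable (f := fun x => ‖f x - g x‖)
      (by rw [(hiter i).map_eq]; exact hd.aestronglyMeasurable)
    rw [(hiter i).map_eq] at this
    exact this.symm
  let φ : X → ℝ := fun x => ∑ i ∈ Finset.range L, ‖f (T^[i] x) - g (T^[i] x)‖ + L * (ε * δ) -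
    L * (3 * ε * ‖f x‖)
  have hs : Integrable (fun x => ∑ i ∈ Finset.range L, ‖f (T^[i] x) - g (T^[i] x)‖) μ :=
    integrable_finsetSum _ fun i _ => hdi i
  have hφint : ∫ x, φ x ∂μ < 0 := by
    have e1 : ∫ x, φ x ∂μ = (∑ i ∈ Finset.range L, ∫ x, ‖f (T^[i] x) - g (T^[i] x)‖ ∂μ +
        L * (ε * δ)) - L * (3 * ε * δ) := by
      have e2 : ∫ x, (L : ℝ) * (3 * ε * ‖f x‖) ∂μ = L * (3 * ε * δ) := by
        rw [integral_const_mul, integral_const_mul]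
      have hs' : Integrable (fun x => ∑ i ∈ Finset.range L, ‖f (T^[i] x) - g (T^[i] x)‖ +
          L * (ε * δ)) μ := hs.add (integrable_const _)
      rw [integral_sub hs' ((hf.norm.const_mul _).const_mul _),
        integral_add hs (integrable_const _), integral_finsetSum _ fun i _ => hdi i, e2]
      simp
    rw [e1]
    simp only [hdint, Finset.sum_const, Finset.card_range, nsmul_eq_mul]
    have hL' : (0 : ℝ) < L := by exact_mod_cast hL
    have h1 := mul_le_mul_of_nonneg_left hfg hL'.le
    have h2 : 0 < (L : ℝ) * (ε * δ) := by positivity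
    linarith
  have hfreq : ∃ᵐ x ∂μ, φ x < 0 := by
    intro hcon
    have : 0 ≤ ∫ x, φ x ∂μ := integral_nonneg_of_ae (by
      filter_upwards [hcon] with x hx using not_lt.1 hx)
    linarith
  obtain ⟨x, hx1, hx2⟩ := (hfreq.and_eventually hae).exists
  exact ⟨x, hx2, by simpa [φ, sub_neg] using hx1⟩

variable {A : Type*} [TopologicalSpace A] [DiscreteTopology A] [Finite A] {ξ : A → List A}

/-- Otherwise the pairs that agree on [-N, N] but are separated by `g` form decreasing non-empty
compact sets, and a common point would lie on the diagonal. -/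
lemma exists_window_uniform {g : Omega ξ → ℂ} (hg : Continuous g) {η : ℝ} (hη : 0 < η) :
    ∃ N : ℕ, ∀ x x' : Omega ξ, (∀ i : ℤ, -N ≤ i → i ≤ N → x.1 i = x'.1 i) →
      ‖g x - g x'‖ < η := by
  by_contra! hcon
  let K : ℕ → Set (Omega ξ × Omega ξ) := fun N =>
    {p | (∀ i : ℤ, -N ≤ i → i ≤ N → p.1.1 i = p.2.1 i) ∧ η ≤ ‖g p.1 - g p.2‖}
  have hcl : ∀ N, IsClosed (K N) := by
    intro N
    have h1 : IsClosed {p : Omega ξ × Omega ξ | ∀ i : ℤ, -N ≤ i → i ≤ N → p.1.1 i = p.2.1 i} := by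
      simp only [Set.ofPred_forall]
      refine isClosed_iInter fun i => isClosed_iInter fun _ => isClosed_iInter fun _ => ?_
      exact isClosed_eq
        ((continuous_apply i).comp (continuous_subtype_val.comp continuous_fst))
        ((continuous_apply i).comp (continuous_subtype_val.comp continuous_snd))
    exact h1.inter (isClosed_le continuous_const
      ((hg.comp continuous_fst).sub (hg.comp continuous_snd)).norm)
  obtain ⟨⟨x, x'⟩, hx⟩ := IsCompact.nonempty_iInter_of_sequence_nonempty_isCompact_isClosed K
    (fun N p hp => ⟨fun i h1 h2 => hp.1 i (by push_cast; omega) (by push_cast; omega), hp.2⟩)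
    (fun N => by
      obtain ⟨x, x', h1, h2⟩ := hcon N
      exact ⟨(x, x'), h1, h2⟩)
    (hcl 0).isCompact hcl
  have hx' := Set.mem_iInter.1 hx
  have : x = x' := by
    apply Subtype.ext
    ext i
    exact (hx' i.natAbs).1 i (by omega) (by omega)
  have h2 := (hx' 0).2
  simp only [this, sub_self, norm_zero] at h2
  linarith

end Approximation

/-! ### Eigenvalues satisfy z^{|ξ^n b|} → 1 -/

section Eigenvalue

variable {A : Type*} {ξ : A → List A} {ℓ t : A}

lemma shift_iterate (i : ℕ) (x : Omega ξ) : ((shift ξ)^[i] x).1 = tr i x.1 := by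
  induction i with
  | zero => simp
  | succ i ih =>
    rw [Function.iterate_succ_apply']
    change shiftBy 1 ((shift ξ)^[i] x).1 = _
    rw [shiftBy_eq_tr, ih, tr_tr]
    congr 1; push_cast; ring

variable [Finite A] [TopologicalSpace A] [DiscreteTopology A]

/-- The words `ξ^{n+1} b ξ^n ℓ` occur in `Ω_ξ` with gaps bounded by a multiple of `|ξ^n ℓ|`. -/
lemma PrimitiveProper.exists_occ_return (h : PrimitiveProper ξ ℓ t) (b : A) :
    ∃ C : ℕ, 0 < C ∧ ∀ n, ∃ L : ℕ, 0 < L ∧ L ≤ C * (iter ξ n ℓ).length ∧ ∀ x ∈ Omega ξ, ∃ p : ℕ,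
      Occ x p (iter ξ (n + 1) b ++ iter ξ n ℓ) ∧
        p + (iter ξ (n + 1) b ++ iter ξ n ℓ).length ≤ L := by
  have : Nonempty A := ⟨ℓ⟩
  obtain ⟨u, huΩ, -, hocc⟩ := h.exists_fixedPoint
  obtain ⟨K, hK⟩ := h.mem_iter
  obtain ⟨s, hs⟩ := hocc [b] ⟨K, b, by
    obtain ⟨p, q, hpq⟩ := List.append_of_mem (hK K le_rfl b b)
    exact ⟨p, q, by simp [hpq]⟩⟩
  have hb : u s = b := occ_singleton.1 hs
  obtain ⟨q, hq⟩ := (h.eventually_infix_iter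
    ((mem_Omega_iff.1 huΩ) s [b, u (s + 1)] (by simp [occ_cons, occ_nil, hb]))).exists
  obtain ⟨C, hC, hle⟩ := h.exists_length_iter_le (1 + q)
  refine ⟨2 * C, by omega, fun n => ?_⟩
  obtain ⟨a, ha⟩ := Finite.exists_max fun a => (iter ξ (n + (1 + q)) a).length
  -- Less than one block of level `n + 1 + q` leads to the next cut, and the block that follows
  -- contains the word.
  refine ⟨2 * (iter ξ (n + (1 + q)) a).length,
    Nat.mul_pos two_pos (h.length_iter_pos _ _), ?_, fun x hx => ?_⟩
  · have := hle n a ℓ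
    rw [mul_assoc]; omega
  obtain ⟨r, hr⟩ := h.exists_mem_towerLevel (n + (1 + q)) hx
  obtain ⟨y, hy, hlt, rfl⟩ := mem_towerLevel.1 hr
  obtain ⟨p1, q1, hpq⟩ := hq (y 0)
  obtain ⟨w, hw⟩ := h.iter_prefix n (u (s + 1))
  have e1 : iter ξ (n + (1 + q)) (y 0) = p1.flatMap (iter ξ (n + 1)) ++
      (iter ξ (n + 1) b ++ iter ξ n ℓ) ++ (w ++ q1.flatMap (iter ξ (n + 1))) := by
    have : n + (1 + q) = q + (n + 1) := by ring
    rw [this, ← iter_add, ← hpq]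
    simp [← hw]
  have ho := occ_sub (h.iter_ne_nil (n + (1 + q))) y 0
  rw [cuts_zero, e1, occ_append, occ_append] at ho
  refine ⟨r + (p1.flatMap (iter ξ (n + 1))).length, ?_, ?_⟩
  · rw [occ_tr]
    convert ho.1.2 using 1
    push_cast; ring
  · have h1 := congrArg List.length e1
    simp only [List.length_append] at h1 ⊢
    have h2 := ha (y 0)
    have h3 := ha (y (-1))
    omega

/-- Since `ξ^{n+1} b` begins with `ξ^n ℓ`, an occurrence of `ξ^{n+1} b ξ^n ℓ` shows `ξ^n ℓ` twice,
at distance H = |ξ^{n+1} b|. For most places i in it, S^i x and S^{i+H} x agree on a long window, so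
a continuous `g` near `f` nearly takes the same value at both, whereas ‖f(S^{i+H}x) - f(S^i x)‖ =
‖z^H - 1‖ ‖f(x)‖. Such i fill a fixed proportion of a segment of length L, so the mean error between
`f` and `g` suffices. -/
lemma PrimitiveProper.tendsto_pow_length (h : PrimitiveProper ξ ℓ t) [MeasurableSpace (Omega ξ)]
    [BorelSpace (Omega ξ)] (μ : Measure (Omega ξ)) [IsProbabilityMeasure μ]
    (hμ : MeasurePreserving (shift ξ) μ μ) {z : ℂ} (hz : ‖z‖ = 1)
    (hev : IsEigenvalue μ (shift ξ) z) (b : A) :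
    Tendsto (fun n => z ^ (iter ξ n b).length) atTop (𝓝 1) := by
  obtain ⟨f, hf2, hf0, hfz⟩ := hev
  have hf : Integrable f μ := hf2.integrable (by norm_num)
  have hδ : 0 < ∫ x, ‖f x‖ ∂μ := by
    rw [integral_pos_iff_support_of_nonneg (fun _ => norm_nonneg _) hf.norm]
    refine pos_iff_ne_zero.2 fun h0 => hf0 ?_
    refine (ae_iff.2 ?_)
    convert h0 using 2
    ext x; simp
  set δ := ∫ x, ‖f x‖ ∂μ with hδdef
  rw [← tendsto_add_atTop_iff_nat 1]
  obtain ⟨C, hC, hL⟩ := h.exists_occ_return b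
  rw [Metric.tendsto_atTop']
  intro ε' hε'
  -- The sum runs over `Q = m - 2N` places, and m ≥ 4N + 1 gives m ≤ 2Q; with L ≤ C m the final
  -- bound is ‖z^H - 1‖ < 12 C ε = ε'/2.
  set ε := ε' / (24 * C) with hε
  have hC' : (0 : ℝ) < C := by exact_mod_cast hC
  have hεpos : 0 < ε := by positivity
  obtain ⟨g, hfg, hg⟩ := hf.exists_boundedContinuous_integral_sub_le (mul_pos hεpos hδ)
  obtain ⟨N, hN⟩ := exists_window_uniform g.continuous (mul_pos hεpos hδ)
  obtain ⟨n₀, hn₀⟩ := eventually_atTop.1 ((h.grow ℓ).eventually_ge_atTop (4 * N + 1))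
  refine ⟨n₀, fun n hn => ?_⟩
  obtain ⟨L, hLpos, hLle, hLx⟩ := hL n
  obtain ⟨x, hxz, hx⟩ := exists_good_point hμ hf hg hfz hεpos hδ hfg hLpos
  obtain ⟨p, hp, hpL⟩ := hLx x.1 x.2
  set H := (iter ξ (n + 1) b).length with hH
  set m := (iter ξ n ℓ).length with hm
  have hmN : 4 * N + 1 ≤ m := hn₀ n hn.le
  obtain ⟨w, hw⟩ := h.iter_prefix n b
  rw [occ_append] at hp
  have hp1 : Occ x.1 p (iter ξ n ℓ) := by
    have := hp.1
    rw [← hw, occ_append] at this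
    exact this.1
  have hp2 := hp.2
  rw [List.length_append] at hpL
  have hmH : m ≤ H := by rw [hm, hH, ← hw]; simp
  have hfx : 0 < ‖f x‖ := by
    have h1 : 0 ≤ ∑ i ∈ Finset.range L, ‖f ((shift ξ)^[i] x) - g ((shift ξ)^[i] x)‖ :=
      Finset.sum_nonneg fun _ _ => norm_nonneg _
    have hL' : (0 : ℝ) < L := by exact_mod_cast hLpos
    have h2 : 0 < (L : ℝ) * (ε * δ) := by positivity
    by_contra hcon
    have h3 : ‖f x‖ = 0 := le_antisymm (not_lt.1 hcon) (norm_nonneg _)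
    rw [h3] at hx
    simp only [mul_zero] at hx
    linarith
  set D : ℕ → ℝ := fun i => ‖f ((shift ξ)^[i] x) - g ((shift ξ)^[i] x)‖ with hD
  have hD0 : ∀ i, 0 ≤ D i := fun _ => norm_nonneg _
  have hterm : ∀ i ∈ Finset.Ico (p + N) (p + m - N),
      ‖z ^ H - 1‖ * ‖f x‖ ≤ D (i + H) + D i + ε * δ := by
    intro i hi
    rw [Finset.mem_Ico] at hi
    have hclose := hN ((shift ξ)^[i + H] x) ((shift ξ)^[i] x) (fun s hs1 hs2 => by
      rw [shift_iterate, shift_iterate, tr_apply, tr_apply]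
      obtain ⟨j, hj⟩ := Int.eq_ofNat_of_zero_le (show 0 ≤ s + i - p by omega)
      have hjm : j < (iter ξ n ℓ).length := by omega
      have e1 := hp1 j hjm
      have e2 := hp2 j hjm
      rw [← e1] at e2
      have e3 : s + ((i + H : ℕ) : ℤ) = p + (iter ξ (n + 1) b).length + j := by omega
      have e4 : s + (i : ℤ) = p + j := by omega
      rw [e3, e4, e2])
    have e : ‖z ^ H - 1‖ * ‖f x‖ = ‖f ((shift ξ)^[i + H] x) - f ((shift ξ)^[i] x)‖ := by
      rw [hxz, hxz]
      have : z ^ (i + H) * f x - z ^ i * f x = z ^ i * ((z ^ H - 1) * f x) := by ring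
      rw [this, norm_mul, norm_mul, norm_pow, hz, one_pow, one_mul]
    rw [e]
    have e5 : f ((shift ξ)^[i + H] x) - f ((shift ξ)^[i] x) =
        (f ((shift ξ)^[i + H] x) - g ((shift ξ)^[i + H] x)) -
        (f ((shift ξ)^[i] x) - g ((shift ξ)^[i] x)) +
        (g ((shift ξ)^[i + H] x) - g ((shift ξ)^[i] x)) := by ring
    rw [e5]
    refine (norm_add_le _ _).trans ?_
    exact add_le_add (norm_sub_le _ _) hclose.le
  have hsum := Finset.sum_le_sum hterm
  rw [Finset.sum_const, Finset.sum_add_distrib, Finset.sum_add_distrib, Finset.sum_const,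
    Nat.card_Ico, nsmul_eq_mul, nsmul_eq_mul] at hsum
  have hsub : ∀ c d : ℕ, d ≤ L → ∑ i ∈ Finset.Ico c d, D i ≤ ∑ i ∈ Finset.range L, D i :=
    fun c d hd => Finset.sum_le_sum_of_subset_of_nonneg
      (fun i hi => by simp at hi ⊢; omega) fun _ _ _ => hD0 _
  have hs1 := hsub (p + N) (p + m - N) (by omega)
  have hs2 : ∑ i ∈ Finset.Ico (p + N) (p + m - N), D (i + H) ≤ ∑ i ∈ Finset.range L, D i := by
    rw [Finset.sum_Ico_add' D]
    exact hsub _ _ (by omega)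
  set Q := p + m - N - (p + N) with hQ
  have hQL : (Q : ℝ) ≤ L := by exact_mod_cast (show Q ≤ L by omega)
  have hQm : (m : ℝ) ≤ 2 * Q := by exact_mod_cast (show m ≤ 2 * Q by omega)
  have hLm : (L : ℝ) ≤ C * m := by exact_mod_cast hLle
  have h5 : (Q : ℝ) * (ε * δ) ≤ L * (ε * δ) := by
    have : 0 ≤ ε * δ := by positivity
    gcongr
  have h6 : (Q : ℝ) * (‖z ^ H - 1‖ * ‖f x‖) < L * (6 * ε * ‖f x‖) := by
    have h7 : (0 : ℝ) ≤ L * (ε * δ) := by positivity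
    change ∑ i ∈ Finset.range L, D i + _ < _ at hx
    linarith
  have h8 : (Q : ℝ) * ‖z ^ H - 1‖ < L * (6 * ε) := by
    rw [← mul_assoc, ← mul_assoc] at h6
    exact lt_of_mul_lt_mul_right h6 hfx.le
  have hQpos : (0 : ℝ) < Q := by exact_mod_cast (show 0 < Q by omega)
  have h9 : (Q : ℝ) * ‖z ^ H - 1‖ < Q * (12 * C * ε) := by
    calc (Q : ℝ) * ‖z ^ H - 1‖ < L * (6 * ε) := h8
      _ ≤ (C * (2 * Q)) * (6 * ε) := by gcongr; exact hLm.trans (by gcongr)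
      _ = _ := by ring
  have h10 := lt_of_mul_lt_mul_left h9 hQpos.le
  rw [dist_eq_norm]
  have h11 : 12 * (C : ℝ) * ε = ε' / 2 := by rw [hε]; field_simp; norm_num
  linarith

end Eigenvalue

/-! ### Fractional parts, independence over ℚ and aperiodicity -/

section Rotation

lemma int_relation_trivial {n : ℕ} {α : Fin n → ℝ}
    (hα : LinearIndependent ℚ (Fin.cons 1 α : Fin (n + 1) → ℝ)) {k : Fin n → ℤ} {m : ℤ}
    (h : ∑ i, (k i : ℝ) * α i = m) : k = 0 := by
  rw [Fintype.linearIndependent_iff] at hα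
  have := hα (Fin.cons (-(m : ℚ)) fun i => (k i : ℚ)) (by
    rw [Fin.sum_univ_succ]
    simp only [Fin.cons_zero, Fin.cons_succ, Rat.smul_def]
    push_cast
    rw [h]; ring)
  ext i
  have h1 := this i.succ
  rw [Fin.cons_succ] at h1
  exact_mod_cast h1

/-- With `s = θ - round θ` the right side is 2|sin πs|, and |sin y| ≥ (2/π)|y| for |y| ≤ π/2. -/
lemma abs_sub_round_le_norm_exp (θ : ℝ) :
    |θ - round θ| ≤ ‖Complex.exp (2 * Real.pi * Complex.I * (θ : ℂ)) - 1‖ := by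
  set s := θ - round θ with hs
  have h1 : Complex.exp (2 * Real.pi * Complex.I * (θ : ℂ)) =
      Complex.exp (Complex.I * ((2 * Real.pi * s : ℝ) : ℂ)) := by
    rw [Complex.exp_eq_exp_iff_exists_int]
    refine ⟨round θ, ?_⟩
    rw [hs]; push_cast; ring
  have h2 : 2 * Real.pi * s / 2 = Real.pi * s := by ring
  rw [h1, Complex.norm_exp_I_mul_ofReal_sub_one, h2, norm_mul, Real.norm_eq_abs, Real.norm_eq_abs]
  have h3 : |s| ≤ 1 / 2 := abs_sub_round θ
  have hpi := Real.pi_pos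
  have h4 : |Real.pi * s| ≤ Real.pi / 2 := by
    rw [abs_mul, abs_of_pos hpi]; nlinarith
  have h5 := Real.mul_abs_le_abs_sin h4
  rw [abs_mul, abs_of_pos hpi] at h5
  have h6 : 2 / Real.pi * (Real.pi * |s|) = 2 * |s| := by field_simp
  rw [h6] at h5
  rw [abs_of_pos (two_pos : (0 : ℝ) < 2)]
  have := abs_nonneg s
  linarith

lemma eq_zero_of_tendsto_int {z : ℕ → ℤ} (h : Tendsto (fun n => (z n : ℝ)) atTop (𝓝 0)) :
    ∀ᶠ n in atTop, z n = 0 := by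
  filter_upwards [Metric.tendsto_nhds.1 h 1 one_pos] with n hn
  rw [dist_zero_right, Real.norm_eq_abs] at hn
  have : |z n| < 1 := by exact_mod_cast hn
  exact Int.abs_lt_one_iff.1 this

variable {A : Type*} {ξ : A → List A} {ℓ t : A}

lemma wt_const_one (ξ : A → List A) (n : ℕ) (u : List A) :
    wt (fun a => ((iter ξ n a).length : ℝ)) u = ((u.flatMap (iter ξ n)).length : ℝ) := by
  induction u with
  | nil => simp
  | cons a u ih => simp [ih]

lemma wt_intCast {z : A → ℤ} (u : List A) : wt (fun a => (z a : ℝ)) u = ((wt z u : ℤ) : ℝ) :=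
  map_wt (Int.castAddHom ℝ) z u

lemma norm_exp_two_pi_I (α : ℝ) : ‖Complex.exp (2 * Real.pi * Complex.I * (α : ℂ))‖ = 1 := by
  have : (2 * Real.pi * Complex.I * (α : ℂ)) = ((2 * Real.pi * α : ℝ) : ℂ) * Complex.I := by
    push_cast; ring
  rw [this, Complex.norm_exp_ofReal_mul_I]

/-- A period `p` common to all points makes `f = z^p f` almost everywhere; as `f` is not zero, `z^p
= 1` and `p α` is an integer. -/
lemma noPeriod_of_isEigenvalue [MeasurableSpace (Omega ξ)] {μ : Measure (Omega ξ)}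
    (hμ : MeasurePreserving (shift ξ) μ μ) {α : ℝ}
    (hev : IsEigenvalue μ (shift ξ) (Complex.exp (2 * Real.pi * Complex.I * (α : ℂ))))
    (hα : ∀ (p : ℕ) (m : ℤ), p * α = m → p = 0) : NoPeriod ξ := by
  intro p hp
  by_contra! hcon
  obtain ⟨f, -, hf0, hfz⟩ := hev
  set z := Complex.exp (2 * Real.pi * Complex.I * (α : ℂ)) with hz
  have hae : ∀ i : ℕ, ∀ᵐ x ∂μ, f ((shift ξ)^[i] x) = z ^ i * f x := by
    intro i
    induction i with
    | zero => simp
    | succ i ih =>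
      filter_upwards [ih, (hμ.iterate i).quasiMeasurePreserving.ae hfz] with x hx hx'
      rw [Function.iterate_succ_apply', hx', hx, pow_succ']
      ring
  apply hf0
  filter_upwards [hae p] with x hx
  have hper : (shift ξ)^[p] x = x := Subtype.ext (by rw [shift_iterate]; exact hcon x.1 x.2)
  rw [hper] at hx
  by_contra hfx
  have h1 : z ^ p = 1 := by
    have : (z ^ p - 1) * f x = 0 := by rw [sub_mul, ← hx]; ring
    rcases mul_eq_zero.1 this with h | h
    · exact sub_eq_zero.1 h
    · exact absurd h hfx
  rw [hz, ← Complex.exp_nat_mul, Complex.exp_eq_one_iff] at h1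
  obtain ⟨m, hm⟩ := h1
  have h2 : (p : ℂ) * α = m := by
    have h3 : (2 * Real.pi * Complex.I : ℂ) ≠ 0 := Complex.two_pi_I_ne_zero
    apply mul_right_cancel₀ h3
    rw [← hm]; ring
  exact hp.ne' (hα p m (by exact_mod_cast h2))

end Rotation

/-! ### M^t on the stable space and Host's decomposition -/

section StableSpace

variable {A : Type*} [Fintype A] [DecidableEq A]

lemma mulVecLin_pow (B : Matrix A A ℝ) (k : ℕ) : (B ^ k).mulVecLin = B.mulVecLin ^ k :=
  Matrix.toLin'_pow B k

variable (ξ : A → List A)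

lemma mulVec_mem_stableSpace {v : A → ℝ} (hv : v ∈ stableSpace ξ) :
    (incidence ξ).transpose.mulVec v ∈ stableSpace ξ := by
  obtain ⟨h1, h2⟩ := Submodule.mem_inf.1 hv
  refine Submodule.mem_inf.2 ⟨mulVec_mem_contracted h1, ?_⟩
  rw [Submodule.mem_iInf] at h2 ⊢
  intro k
  obtain ⟨u, hu⟩ := h2 k
  refine ⟨(incidence ξ).transpose.mulVec u, ?_⟩
  rw [← hu, Matrix.mulVecLin_apply, Matrix.mulVecLin_apply, Matrix.mulVec_mulVec,
    Matrix.mulVec_mulVec, ← pow_succ, ← pow_succ']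

/-- The action of the transposed incidence matrix on the stable space. -/
noncomputable def stableMap : stableSpace ξ →ₗ[ℝ] stableSpace ξ :=
  (incidence ξ).transpose.mulVecLin.restrict fun _ hv => mulVec_mem_stableSpace ξ hv

/-- Fitting's decomposition: the kernels of the powers of M^t meet the intersection of the ranges
only in 0. -/
lemma stableMap_injective : Function.Injective (stableMap ξ) := by
  rw [← LinearMap.ker_eq_bot, LinearMap.ker_eq_bot']
  intro v hv
  have h1 : (incidence ξ).transpose.mulVecLin v.1 = 0 := congrArg Subtype.val hv
  have h2 := (Submodule.mem_inf.1 v.2).2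
  simp only [mulVecLin_pow] at h2
  have h3 := (LinearMap.isCompl_iSup_ker_pow_iInf_range_pow
    (incidence ξ).transpose.mulVecLin).disjoint
  have h4 : v.1 ∈ ⨆ n, LinearMap.ker ((incidence ξ).transpose.mulVecLin ^ n) :=
    Submodule.mem_iSup_of_mem 1 (by simpa using h1)
  exact Subtype.ext (Submodule.disjoint_def.1 h3 _ h4 h2)

lemma stableMap_pow_coe (k : ℕ) (v : stableSpace ξ) :
    ((stableMap ξ ^ k) v : A → ℝ) = ((incidence ξ).transpose ^ k).mulVec v := by
  induction k generalizing v with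
  | zero => simp
  | succ k ih =>
    have : ((stableMap ξ v : stableSpace ξ) : A → ℝ) = (incidence ξ).transpose.mulVec v := rfl
    rw [pow_succ, Module.End.mul_apply, ih, this, pow_succ, Matrix.mulVec_mulVec]

lemma exists_mulVec_pow_eq (k : ℕ) {u : A → ℝ} (hu : u ∈ stableSpace ξ) :
    ∃ v ∈ stableSpace ξ, ((incidence ξ).transpose ^ k).mulVec v = u := by
  have hs : Function.Surjective (stableMap ξ ^ k) := by
    rw [Module.End.coe_pow]
    exact Function.Surjective.iterate
      (LinearMap.injective_iff_surjective.1 (stableMap_injective ξ)) k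
  obtain ⟨v, hv⟩ := hs ⟨u, hu⟩
  refine ⟨v.1, v.2, ?_⟩
  rw [← stableMap_pow_coe, hv]

variable {ξ}

/-- Host's lemma: if `α |ξ^n b|` tends to `0` modulo `1` for every letter, then `α (1, …, 1)^t`
splits. -/
lemma exists_isDecomposition {α : ℝ}
    (h : ∀ b, Tendsto (fun n => α * (iter ξ n b).length - round (α * (iter ξ n b).length))
      atTop (𝓝 0)) : ∃ v w, IsDecomposition ξ α v w := by
  set B := (incidence ξ).transpose with hB
  let e : ℕ → A → ℤ := fun n a => round (α * (iter ξ n a).length)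
  let ε : ℕ → A → ℝ := fun n a => α * (iter ξ n a).length - e n a
  have hBε : ∀ n, B.mulVec (ε n) =
      fun a => ε (n + 1) a + ((e (n + 1) a - wt (e n) (ξ a) : ℤ) : ℝ) := by
    intro n
    rw [hB, incidence_transpose_mulVec]
    ext a
    have h1 : wt (ε n) (ξ a) = α * wt (fun b => ((iter ξ n b).length : ℝ)) (ξ a) -
        wt (fun b => (e n b : ℝ)) (ξ a) := by
      induction ξ a with
      | nil => simp
      | cons b u ih => simp only [wt_cons, ih, ε]; ring
    rw [h1, wt_const_one, wt_intCast, ← iter_succ']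
    simp only [ε]
    push_cast
    ring
  have hlim : ∀ a, Tendsto (fun n => ε n a) atTop (𝓝 0) := h
  -- The vector M^t(ε n) - ε(n+1) is integral and tends to 0, so it vanishes for large `n`: from
  -- `m₀` on, the `ε n` form an orbit of M^t that tends to 0.
  have hev : ∀ᶠ n in atTop, ∀ a, e (n + 1) a - wt (e n) (ξ a) = 0 := by
    rw [eventually_all]
    intro a
    apply eq_zero_of_tendsto_int
    have h1 : Tendsto (fun n => B.mulVec (ε n) a - ε (n + 1) a) atTop (𝓝 0) := by
      have h2 : Tendsto ε atTop (𝓝 0) := tendsto_pi_nhds.2 hlim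
      have h3 : Continuous fun v : A → ℝ => B.mulVec v a :=
        (continuous_apply a).comp (Continuous.matrix_mulVec continuous_const continuous_id)
      have h4 := (h3.tendsto 0).comp h2
      simp only [Matrix.mulVec_zero, Pi.zero_apply] at h4
      simpa using h4.sub ((tendsto_add_atTop_iff_nat 1).2 (hlim a))
    refine h1.congr fun n => ?_
    rw [hBε]; ring
  obtain ⟨m₀, hm₀⟩ := eventually_atTop.1 hev
  have hstep : ∀ k, (B ^ k).mulVec (ε m₀) = ε (m₀ + k) := by
    intro k
    induction k with
    | zero => simp
    | succ k ih =>
      rw [pow_succ', ← Matrix.mulVec_mulVec, ih, hBε]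
      ext a
      rw [hm₀ _ (by omega) a, Int.cast_zero, add_zero]
      rfl
  -- The decreasing ranges stabilize, so `k₀` further steps bring the orbit into their intersection.
  obtain ⟨k₀, hk₀⟩ := (B.mulVecLin.eventually_iInf_range_pow_eq).exists
  have hmem : ε (m₀ + k₀) ∈ stableSpace ξ := by
    refine Submodule.mem_inf.2 ⟨?_, ?_⟩
    · change Tendsto _ _ _
      have h1 : Tendsto ε atTop (𝓝 0) := tendsto_pi_nhds.2 hlim
      refine (h1.comp (tendsto_add_atTop_nat (m₀ + k₀))).congr fun k => ?_
      rw [← hstep k₀, Matrix.mulVec_mulVec, ← pow_add, hstep]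
      simp only [Function.comp_apply]
      congr 1; ring
    · simp only [mulVecLin_pow]
      rw [← hB, hk₀, ← mulVecLin_pow]
      exact ⟨ε m₀, by rw [Matrix.mulVecLin_apply, hstep]⟩
  -- As M^t is bijective on E^s, the orbit can be traced back there to time 0; what remains of `α
  -- (1, …, 1)^t` is mapped to the integer vector `e (m₀ + k₀)`.
  obtain ⟨v, hv, hve⟩ := exists_mulVec_pow_eq ξ (m₀ + k₀) hmem
  refine ⟨v, fun a => α - v a, fun a => by ring, hv, m₀ + k₀, fun a => ⟨e (m₀ + k₀) a, ?_⟩⟩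
  have h1 : (fun a => α - v a) = (fun _ : A => α) - v := rfl
  rw [h1, Matrix.mulVec_sub, hve, pow_incidence_transpose_mulVec]
  have h2 : ∀ u : List A, wt (fun _ : A => α) u = α * u.length := by
    intro u
    induction u with
    | nil => simp
    | cons a u ih => simp only [wt_cons, ih, List.length_cons]; push_cast; ring
  simp [h2, ε]

end StableSpace

/-! ### Weyl equidistribution and Kronecker's theorem -/

section Kronecker

open UnitAddTorus

variable {n : ℕ}

lemma mFourier_add_apply (k : Fin n → ℤ) (x y : UnitAddTorus (Fin n)) :
    mFourier k (x + y) = mFourier k x * mFourier k y := by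
  simp only [mFourier, ContinuousMap.coe_mk, ← Finset.prod_mul_distrib]
  refine Finset.prod_congr rfl fun i _ => ?_
  simp [fourier_apply, smul_add, AddCircle.toCircle_add]

lemma mFourier_nsmul_apply (k : Fin n → ℤ) (j : ℕ) (x : UnitAddTorus (Fin n)) :
    mFourier k (j • x) = mFourier k x ^ j := by
  induction j with
  | zero => simp [mFourier]
  | succ j ih => rw [succ_nsmul, mFourier_add_apply, ih, pow_succ]

lemma mFourier_coe_ne_one {α : Fin n → ℝ}
    (hα : LinearIndependent ℚ (Fin.cons 1 α : Fin (n + 1) → ℝ)) {k : Fin n → ℤ} (hk : k ≠ 0) :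
    mFourier k (fun i => (α i : UnitAddCircle)) ≠ 1 := by
  intro h
  apply hk
  have h1 : mFourier k (fun i => (α i : UnitAddCircle)) =
      Complex.exp (2 * Real.pi * Complex.I * (∑ i, (k i : ℝ) * α i : ℝ)) := by
    simp only [mFourier, ContinuousMap.coe_mk, fourier_coe_apply]
    rw [← Complex.exp_sum]
    congr 1
    push_cast
    rw [Finset.mul_sum]
    refine Finset.sum_congr rfl fun i _ => ?_
    simp; ring
  rw [h1, Complex.exp_eq_one_iff] at h
  obtain ⟨m, hm⟩ := h
  apply int_relation_trivial hα (m := m)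
  have h2 : ((∑ i, (k i : ℝ) * α i : ℝ) : ℂ) = m := by
    apply mul_left_cancel₀ Complex.two_pi_I_ne_zero
    rw [hm]; ring
  exact_mod_cast h2

lemma isProbabilityMeasure_unitAddTorus :
    IsProbabilityMeasure (volume : Measure (UnitAddTorus (Fin n))) := by
  have : IsProbabilityMeasure (volume : Measure UnitAddCircle) := ⟨UnitAddCircle.measure_univ⟩
  exact Measure.pi.instIsProbabilityMeasure _

/-- Weyl's equidistribution for trigonometric polynomials. -/
lemma tendsto_average_span {α : Fin n → ℝ}
    (hα : LinearIndependent ℚ (Fin.cons 1 α : Fin (n + 1) → ℝ)) {P : C(UnitAddTorus (Fin n), ℂ)}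
    (hP : P ∈ Submodule.span ℂ (Set.range (mFourier (d := Fin n)))) :
    Tendsto (fun N : ℕ => (N : ℂ)⁻¹ * ∑ j ∈ Finset.range N, P (j • fun i => (α i : UnitAddCircle)))
      atTop (𝓝 (∫ x, P x)) := by
  have := isProbabilityMeasure_unitAddTorus (n := n)
  have hint : ∀ Q : C(UnitAddTorus (Fin n), ℂ), Integrable Q volume := fun Q =>
    Q.continuous.integrable_of_hasCompactSupport (HasCompactSupport.of_compactSpace _)
  induction hP using Submodule.span_induction with
  | mem P hP =>
    obtain ⟨k, rfl⟩ := hP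
    set a : UnitAddTorus (Fin n) := fun i => (α i : UnitAddCircle) with ha
    by_cases hk : k = 0
    · subst hk
      simp only [mFourier_zero, ContinuousMap.one_apply, integral_const, Finset.sum_const,
        Finset.card_range]
      refine tendsto_const_nhds.congr' ?_
      filter_upwards [eventually_gt_atTop 0] with N hN
      have : (N : ℂ) ≠ 0 := by exact_mod_cast hN.ne'
      simp [this]
    · set ζ := mFourier k a with hζ
      have hζ1 : ζ ≠ 1 := mFourier_coe_ne_one hα hk
      have h0 : ∫ x, mFourier k x = 0 := by
        have h1 : ∫ x, mFourier k (x + a) = ∫ x, mFourier k x :=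
          integral_add_right_eq_self (fun x => mFourier k x) a
        simp only [mFourier_add_apply] at h1
        rw [integral_mul_const] at h1
        have h2 : (∫ x, mFourier k x) * (ζ - 1) = 0 := by rw [mul_sub, h1]; ring
        rcases mul_eq_zero.1 h2 with h | h
        · exact h
        · exact absurd (sub_eq_zero.1 h) hζ1
      rw [h0]
      have hnorm : ‖ζ‖ ≤ 1 := (ContinuousMap.norm_coe_le_norm _ _).trans_eq mFourier_norm
      have hz : 0 < ‖ζ - 1‖ := norm_pos_iff.2 (sub_ne_zero.2 hζ1)
      have hlim : Tendsto (fun N : ℕ => (N : ℝ)⁻¹ * (2 / ‖ζ - 1‖)) atTop (𝓝 0) := by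
        simpa using (tendsto_inv_atTop_nhds_zero_nat (𝕜 := ℝ)).mul_const (2 / ‖ζ - 1‖)
      refine squeeze_zero_norm (fun N => ?_) hlim
      simp only [mFourier_nsmul_apply]
      rw [geom_sum_eq hζ1, norm_mul, norm_inv, norm_div, Complex.norm_natCast]
      gcongr
      calc ‖ζ ^ N - 1‖ ≤ ‖ζ ^ N‖ + ‖(1 : ℂ)‖ := norm_sub_le _ _
        _ ≤ 1 + 1 := by
          rw [norm_pow, norm_one]
          gcongr
          exact pow_le_one₀ (norm_nonneg _) hnorm
        _ = 2 := by norm_num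
  | zero => simp
  | add P Q _ _ hP hQ =>
    simp only [ContinuousMap.add_apply, Finset.sum_add_distrib, mul_add]
    rw [integral_add (hint P) (hint Q)]
    exact hP.add hQ
  | smul c P _ hP =>
    simp only [ContinuousMap.smul_apply, smul_eq_mul, ← Finset.mul_sum]
    rw [integral_const_mul]
    refine (hP.const_mul c).congr fun N => ?_
    ring

/-- Kronecker's theorem on the torus. -/
lemma denseRange_nsmul_torus {α : Fin n → ℝ}
    (hα : LinearIndependent ℚ (Fin.cons 1 α : Fin (n + 1) → ℝ)) :
    DenseRange fun j : ℕ => (j • (fun i => (α i : UnitAddCircle)) : UnitAddTorus (Fin n)) := by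
  set a : UnitAddTorus (Fin n) := fun i => (α i : UnitAddCircle) with ha
  set K := closure (Set.range fun j : ℕ => j • a) with hK
  by_contra hcon
  obtain ⟨p, hp⟩ : ∃ p, p ∉ K := by
    by_contra! h
    exact hcon h
  have hKne : K.Nonempty := ⟨a, subset_closure ⟨1, one_nsmul _⟩⟩
  have hφ : Continuous fun x => Metric.infDist x K := Metric.continuous_infDist_pt K
  let φ : C(UnitAddTorus (Fin n), ℂ) :=
    ⟨fun x => (Metric.infDist x K : ℂ), Complex.continuous_ofReal.comp hφ⟩
  have hpos : 0 < ∫ x, Metric.infDist x K :=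
    hφ.integral_pos_of_hasCompactSupport_nonneg_nonzero (HasCompactSupport.of_compactSpace _)
      (fun _ => Metric.infDist_nonneg)
      ((isClosed_closure.notMem_iff_infDist_pos hKne).1 hp).ne'
  -- The distance to `K` vanishes on the orbit, so a trigonometric polynomial within `δ` of it has
  -- averages, and hence integral, at most `δ` in modulus. The integral of the distance would be at
  -- most 2δ, yet it equals 3δ.
  set δ := (∫ x, Metric.infDist x K) / 3 with hδ
  have hδpos : 0 < δ := by positivity
  have hmem : φ ∈ (Submodule.span ℂ (Set.range (mFourier (d := Fin n)))).topologicalClosure := by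
    rw [span_mFourier_closure_eq_top]
    trivial
  obtain ⟨P, hP, hPφ⟩ := Metric.mem_closure_iff.1 hmem δ hδpos
  have hle : ∀ x, ‖φ x - P x‖ ≤ δ := fun x => by
    rw [dist_eq_norm] at hPφ
    exact (ContinuousMap.norm_coe_le_norm (φ - P) x).trans hPφ.le
  have := isProbabilityMeasure_unitAddTorus (n := n)
  have hint : ∀ Q : C(UnitAddTorus (Fin n), ℂ), Integrable Q volume := fun Q =>
    Q.continuous.integrable_of_hasCompactSupport (HasCompactSupport.of_compactSpace _)
  have h1 : ‖∫ x, P x‖ ≤ δ := by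
    refine le_of_tendsto (tendsto_average_span hα hP).norm (Eventually.of_forall fun N => ?_)
    have h2 : ∀ j : ℕ, ‖P (j • a)‖ ≤ δ := fun j => by
      have h3 : φ (j • a) = 0 := by
        simp only [φ, ContinuousMap.coe_mk, Complex.ofReal_eq_zero]
        exact Metric.infDist_zero_of_mem (subset_closure ⟨j, rfl⟩)
      simpa [h3] using hle (j • a)
    rw [norm_mul, norm_inv, Complex.norm_natCast]
    rcases Nat.eq_zero_or_pos N with rfl | hN
    · simpa using hδpos.le
    have hN' : (0 : ℝ) < N := by exact_mod_cast hN
    calc (N : ℝ)⁻¹ * ‖∑ j ∈ Finset.range N, P (j • a)‖ ≤ (N : ℝ)⁻¹ * (N * δ) := by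
          gcongr
          refine (norm_sum_le _ _).trans ((Finset.sum_le_sum fun j _ => h2 j).trans_eq ?_)
          simp
      _ = δ := by field_simp
  have h4 : ‖∫ x, φ x - P x‖ ≤ δ := by
    refine (norm_integral_le_of_norm_le_const (Eventually.of_forall hle)).trans_eq ?_
    simp
  rw [integral_sub (hint φ) (hint P)] at h4
  have h5 : ‖∫ x, φ x‖ = 3 * δ := by
    have : ∫ x, φ x = ((∫ x, Metric.infDist x K : ℝ) : ℂ) := integral_ofReal
    rw [this, Complex.norm_real, Real.norm_of_nonneg hpos.le, hδ]
    ring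
  have h6 : ‖∫ x, φ x‖ ≤ ‖(∫ x, φ x) - ∫ x, P x‖ + ‖∫ x, P x‖ := by
    simpa using norm_add_le ((∫ x, φ x) - ∫ x, P x) (∫ x, P x)
  linarith

end Kronecker

lemma nonempty_interior_image {X Y : Type*} [TopologicalSpace X] [TopologicalSpace Y] (e : X ≃ₜ Y)
    {s : Set X} (h : (interior s).Nonempty) : (interior (e '' s)).Nonempty := by
  rw [← e.image_interior]
  exact h.image e

/-! ### The image of some cylinder has an interior point -/

section Interior

variable {A : Type*} {ξ : A → List A} {ℓ t : A} {n : ℕ} {V W : A → Fin n → ℝ}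

/-- The points of `Ω_ξ` whose coordinate of index `-1` is `b`. -/
def leftCyl (ξ : A → List A) (b : A) : Set (ℤ → A) := {y | y ∈ Omega ξ ∧ y (-1) = b}

lemma isClosed_leftCyl [TopologicalSpace A] [DiscreteTopology A]
    (ξ : A → List A) (b : A) : IsClosed (leftCyl ξ b) :=
  (isClosed_Omega ξ).inter
    ((isClosed_discrete {b}).preimage (continuous_apply (A := fun _ : ℤ => A) (-1)))

/-- Modulo integer vectors, the sums of `W` over the words preceding a fixed point take finitely
many values. -/
lemma PrimitiveProper.exists_cum_fixedPoint_eq (h : PrimitiveProper ξ ℓ t) {m : ℕ}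
    {z : A → Fin n → ℤ}
    (hz : ∀ a i, wt W (iter ξ m a) i = z a i) {u : ℤ → A} (hu : sub ξ u = u) (c : ℤ) :
    ∃ a j, j < (iter ξ m a).length ∧ ∃ ζ : Fin n → ℤ,
      cum W u c = wt W ((iter ξ m a).take j) + fun i => (ζ i : ℝ) := by
  have hne := h.iter_ne_nil m
  obtain ⟨b, hb1, hb2⟩ := exists_block (cuts_lt_succ hne u) c
  rw [cuts_succ] at hb2
  obtain ⟨j, hj⟩ := Int.eq_ofNat_of_zero_le (sub_nonneg.2 hb1)
  have hj' : j < (iter ξ m (u b)).length := by omega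
  -- The complete blocks of level `m` contribute the integer vectors `z`; the remainder is a proper
  -- prefix of one block.
  refine ⟨u b, j, hj', fun i => cum z u b i, ?_⟩
  have h1 := occ_sub hne u b
  rw [h.sub_iter_eq_of_fixed hu, ← List.take_append_drop j (iter ξ m (u b)), occ_append] at h1
  have h2 := h1.1.cum_add W
  rw [List.length_take, min_eq_left hj'.le] at h2
  have e : c = cuts (iter ξ m) u b + j := by omega
  rw [e, h2, add_comm]
  congr 1
  have h3 := cum_sub hne W u b
  rw [h.sub_iter_eq_of_fixed hu] at h3
  rw [h3]
  have h4 : (fun a => wt W (iter ξ m a)) =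
      fun a => (Int.castAddHom ℝ).compLeft (Fin n) (z a) := by
    ext a i
    rw [hz]; rfl
  rw [h4, map_cum]
  rfl

variable [Fintype A] [TopologicalSpace A] [DiscreteTopology A]

namespace PrimitiveProper

lemma isCompact_image_limitMap (h : PrimitiveProper ξ ℓ t) (hper : NoPeriod ξ)
    (hV : SummableWeight ξ V) {C : Set (ℤ → A)} (hC : IsClosed C) (hCΩ : C ⊆ Omega ξ) :
    IsCompact (limitMap ξ V '' C) := by
  have e : limitMap ξ V '' C = (fun x : Omega ξ => limitMap ξ V x.1) '' (Subtype.val ⁻¹' C) := by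
    ext p
    constructor
    · rintro ⟨x, hx, rfl⟩
      exact ⟨⟨x, hCΩ hx⟩, hx, rfl⟩
    · rintro ⟨x, hx, rfl⟩
      exact ⟨x.1, hx, rfl⟩
  rw [e]
  exact (hC.preimage continuous_subtype_val).isCompact.image (h.continuous_limitMap hper hV)

/-- The values of the limit map on the backward orbit of a fixed point. -/
lemma limitMap_tr_fixedPoint (h : PrimitiveProper ξ ℓ t) (hper : NoPeriod ξ)
    (hV : SummableWeight ξ V) {u : ℤ → A} (huΩ : u ∈ Omega ξ) (hu : sub ξ u = u) (i : ℕ) :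
    limitMap ξ V (tr (-i) u) = -cum V u (-i) := by
  obtain ⟨k, hk⟩ := ((h.grow (u (-1))).eventually_gt_atTop i).exists
  have h1 := h.limitMap_tower hper hV k huΩ hk
  rw [h.sub_iter_eq_of_fixed hu] at h1
  -- A fixed point has cuts of all levels at 0, so all its entrance times are 0.
  have h2 : limitMap ξ (fun a => wt V (iter ξ k a)) u = 0 := by
    have : ∀ j, entrance ξ (j + 1) u = 0 := fun j => by
      have := h.entrance_tower_self hper j huΩ (h.length_iter_pos j _)
      rw [h.sub_iter_eq_of_fixed hu] at this
      simpa using this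
    simp [limitMap, this]
  rw [h1, h2, zero_sub]

/-- On the backward orbit of a fixed point the decomposition puts iα in G(Ω) - f(a, j) + ℤ^n, for
`G` the limit map and finitely many vectors f(a, j). The projection to the torus of the compact
union of the sets G(Ω) - f(a, j) is closed and contains a dense orbit, so it is everything. Lifted
to ℝ^n, countably many translates of the compact images of the sets `leftCyl ξ b` cover the space,
and Baire's theorem applies. -/
lemma exists_nonempty_interior (h : PrimitiveProper ξ ℓ t) (hper : NoPeriod ξ)
    (hV : SummableWeight ξ V) {α : Fin n → ℝ} (hVW : ∀ a, V a + W a = α) {m : ℕ}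
    (hW : ∀ a i, ∃ z : ℤ, wt W (iter ξ m a) i = z)
    (hα : LinearIndependent ℚ (Fin.cons 1 α : Fin (n + 1) → ℝ)) :
    ∃ b, (interior (limitMap ξ V '' leftCyl ξ b)).Nonempty := by
  have : Nonempty A := ⟨ℓ⟩
  choose z hz using hW
  obtain ⟨u, huΩ, hfix, -⟩ := h.exists_fixedPoint
  obtain ⟨a₀, ha₀⟩ := Finite.exists_max fun a => (iter ξ m a).length
  set J := (iter ξ m a₀).length
  let f : A → ℕ → Fin n → ℝ := fun a j => wt W ((iter ξ m a).take j)
  have hcum : ∀ c : ℤ, c • α - cum W u c = cum V u c := by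
    apply eq_cum
    · simp
    · intro c
      rw [cum_succ, add_smul, one_smul, ← hVW (u c)]
      abel
  have horbit : ∀ i : ℕ, ∃ a, ∃ j < J, ∃ ζ : Fin n → ℤ,
      (i : ℝ) • α = limitMap ξ V (tr (-i) u) - f a j - fun s => (ζ s : ℝ) := by
    intro i
    obtain ⟨a, j, hj, ζ, hζ⟩ := h.exists_cum_fixedPoint_eq hz hfix (-i)
    refine ⟨a, j, hj.trans_le (ha₀ a), ζ, ?_⟩
    rw [h.limitMap_tr_fixedPoint hper hV huΩ hfix, ← hcum, hζ, neg_smul]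
    ext s
    simp [f]
    ring
  let π : (Fin n → ℝ) → UnitAddTorus (Fin n) := fun p i => (p i : UnitAddCircle)
  have hπ : Continuous π := continuous_pi fun i =>
    (AddCircle.continuous_mk' 1).comp (continuous_apply i)
  have hGΩ : IsCompact (limitMap ξ V '' Omega ξ) :=
    h.isCompact_image_limitMap hper hV (isClosed_Omega ξ) subset_rfl
  let K : Set (Fin n → ℝ) :=
    ⋃ a, ⋃ j ∈ Finset.range J, (fun p => p - f a j) '' (limitMap ξ V '' Omega ξ)
  have hK : IsCompact K := isCompact_iUnion fun a => (Finset.range J).isCompact_biUnion fun j _ =>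
    hGΩ.image (continuous_id.sub continuous_const)
  have hdense : π '' K = Set.univ := by
    rw [← (hK.image hπ).isClosed.closure_eq]
    refine (((denseRange_nsmul_torus hα).mono ?_)).closure_eq
    rintro _ ⟨i, rfl⟩
    obtain ⟨a, j, hj, ζ, hζ⟩ := horbit i
    refine ⟨limitMap ξ V (tr (-i) u) - f a j, ?_, ?_⟩
    · simp only [K, Set.mem_iUnion]
      exact ⟨a, j, Finset.mem_range.2 hj, _, ⟨_, tr_mem_Omega huΩ _, rfl⟩, rfl⟩
    · ext s
      have h1 := congrFun hζ s
      simp only [Pi.smul_apply, smul_eq_mul, Pi.sub_apply] at h1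
      change ((limitMap ξ V (tr (-i) u) s - f a j s : ℝ) : UnitAddCircle) =
        i • (α s : UnitAddCircle)
      have h2 : limitMap ξ V (tr (-i) u) s - f a j s = i • α s + ζ s • (1 : ℝ) := by
        simp only [nsmul_eq_mul, zsmul_eq_mul, mul_one]; linarith
      rw [h2, AddCircle.coe_add, AddCircle.coe_nsmul, AddCircle.coe_zsmul, AddCircle.coe_period,
        smul_zero, add_zero]
  let S : A × A × ℕ × (Fin n → ℤ) → Set (Fin n → ℝ) := fun q =>
    (Homeomorph.addRight (-f q.2.1 q.2.2.1 + fun s => (q.2.2.2 s : ℝ))) ''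
      (limitMap ξ V '' leftCyl ξ q.1)
  have hScl : ∀ q, IsClosed (S q) := fun q => ((h.isCompact_image_limitMap hper hV
    (isClosed_leftCyl ξ q.1) fun _ hy => hy.1).image (Homeomorph.continuous _)).isClosed
  have hScov : ⋃ q, S q = Set.univ := by
    refine Set.eq_univ_of_forall fun p => ?_
    obtain ⟨q, hq, hqp⟩ : π p ∈ π '' K := by rw [hdense]; trivial
    simp only [K, Set.mem_iUnion] at hq
    obtain ⟨a, j, -, _, ⟨x, hx, rfl⟩, rfl⟩ := hq
    have hdiff : ∀ s, ∃ ζ : ℤ, p s = limitMap ξ V x s - f a j s + ζ := by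
      intro s
      have h1 : ((limitMap ξ V x s - f a j s : ℝ) : UnitAddCircle) = (p s : UnitAddCircle) :=
        congrFun hqp s
      have h2 : ((p s - (limitMap ξ V x s - f a j s) : ℝ) : UnitAddCircle) = 0 := by
        rw [AddCircle.coe_sub, ← h1, sub_self]
      obtain ⟨ζ, hζ⟩ := (AddCircle.coe_eq_zero_iff 1).1 h2
      refine ⟨ζ, ?_⟩
      rw [zsmul_eq_mul, mul_one] at hζ
      linarith
    choose ζ hζ using hdiff
    refine Set.mem_iUnion.2 ⟨(x (-1), a, j, ζ), _, ⟨x, ⟨hx, rfl⟩, rfl⟩, ?_⟩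
    ext s
    simp [hζ]
    ring
  obtain ⟨q, hq⟩ := nonempty_interior_of_iUnion_of_closed hScl hScov
  refine ⟨q.1, ?_⟩
  have := nonempty_interior_image (Homeomorph.addRight
    (-f q.2.1 q.2.2.1 + fun s => (q.2.2.2 s : ℝ))).symm hq
  simp only [S] at this
  rwa [← Set.image_comp, Homeomorph.symm_comp_self, Set.image_id] at this

end PrimitiveProper

end Interior

/-! ### Propagation of interior points and regularity -/

section Regularity

variable {A : Type*} {ξ : A → List A} {ℓ t : A}

namespace PrimitiveProper

/-- The surroundings of a cut of level `k + 1`. -/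
lemma occ_around_cut (h : PrimitiveProper ξ ℓ t) (k : ℕ) (y : ℤ → A) :
    Occ (sub (iter ξ (k + 1)) y)
      (-((iter ξ k t).length + (iter ξ (k + 1) (y (-1))).length : ℕ))
      (iter ξ k t ++ iter ξ (k + 1) (y (-1)) ++ iter ξ k ℓ) := by
  have hne := h.iter_ne_nil (k + 1)
  have h0 := occ_sub hne y 0
  have h1 := occ_sub hne y (-1)
  have h2 := occ_sub hne y (-2)
  have c1 := cuts_succ (iter ξ (k + 1)) y (-1)
  have c2 := cuts_succ (iter ξ (k + 1)) y (-2)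
  rw [neg_add_cancel, cuts_zero] at c1
  have e2 : (-2 : ℤ) + 1 = -1 := by norm_num
  rw [e2] at c2
  -- Properness removes the dependence on the neighbouring letters `y 0` and `y (-2)`.
  obtain ⟨w, hw⟩ := h.iter_prefix k (y 0)
  obtain ⟨w', hw'⟩ := h.iter_suffix k (y (-2))
  have l2 : (iter ξ (k + 1) (y (-2))).length = w'.length + (iter ξ k t).length := by
    rw [← hw']; simp
  rw [← hw, occ_append, cuts_zero] at h0
  rw [← hw', occ_append] at h2
  rw [occ_append, occ_append]
  refine ⟨⟨?_, ?_⟩, ?_⟩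
  · convert h2.2 using 1; push_cast; omega
  · convert h1 using 1; push_cast; omega
  · convert h0.1 using 1; push_cast [List.length_append]; ring

/-- The `r` places before the cut lie in the last block, so the sum depends on `y` through `y (-1)`
alone: the translation in the self-affinity is constant on a tower piece. -/
lemma cum_sub_neg {E : Type*} [AddCommGroup E] (h : PrimitiveProper ξ ℓ t) (v : A → E) (k : ℕ)
    (y : ℤ → A) {r : ℕ} (hr : r < (iter ξ k (y (-1))).length) :
    cum v (sub (iter ξ k) y) (-r) =
      -wt v ((iter ξ k (y (-1))).drop ((iter ξ k (y (-1))).length - r)) := by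
  have h1 := occ_sub (h.iter_ne_nil k) y (-1)
  have c1 := cuts_succ (iter ξ k) y (-1)
  rw [neg_add_cancel, cuts_zero] at c1
  rw [← List.take_append_drop ((iter ξ k (y (-1))).length - r) (iter ξ k (y (-1))),
    occ_append] at h1
  have h2 := h1.2.cum_add v
  rw [List.length_drop, List.length_take, min_eq_left (Nat.sub_le _ _)] at h2
  have e1 : cuts (iter ξ k) y (-1) + (((iter ξ k (y (-1))).length - r : ℕ) : ℤ) = -r := by omega
  have e2 : (-r : ℤ) + (((iter ξ k (y (-1))).length - ((iter ξ k (y (-1))).length - r) : ℕ) : ℤ)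
    = 0 := by omega
  rw [e1, e2, cum_zero] at h2
  rw [eq_neg_iff_add_eq_zero, ← h2]

variable {n : ℕ} {V : A → Fin n → ℝ}

lemma exists_pow_equiv {L : (Fin n → ℝ) ≃L[ℝ] (Fin n → ℝ)} (hL : ∀ a, wt V (ξ a) = L (V a))
    (k : ℕ) : ∃ L' : (Fin n → ℝ) ≃L[ℝ] (Fin n → ℝ), ∀ a, wt V (iter ξ k a) = L' (V a) := by
  induction k with
  | zero => exact ⟨ContinuousLinearEquiv.refl ℝ _, fun a => by simp⟩
  | succ k ih =>
    obtain ⟨L', hL'⟩ := ih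
    refine ⟨L'.trans L, fun a => ?_⟩
    rw [iter_succ, wt_flatMap]
    simp only [hL]
    have := map_wt (L : (Fin n → ℝ) →+ (Fin n → ℝ)) V (iter ξ k a)
    simp only [ContinuousLinearEquiv.trans_apply, ← hL']
    exact this

variable [Fintype A] [TopologicalSpace A] [DiscreteTopology A]

/-- The points at distance `r` before a cut of level `k` which follows the block `ξ^k b`. -/
def towerPiece (ξ : A → List A) (k r : ℕ) (b : A) : Set (ℤ → A) :=
  (fun y => tr (-r) (sub (iter ξ k) y)) '' leftCyl ξ b

lemma nonempty_interior_image_towerPiece (h : PrimitiveProper ξ ℓ t) (hper : NoPeriod ξ)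
    (hV : SummableWeight ξ V) {L : (Fin n → ℝ) ≃L[ℝ] (Fin n → ℝ)}
    (hL : ∀ a, wt V (ξ a) = L (V a)) {b : A}
    (hb : (interior (limitMap ξ V '' leftCyl ξ b)).Nonempty) {k r : ℕ}
    (hr : r < (iter ξ k b).length) :
    (interior (limitMap ξ V '' towerPiece ξ k r b)).Nonempty := by
  obtain ⟨L', hL'⟩ := exists_pow_equiv hL k
  set c : Fin n → ℝ := wt V ((iter ξ k b).drop ((iter ξ k b).length - r)) with hc
  have e : limitMap ξ V '' towerPiece ξ k r b =
      (L'.toHomeomorph.trans (Homeomorph.addRight c)) '' (limitMap ξ V '' leftCyl ξ b) := by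
    rw [towerPiece, Set.image_image, Set.image_image]
    refine Set.image_congr fun y hy => ?_
    have hr' : r < (iter ξ k (y (-1))).length := by rw [hy.2]; exact hr
    rw [h.limitMap_tower hper hV k hy.1 hr', h.cum_sub_neg V k y hr', hy.2, ← hc]
    have h1 : SummableWeight ξ fun a => L' (V a) := by
      have := hV.iterate k
      simp only [hL'] at this
      exact this
    simp only [hL']
    have h2 := h.limitMap_map hper hV (L' : (Fin n → ℝ) →L[ℝ] (Fin n → ℝ)) h1 hy.1
    simp only [ContinuousLinearEquiv.coe_coe] at h2
    rw [h2]
    simp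
  rw [e]
  exact nonempty_interior_image _ hb

/-- By primitivity `a` occurs in `ξ^K b`. Standing just after it, `|q|` places before the end of the
block, gives a tower piece over `b` contained in `leftCyl ξ a`. -/
lemma nonempty_interior_leftCyl (h : PrimitiveProper ξ ℓ t) (hper : NoPeriod ξ)
    (hV : SummableWeight ξ V) {L : (Fin n → ℝ) ≃L[ℝ] (Fin n → ℝ)}
    (hL : ∀ a, wt V (ξ a) = L (V a)) {b : A}
    (hb : (interior (limitMap ξ V '' leftCyl ξ b)).Nonempty) (a : A) :
    (interior (limitMap ξ V '' leftCyl ξ a)).Nonempty := by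
  obtain ⟨K, hK⟩ := h.mem_iter
  obtain ⟨p, q, hpq⟩ := List.append_of_mem (hK K le_rfl a b)
  have hl : (iter ξ K b).length = p.length + (q.length + 1) := by rw [hpq]; simp
  refine (h.nonempty_interior_image_towerPiece hper hV hL hb (k := K) (r := q.length)
    (by omega)).mono (interior_mono (Set.image_mono ?_))
  rintro _ ⟨y, ⟨hy, hyb⟩, rfl⟩
  refine ⟨tr_mem_Omega (sub_mem_Omega h.ne_nil hy K) _, ?_⟩
  have h1 := occ_sub (h.iter_ne_nil K) y (-1)
  have c1 := cuts_succ (iter ξ K) y (-1)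
  rw [neg_add_cancel, cuts_zero] at c1
  rw [hyb] at h1 c1
  rw [hpq, occ_append, occ_cons] at h1
  change tr (-q.length) (sub (iter ξ K) y) (-1) = a
  rw [tr_apply, ← h1.2.1]
  congr 1
  omega

/-- The image of a clopen set by the limit map is the closure of its interior. -/
lemma isRegularSet_image_limitMap (h : PrimitiveProper ξ ℓ t) (hper : NoPeriod ξ)
    (hV : SummableWeight ξ V) {L : (Fin n → ℝ) ≃L[ℝ] (Fin n → ℝ)}
    (hL : ∀ a, wt V (ξ a) = L (V a)) {b : A}
    (hb : (interior (limitMap ξ V '' leftCyl ξ b)).Nonempty) {c : Set (Omega ξ)}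
    (hc : IsClopen c) : IsRegularSet ((fun x : Omega ξ => limitMap ξ V x.1) '' c) := by
  have hcomp : IsCompact ((fun x : Omega ξ => limitMap ξ V x.1) '' c) :=
    hc.1.isCompact.image (h.continuous_limitMap hper hV)
  refine ⟨hcomp, (hcomp.isClosed.closure_interior_subset).antisymm ?_⟩
  rintro _ ⟨x, hx, rfl⟩
  rw [Metric.mem_closure_iff]
  intro ε hε
  obtain ⟨U, hU, rfl⟩ := isOpen_induced_iff.1 hc.2
  obtain ⟨N, hN⟩ := exists_window_of_isOpen hU hx
  -- A level at which the sums up to the cut are within ε/2 of the limit, and at which the known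
  -- surroundings of the cut extend at least `N` places beyond the block on either side. The tower
  -- piece of `x` then lies in `U`.
  obtain ⟨k, hk1, hk2, hk3⟩ := (((tendsto_add_atTop_nat 1).eventually
    (h.eventually_norm_limitMap_sub_le hper hV (half_pos hε))).and
    (((h.grow ℓ).eventually_gt_atTop N).and ((h.grow t).eventually_ge_atTop N))).exists
  obtain ⟨y, hy, hlt, hxy⟩ := h.exists_tower hper (k + 1) x.2
  set r := entrance ξ (k + 1 + 1) x.1 with hr
  obtain ⟨p, hp⟩ := h.nonempty_interior_image_towerPiece hper hV hL
    (h.nonempty_interior_leftCyl hper hV hL hb (y (-1))) hlt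
  have hsub : limitMap ξ V '' towerPiece ξ (k + 1) r (y (-1)) ⊆
      (fun x : Omega ξ => limitMap ξ V x.1) '' (Subtype.val ⁻¹' U) := by
    rintro _ ⟨_, ⟨y', ⟨hy', hyy⟩, rfl⟩, rfl⟩
    refine ⟨⟨tr (-r) (sub (iter ξ (k + 1)) y'), tr_mem_Omega (sub_mem_Omega h.ne_nil hy' _) _⟩,
      hN _ fun i hi1 hi2 => ?_, rfl⟩
    change tr (-r) (sub (iter ξ (k + 1)) y') i = _
    rw [hxy, tr_apply, tr_apply]
    have o1 := h.occ_around_cut k y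
    have o2 := h.occ_around_cut k y'
    rw [hyy] at o2
    obtain ⟨j, hj⟩ := Int.eq_ofNat_of_zero_le (show 0 ≤ i + -(r : ℤ) +
      ((iter ξ k t).length + (iter ξ (k + 1) (y (-1))).length : ℕ) by push_cast; omega)
    have hj' : j < (iter ξ k t ++ iter ξ (k + 1) (y (-1)) ++ iter ξ k ℓ).length := by
      simp only [List.length_append]; omega
    have e1 := o1 j hj'
    rw [← o2 j hj'] at e1
    have e2 : i + -(r : ℤ) =
      -((iter ξ k t).length + (iter ξ (k + 1) (y (-1))).length : ℕ) + j := by omega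
    rw [e2, e1]
  refine ⟨p, interior_mono hsub hp, ?_⟩
  obtain ⟨_, ⟨y', ⟨hy', hyy⟩, rfl⟩, rfl⟩ := interior_subset hp
  set x' := tr (-r) (sub (iter ξ (k + 1)) y') with hx'
  have hlt' : r < (iter ξ (k + 1) (y' (-1))).length := by rw [hyy]; exact hlt
  have hr' : entrance ξ (k + 1 + 1) x' = r := h.entrance_tower_self hper (k + 1) hy' hlt'
  have b1 := hk1 x.1 x.2
  have b2 := hk1 x' (tr_mem_Omega (sub_mem_Omega h.ne_nil hy' _) _)
  rw [hr'] at b2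
  rw [← hr] at b1
  -- Both points read the same last `r` letters before the cut.
  have hcum : cum V x.1 r = cum V x' r := by
    rw [hxy, hx', cum_tr, cum_tr, h.cum_sub_neg V _ y hlt, h.cum_sub_neg V _ y' hlt', hyy,
      add_neg_cancel, cum_zero, cum_zero]
  rw [dist_eq_norm]
  have e : limitMap ξ V x.1 - limitMap ξ V x' = (limitMap ξ V x.1 - cum V x.1 r) -
      (limitMap ξ V x' - cum V x' r) := by rw [hcum]; abel
  change ‖limitMap ξ V x.1 - limitMap ξ V x'‖ < ε
  rw [e]
  refine (norm_sub_le _ _).trans_lt ?_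
  linarith

end PrimitiveProper

end Regularity

lemma IsRegularSet.image {n : ℕ} {K : Set (Fin n → ℝ)} (hK : IsRegularSet K)
    (e : (Fin n → ℝ) ≃ₜ (Fin n → ℝ)) : IsRegularSet (e '' K) :=
  ⟨hK.1.image e.continuous, by rw [← e.image_interior, ← e.image_closure, hK.2]⟩

lemma isRegularSet_of_subsingleton (K : Set (Fin 0 → ℝ)) : IsRegularSet K := by
  refine ⟨(Set.toFinite K).isCompact, ?_⟩
  rw [(isOpen_discrete K).interior_eq, (isClosed_discrete K).closure_eq]

/-! ### From eigenvalues to fractional parts -/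

section Fractions

variable {A : Type*} [Finite A] [TopologicalSpace A] [DiscreteTopology A] {ξ : A → List A} {ℓ t : A}

lemma tendsto_frac_of_isEigenvalue (h : PrimitiveProper ξ ℓ t) [MeasurableSpace (Omega ξ)]
    [BorelSpace (Omega ξ)] (μ : Measure (Omega ξ)) [IsProbabilityMeasure μ]
    (hμ : MeasurePreserving (shift ξ) μ μ) {α : ℝ}
    (hev : IsEigenvalue μ (shift ξ) (Complex.exp (2 * Real.pi * Complex.I * (α : ℂ)))) (b : A) :
    Tendsto (fun n => α * (iter ξ n b).length - round (α * (iter ξ n b).length)) atTop (𝓝 0) := by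
  have h1 := h.tendsto_pow_length μ hμ (norm_exp_two_pi_I α) hev b
  have h2 := (tendsto_iff_norm_sub_tendsto_zero.1 h1)
  refine squeeze_zero_norm (fun n => ?_) h2
  refine (abs_sub_round_le_norm_exp _).trans_eq ?_
  rw [← Complex.exp_nat_mul]
  congr 3
  push_cast
  ring

end Fractions

/-! ### The v(j) form a basis of E^s; assembly of the theorem -/

section Final

variable {A : Type*} [Fintype A] [DecidableEq A] {ξ : A → List A} {ℓ t : A} {n : ℕ}

lemma exists_primitiveProper (hsub : IsSubstitution ξ) (hprim : IsPrimitiveSubst ξ)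
    (hprop : IsProper ξ) : ∃ ℓ t, PrimitiveProper ξ ℓ t := by
  obtain ⟨⟨ℓ, hℓ⟩, t, ht⟩ := hprop
  refine ⟨ℓ, t, hℓ, ht, hsub.2, ?_⟩
  obtain ⟨k, -, hk⟩ := hprim.exists_pos_pow
  have hne : ∀ a, ξ a ≠ [] := fun a h0 => by simpa [h0] using hℓ a
  refine ⟨k, fun j hj a b => ?_⟩
  obtain ⟨i, rfl⟩ := Nat.exists_eq_add_of_le' hj
  obtain ⟨c, hc⟩ := List.exists_mem_of_ne_nil _ (iter_ne_nil hne i b)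
  rw [← iter_add, List.mem_flatMap]
  exact ⟨c, hc, mem_iter_of_pow_incidence_pos (hk a c)⟩

/-- The matrix of `M_ξ^t` in a basis of the stable space acts on `ℝⁿ` as an automorphism. -/
lemma exists_equiv_of_linearIndependent {v : Fin n → stableSpace ξ} (hv : LinearIndependent ℝ v)
    (hn : Module.finrank ℝ (stableSpace ξ) = n) :
    ∃ L : (Fin n → ℝ) ≃L[ℝ] (Fin n → ℝ), ∀ a,
      wt (fun b i => (v i : A → ℝ) b) (ξ a) = L fun i => (v i : A → ℝ) a := by
  rcases Nat.eq_zero_or_pos n with rfl | hpos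
  · exact ⟨ContinuousLinearEquiv.refl ℝ _, fun a => Subsingleton.elim _ _⟩
  have : Nonempty (Fin n) := ⟨⟨0, hpos⟩⟩
  let b := basisOfLinearIndependentOfCardEqFinrank hv (by simp [hn])
  let M : Matrix (Fin n) (Fin n) ℝ := Matrix.of fun i j => b.repr (stableMap ξ (v i)) j
  have hb : ∀ i, b i = v i := fun i => by simp [b]
  have hM : ∀ i, stableMap ξ (v i) = ∑ j, M i j • v j := fun i => by
    rw [← b.sum_repr (stableMap ξ (v i))]
    simp only [hb]
    rfl
  -- A vector on which the matrix acts as zero from the left would give a vector of E^s killed by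
  -- M^t, which is injective there.
  have hunit : IsUnit M := by
    rw [← Matrix.vecMul_injective_iff_isUnit]
    intro c c' hcc
    have h1 : ∀ c : Fin n → ℝ, stableMap ξ (∑ i, c i • v i) = ∑ j, Matrix.vecMul c M j • v j := by
      intro c
      rw [map_sum]
      simp only [map_smul, hM, Finset.smul_sum, Matrix.vecMul, dotProduct, Finset.sum_smul,
        smul_smul]
      rw [Finset.sum_comm]
    have h2 : stableMap ξ (∑ i, c i • v i) = stableMap ξ (∑ i, c' i • v i) := by
      rw [h1, h1]
      rw [show Matrix.vecMul c M = Matrix.vecMul c' M from hcc]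
    have h3 := stableMap_injective ξ h2
    exact (linearIndependent_iff_injective_fintypeLinearCombination.1 hv)
      (by simpa only [Fintype.linearCombination_apply] using h3)
  let L := LinearEquiv.ofInjectiveEndo M.mulVecLin (Matrix.mulVec_injective_iff_isUnit.2 hunit)
  refine ⟨L.toContinuousLinearEquiv, fun a => ?_⟩
  change _ = M.mulVec _
  ext i
  have h1 : wt (fun b i => (v i : A → ℝ) b) (ξ a) i = wt (v i : A → ℝ) (ξ a) :=
    (map_wt (Pi.evalAddMonoidHom (fun _ : Fin n => ℝ) i) (fun b i => (v i : A → ℝ) b) _).symm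
  have h2 : ((stableMap ξ (v i) : stableSpace ξ) : A → ℝ) a = wt (v i : A → ℝ) (ξ a) :=
    congrFun (incidence_transpose_mulVec ξ (v i : A → ℝ)) a
  rw [h1, ← h2, hM]
  simp [Matrix.mulVec, dotProduct]

/-- Integrality persists for larger exponents, since `ξ^{j+m} a` is a concatenation of words `ξ^m
b`; this allows one exponent for all coordinates. -/
lemma isDecomposition_integral_of_le {α : ℝ} {v w : A → ℝ} (hd : IsDecomposition ξ α v w) :
    ∀ᶠ m in atTop, ∀ a, ∃ z : ℤ, wt w (iter ξ m a) = z := by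
  obtain ⟨-, -, m, hm⟩ := hd
  rw [pow_incidence_transpose_mulVec] at hm
  choose z hz using hm
  filter_upwards [eventually_ge_atTop m] with k hk a
  obtain ⟨j, rfl⟩ := Nat.exists_eq_add_of_le' hk
  refine ⟨wt z (iter ξ j a), ?_⟩
  rw [← iter_add, wt_flatMap, ← wt_intCast]
  congr 1
  ext b
  exact hz b

variable [TopologicalSpace A] [DiscreteTopology A]

/-- If the limit map of `v` has an image with interior points, the vectors `v i` are independent. -/
lemma PrimitiveProper.linearIndependent_of_interior (h : PrimitiveProper ξ ℓ t)
    (hper : NoPeriod ξ) {v : Fin n → stableSpace ξ}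
    (hV : SummableWeight ξ fun a i => (v i : A → ℝ) a) {b : A}
    (hb : (interior (limitMap ξ (fun a i => (v i : A → ℝ) a) '' leftCyl ξ b)).Nonempty) :
    LinearIndependent ℝ v := by
  rw [Fintype.linearIndependent_iff]
  intro c hc
  -- A relation `c` among the `v i` annihilates the weight, hence the image of the limit map lies in
  -- the kernel of `φ`; a subspace with interior points is the whole space, so `c = 0`.
  let φ : (Fin n → ℝ) →L[ℝ] ℝ := ∑ i, c i • ContinuousLinearMap.proj i
  have hφ : ∀ p, φ p = ∑ i, c i * p i := fun p => by simp [φ]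
  have h0 : (fun a => φ fun i => (v i : A → ℝ) a) = fun _ => 0 := by
    ext a
    rw [hφ]
    have := congrFun (congrArg Subtype.val hc) a
    simpa using this
  have hzero : SummableWeight ξ fun a => φ fun i => (v i : A → ℝ) a := by
    rw [h0]
    have : ∀ k, ‖fun a => wt (fun _ : A => (0 : ℝ)) (iter ξ k a)‖ = 0 := by
      intro k
      rw [norm_eq_zero]
      ext a
      simp [wt]
    unfold SummableWeight
    simp only [this]
    exact summable_zero
  have hker : limitMap ξ (fun a i => (v i : A → ℝ) a) '' leftCyl ξ b ⊆
      LinearMap.ker φ.toLinearMap := by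
    rintro _ ⟨x, hx, rfl⟩
    have h1 := h.limitMap_map hper hV φ hzero hx.1
    rw [h0] at h1
    have h2 : limitMap ξ (fun _ : A => (0 : ℝ)) x = 0 := by
      have : ∀ m, cum (fun _ : A => (0 : ℝ)) x m = 0 := fun m =>
        (eq_cum (g := fun _ => (0 : ℝ)) rfl (by simp) m).symm
      simp [limitMap, this]
    rw [h2] at h1
    exact h1.symm
  have htop := Submodule.eq_top_of_nonempty_interior' _ (hb.mono (interior_mono hker))
  intro i
  have h3 : (Pi.single i 1 : Fin n → ℝ) ∈ LinearMap.ker φ.toLinearMap := by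
    rw [htop]; trivial
  have h4 : φ (Pi.single i 1) = 0 := h3
  rw [hφ] at h4
  simpa [Pi.single_apply] using h4

/-- The interior point is found first, for an arbitrary decomposition; it forces the `v i` to be
independent, and dim E^s = n then makes them a basis. Only at this stage is M^t an automorphism `L`
of ℝ^n, which gives self-affinity of the limit map and transfers regularity to its image by `L`, the
map `F`. -/
lemma PrimitiveProper.regular_of_isDecomposition (h : PrimitiveProper ξ ℓ t) (hper : NoPeriod ξ)
    (hn : Module.finrank ℝ (stableSpace ξ) = n) {α : Fin n → ℝ}
    (hα : LinearIndependent ℚ (Fin.cons 1 α : Fin (n + 1) → ℝ)) {v w : Fin n → A → ℝ}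
    (hd : ∀ i, IsDecomposition ξ (α i) (v i) (w i)) :
    TendstoUniformly
      (fun (N : ℕ) (x : Omega ξ) => ∑ k ∈ Finset.range N, seriesTerm ξ v (k + 1) x)
      (F ξ v) atTop ∧
    ∀ c : Set (Omega ξ), IsClopen c → IsRegularSet (F ξ v '' c) := by
  have hvs : ∀ i, v i ∈ stableSpace ξ := fun i => (hd i).2.1
  have hV : SummableWeight ξ fun a i => v i a :=
    summableWeight_of_contracted fun i => (Submodule.mem_inf.1 (hvs i)).1
  have hBV : SummableWeight ξ fun a => wt (fun b i => v i b) (ξ a) := by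
    have := hV.iterate 1
    simpa only [iter_one] using this
  have hF : F ξ v = fun x => limitMap ξ (fun a => wt (fun b i => v i b) (ξ a)) x.1 := by
    ext1 x
    unfold F limitMap
    congr 1
    ext1 k
    exact h.seriesTerm_eq hper v k x
  obtain ⟨m, hm⟩ := (eventually_all.2 fun i => isDecomposition_integral_of_le (hd i)).exists
  obtain ⟨b, hb⟩ := h.exists_nonempty_interior hper hV (W := fun a i => w i a) (α := α) (m := m)
    (fun a => funext fun i => ((hd i).1 a).symm) (fun a i => by
      obtain ⟨z, hz⟩ := hm i a
      refine ⟨z, ?_⟩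
      rw [← hz]
      exact (map_wt (Pi.evalAddMonoidHom (fun _ : Fin n => ℝ) i) (fun a i => w i a) _).symm) hα
  let v' : Fin n → stableSpace ξ := fun i => ⟨v i, hvs i⟩
  have hind : LinearIndependent ℝ v' := h.linearIndependent_of_interior hper hV hb
  obtain ⟨L, hL⟩ := exists_equiv_of_linearIndependent hind hn
  have hL' : ∀ a, wt (fun b i => v i b) (ξ a) = L fun i => v i a := hL
  constructor
  · simp only [hF, h.seriesTerm_eq hper]
    exact h.tendstoUniformly_limitMap hper hBV
  · intro c hc
    have h1 := (h.isRegularSet_image_limitMap hper hV hL' hb hc).image L.toHomeomorph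
    convert h1 using 1
    rw [hF, Set.image_image]
    refine Set.image_congr fun x _ => ?_
    simp only [hL'] at hBV ⊢
    exact h.limitMap_map hper hV (L : (Fin n → ℝ) →L[ℝ] (Fin n → ℝ)) hBV x.2

end Final

end PisotRegular

theorem mainTheorem5 {A : Type*} [Fintype A] [DecidableEq A]
    [TopologicalSpace A] [DiscreteTopology A] [MeasurableSpace A] [MeasurableSingletonClass A]
    (ξ : A → List A) (hsub : PisotRegular.IsSubstitution ξ)
    (hprim : PisotRegular.IsPrimitiveSubst ξ) (hprop : PisotRegular.IsProper ξ)
    (μ : Measure (PisotRegular.Omega ξ)) [IsProbabilityMeasure μ]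
    (hμ : MeasurePreserving (PisotRegular.shift ξ) μ μ)
    (hI : PisotRegular.HypI ξ)
    {n : ℕ} (α : Fin n → ℝ) (hII : PisotRegular.HypII ξ μ α) :
    (∃ v w : Fin n → A → ℝ, ∀ i, PisotRegular.IsDecomposition ξ (α i) (v i) (w i)) ∧
    ∀ v w : Fin n → A → ℝ, (∀ i, PisotRegular.IsDecomposition ξ (α i) (v i) (w i)) →
      TendstoUniformly
        (fun (N : ℕ) (x : PisotRegular.Omega ξ) =>
          ∑ k ∈ Finset.range N, PisotRegular.seriesTerm ξ v (k + 1) x)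
        (PisotRegular.F ξ v) atTop ∧
      ∀ c : Set (PisotRegular.Omega ξ), IsClopen c →
        PisotRegular.IsRegularSet (PisotRegular.F ξ v '' c) := by
  obtain ⟨ℓ, t, h⟩ := PisotRegular.exists_primitiveProper hsub hprim hprop
  obtain ⟨hn, hev, hα⟩ := hII
  constructor
  · have hex := fun i => PisotRegular.exists_isDecomposition fun b =>
      PisotRegular.tendsto_frac_of_isEigenvalue h μ hμ (hev i) b
    choose v w hvw using hex
    exact ⟨v, w, hvw⟩
  · intro v w hd
    -- Without any `α` the subshift may be periodic and recognizability may fail, but ℝ^0 is a point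
    -- and nothing is left to prove.
    rcases Nat.eq_zero_or_pos n with rfl | hpos
    · refine ⟨?_, fun c _ => PisotRegular.isRegularSet_of_subsingleton _⟩
      rw [Metric.tendstoUniformly_iff]
      intro ε hε
      refine Eventually.of_forall fun N x => ?_
      rwa [Subsingleton.elim (PisotRegular.F ξ v x) _, dist_self]
    · refine h.regular_of_isDecomposition ?_ hn hα hd
      refine PisotRegular.noPeriod_of_isEigenvalue hμ (hev ⟨0, hpos⟩) fun p m hpm => ?_
      have := PisotRegular.int_relation_trivial hα (k := Pi.single ⟨0, hpos⟩ (p : ℤ)) (m := m)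
        (by simpa [Pi.single_apply] using hpm)
      simpa using congrFun this ⟨0, hpos⟩
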